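/- Consider a third-order evolution equation $$u_t = F(t,x,u,u_1,u_2)\,u_3 + G(t,x,u,u_1,u_2),\qquad u_k=\partial_x^k u, \qquad (1)$$ where $F,G$ are smooth real functions on an open set $J\subseteq\mathbb R^5$ and $F$ vanishes nowhere on $J$. Let $\Omega\subseteq\mathbb R^3$ be the projection of $J$ to the space of $(t,x,u)$. Let $\mathsf A$ be an abelian Lie algebra of smooth vector fields $Q=\xi^0\partial_t+\xi^1\partial_x+\eta\,\partial_u$ on $\Omega$ (coefficients functions of $(t,x,u)$), with basis $(Q_i)_{i\in I}$, all of which are infinitesimal point symmetries of (1), i.e. the third prolongation of $Q_i$ annihilates $u_t-Fu_3-G$ wherever $u_t-Fu_3-G=0$. As usual for local Lie algebras of vector fields, linear independence of the $Q_i$ over $\mathbb R$ is understood for germs: the restrictions of the $Q_i$ to every non-empty open subset of $\Omega$ are linearly independent. The rank of $\mathsf A$ is the smallest positive integer $r$ such that all wedge products $Q_{i_1}\wedge\dots\wedge Q_{i_{r+1}}$ vanish on $\Omega$. If $\dim\mathsf A\ge 4$ (possibly infinite), or if $\dim\mathsf A=3$ and $\operatorname{rank}\mathsf A=1$, then (1)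 is (locally, at generic points) linearizable: there is an open dense subset $O$ of $J$ such that on a neighbourhood of each point of $O$ an equivalence transformation $$t'=T(t),\quad x'=X(t,x,u),\quad u'=U(t,x,u)$$ (smooth with smooth inverse, and with $X_x+u_1X_u\neq0$ on that neighbourhood) takes (1) to a linear equation $$u'_{t'}=f\,u'_3+h_2\,u'_2+h_1\,u'_1+h_0\,u'+g,$$ where $f,h_2,h_1,h_0,g$ are smooth functions of $(t',x')$ and $f$ vanishes nowhere. -/

import Mathlib

open Set Filter Topology
open scoped ContDiff

namespace EvolutionEq

/-- The space of independent and dependent variables, with coordinates `(t, x, u)`. -/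
abbrev Pt : Type := ℝ × ℝ × ℝ

/-- The space with coordinates `(t, x, u, u₁, u₂)`, where `u₁ = u_x` and `u₂ = u_xx`. -/
abbrev Jet : Type := ℝ × ℝ × ℝ × ℝ × ℝ

/-- The projection `(t, x, u, u₁, u₂) ↦ (t, x, u)`. -/
def base (j : Jet) : Pt := (j.1, j.2.1, j.2.2.1)

/-- The partial derivative `∂w/∂t` of a function `w (t, x)`. -/
noncomputable def dt (w : ℝ × ℝ → ℝ) : ℝ × ℝ → ℝ := fun z => fderiv ℝ w z (1, 0)

/-- The partial derivative `∂w/∂x` of a function `w (t, x)`. -/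
noncomputable def dx (w : ℝ × ℝ → ℝ) : ℝ × ℝ → ℝ := fun z => fderiv ℝ w z (0, 1)

/-- The point `(t, x, w (t, x))` of the graph of `w`. -/
def graphPt (w : ℝ × ℝ → ℝ) (z : ℝ × ℝ) : Pt := (z.1, z.2, w z)

/-- The point `(t, x, w, w_x, w_xx)` determined by `w` at `z = (t, x)`. -/
noncomputable def jet (w : ℝ × ℝ → ℝ) (z : ℝ × ℝ) : Jet :=
  (z.1, z.2, w z, dx w z, dx (dx w) z)

/-- The equation `u_t = F (t, x, u, u₁, u₂) u₃ + G (t, x, u, u₁, u₂)` holds for `u = w` at the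
point `z = (t, x)`. -/
def HoldsAt (F G : Jet → ℝ) (w : ℝ × ℝ → ℝ) (z : ℝ × ℝ) : Prop :=
  dt w z = F (jet w z) * dx (dx (dx w)) z + G (jet w z)

/-! ### Infinitesimal point symmetries

A vector field `Q = ξ⁰ ∂_t + ξ¹ ∂_x + η ∂_u` is a map `Q : Pt → Pt`, `Q = (ξ⁰, ξ¹, η)`; all three
components are functions of `(t, x, u)`. Functions on jet spaces are evaluated on the jets of
functions `w (t, x)`, so that total derivatives become partial derivatives. -/

/-- The characteristic `Σ = η - u_t ξ⁰ - u_x ξ¹` of `Q`, along the function `w`. -/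
noncomputable def characteristic (Q : Pt → Pt) (w : ℝ × ℝ → ℝ) (z : ℝ × ℝ) : ℝ :=
  (Q (graphPt w z)).2.2 - dt w z * (Q (graphPt w z)).1 - dx w z * (Q (graphPt w z)).2.1

/-- The coefficient `D Σ + ξ⁰ D u_t + ξ¹ D u_x` of the prolongation of `Q` at the jet of `w`, where
`D` is one of the differential operators `D_t`, `D_x`, `D_x D_x`, `D_x D_x D_x`. -/
noncomputable def prolongationCoeff (D : (ℝ × ℝ → ℝ) → (ℝ × ℝ → ℝ)) (Q : Pt → Pt)
    (w : ℝ × ℝ → ℝ) (z : ℝ × ℝ) : ℝ :=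
  D (characteristic Q w) z + D (dt w) z * (Q (graphPt w z)).1
    + D (dx w) z * (Q (graphPt w z)).2.1

/-- The components of the second prolongation of `Q` in the directions `(t, x, u, u₁, u₂)`. -/
noncomputable def prolongedVector (Q : Pt → Pt) (w : ℝ × ℝ → ℝ) (z : ℝ × ℝ) : Jet :=
  ((Q (graphPt w z)).1, (Q (graphPt w z)).2.1, (Q (graphPt w z)).2.2,
    prolongationCoeff dx Q w z, prolongationCoeff (fun f => dx (dx f)) Q w z)

/-- `Q` is an infinitesimal point symmetry of `u_t = F u₃ + G` over the open set `J`: the third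
prolongation of `Q` annihilates `u_t - F u₃ - G` wherever `u_t - F u₃ - G = 0`. Every point of the
third-order jet space is the jet of a smooth function `w`. -/
def IsPointSymmetry (J : Set Jet) (F G : Jet → ℝ) (Q : Pt → Pt) : Prop :=
  ∀ w : ℝ × ℝ → ℝ, ContDiff ℝ ∞ w → ∀ z : ℝ × ℝ, jet w z ∈ J → HoldsAt F G w z →
    prolongationCoeff dt Q w z
      - fderiv ℝ F (jet w z) (prolongedVector Q w z) * dx (dx (dx w)) z
      - F (jet w z) * prolongationCoeff (fun f => dx (dx (dx f))) Q w z
      - fderiv ℝ G (jet w z) (prolongedVector Q w z) = 0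

/-- The vector fields `Q i` form a basis of an abelian Lie algebra of infinitesimal point symmetries
of `u_t = F u₃ + G`. Lie algebras of vector fields are understood locally: linear independence (over
the constants) is required of the germs of the `Q i` at every point, that is, of their restrictions
to every non-empty open subset of the domain `base '' J`. -/
structure IsAbelianSymmetryAlgebra {ι : Type*} (J : Set Jet) (F G : Jet → ℝ)
    (Q : ι → Pt → Pt) : Prop where
  smooth : ∀ i, ContDiffOn ℝ ∞ (Q i) (base '' J)
  symmetry : ∀ i, IsPointSymmetry J F G (Q i)
  abelian : ∀ i k, ∀ p ∈ base '' J, VectorField.lieBracket ℝ (Q i) (Q k) p = 0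
  independent : ∀ V : Set Pt, IsOpen V → V.Nonempty → V ⊆ base '' J →
    LinearIndependent ℝ (fun i (p : V) => Q i p)

/-- The rank of a family of vector fields on `Ω`: the smallest positive integer `r` such that all
`(r + 1)`-fold wedge products of its members vanish on `Ω`. -/
noncomputable def rank {ι : Type*} (Ω : Set Pt) (Q : ι → Pt → Pt) : ℕ :=
  sInf {r : ℕ | 0 < r ∧ ∀ i : Fin (r + 1) → ι, ∀ p ∈ Ω,
    ExteriorAlgebra.ιMulti ℝ (r + 1) (fun k => Q (i k) p) = 0}

/-! ### Linearizability -/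

/-- A (local) equivalence transformation `t' = T(t)`, `x' = X(t, x, u)`, `u' = U(t, x, u)`: smooth
with smooth inverse. -/
structure IsEquivalenceTransformation (e : OpenPartialHomeomorph Pt Pt) : Prop where
  smooth : ContDiffOn ℝ ∞ e e.source
  smooth_symm : ContDiffOn ℝ ∞ e.symm e.target
  time : ∃ T : ℝ → ℝ, ∀ p ∈ e.source, (e p).1 = T p.1

/-- The pair `(t', x')` of new independent variables at a point `(t, x, u)`. -/
def newVars (e : OpenPartialHomeomorph Pt Pt) (p : Pt) : ℝ × ℝ := ((e p).1, (e p).2.1)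

/-- `e` transforms the equation `u_t = F u₃ + G`, over the open set `W`, to the equation
`u'_{t'} = F' u'₃ + G'`. The condition `D_x X = X_x + u₁ X_u ≠ 0` says that the image under `e` of
the graph of a function whose jet lies in `W` is again, locally, the graph of a function. If the
image of the graph of `w` is the graph of `v`, then `w` satisfies the first equation at a point if
and only if `v` satisfies the second one at the corresponding point. -/
structure Transforms (e : OpenPartialHomeomorph Pt Pt) (W : Set Jet) (F G F' G' : Jet → ℝ) :
    Prop where
  dom : ∀ j ∈ W, base j ∈ e.source
  transversal : ∀ j ∈ W, fderiv ℝ (fun p => (e p).2.1) (base j) (0, 1, j.2.2.2.1) ≠ 0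
  holds_iff : ∀ (w v : ℝ × ℝ → ℝ) (z : ℝ × ℝ), ContDiffAt ℝ ∞ w z → jet w z ∈ W →
    ContDiffAt ℝ ∞ v (newVars e (graphPt w z)) →
    (∀ᶠ y in 𝓝 z, v (newVars e (graphPt w y)) = (e (graphPt w y)).2.2) →
    (HoldsAt F G w z ↔ HoldsAt F' G' v (newVars e (graphPt w z)))

/-- The equation `u_t = F u₃ + G` is linearizable near the point `j`: on a neighbourhood of `j` some
equivalence transformation takes it to a linear third-order equation
`u_t = f u₃ + h₂ u₂ + h₁ u₁ + h₀ u + g` whose coefficients are smooth functions of `(t, x)`, with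
`f` nowhere zero. -/
def LinearizableNear (F G : Jet → ℝ) (j : Jet) : Prop :=
  ∃ (W : Set Jet) (e : OpenPartialHomeomorph Pt Pt) (f h₂ h₁ h₀ g : ℝ × ℝ → ℝ),
    IsOpen W ∧ j ∈ W ∧ IsEquivalenceTransformation e ∧
    ContDiffOn ℝ ∞ f (newVars e '' e.source) ∧
    ContDiffOn ℝ ∞ h₂ (newVars e '' e.source) ∧
    ContDiffOn ℝ ∞ h₁ (newVars e '' e.source) ∧
    ContDiffOn ℝ ∞ h₀ (newVars e '' e.source) ∧
    ContDiffOn ℝ ∞ g (newVars e '' e.source) ∧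
    (∀ y ∈ newVars e '' e.source, f y ≠ 0) ∧
    Transforms e W F G (fun k => f (k.1, k.2.1))
      (fun k => h₂ (k.1, k.2.1) * k.2.2.2.2 + h₁ (k.1, k.2.1) * k.2.2.2.1
        + h₀ (k.1, k.2.1) * k.2.2.1 + g (k.1, k.2.1))

end EvolutionEq

namespace EvolutionEq

/-! ### Calculus on open sets: constancy, local inversion, smooth antiderivatives. -/

section Calculus

variable {E : Type*} [NormedAddCommGroup E] [NormedSpace ℝ E]

/-! The proof reduces to three commuting symmetries with ξ⁰ = 0. Testing the symmetry condition on
functions that differ only in u_txx shows that ξ⁰ depends on t alone (`IsPointSymmetry.D_tauJ`). The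
∂_t-component of a vanishing bracket then makes the ξ⁰ of two symmetries proportional, with a
constant factor, wherever one of them is nonzero (`exists_fst_eq_const_mul`). So four symmetries
yield, locally, three independent combinations with ξ⁰ = 0. In rank one, a symmetry with ξ⁰ ≠ 0
would make every other one a constant multiple of itself, so ξ⁰ = 0 already.

Let Q₀, Q₁, Q₂ be three such symmetries. If Q₀ and Q₁ were not parallel, then Q₂ = a Q₀ + b Q₁;
commutation forces a and b to depend on t only, and the symmetry condition then gives a' = b' = 0
(`symmetry_combination`), against independence. Hence, locally, Q₁ = φ Q₀ and Q₂ = ψ Q₀, with Q₀ φ =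
Q₀ ψ = 0 by commutation. For the same reason φ is not a function of t alone, so x' = φ and u' = U
with Q₀ U = 1 are new coordinates in which the symmetries become ∂_u, x ∂_u and Ψ(t, x) ∂_u
(`Adapted`).

Let F', G' be the coefficients of the transformed equation. The first two symmetries say that F' and
G' do not depend on u and u₁. The third says Ψ_xx ∂F'/∂u₂ = 0 and Ψ_xx ∂G'/∂u₂ = Ψ_t - F' Ψ_xxx
(`prol_transformed`, `Adapted.action`). Where Ψ_xx ≠ 0 this makes F' a function of (t, x) and G'
affine in u₂, so the equation is linear (`Adapted.linearizableNear`). If Ψ_xx vanished identically,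
then Ψ_t = 0 as well (`Adapted.dt_eq_zero`), and Ψ would be an affine function of x with constant
coefficients, again against independence.

This produces one linearizable point. Since independence is required of germs, the hypotheses pass
to every non-empty open subset, so linearizable points are dense; linearizability is an open
condition. -/

theorem contDiffOn_fderiv_apply {S : Set E} (hS : IsOpen S) {f : E → ℝ} {B : E → E}
    (hf : ContDiffOn ℝ ∞ f S) (hB : ContDiffOn ℝ ∞ B S) :
    ContDiffOn ℝ ∞ (fun y => fderiv ℝ f y (B y)) S :=
  (hf.fderiv_of_isOpen hS (m := ∞) (by simp)).clm_apply hB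

theorem contDiffOn_fderiv_const {S : Set E} (hS : IsOpen S) {f : E → ℝ} (v : E)
    (hf : ContDiffOn ℝ ∞ f S) : ContDiffOn ℝ ∞ (fun y => fderiv ℝ f y v) S :=
  contDiffOn_fderiv_apply hS hf contDiffOn_const

theorem differentiableAt_of_contDiffOn {F : Type*} [NormedAddCommGroup F] [NormedSpace ℝ F]
    {S : Set E} (hS : IsOpen S) {f : E → F} (hf : ContDiffOn ℝ ∞ f S) {x : E} (hx : x ∈ S) :
    DifferentiableAt ℝ f x :=
  (hf.contDiffAt (hS.mem_nhds hx)).differentiableAt (by simp)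

/-- The commutator of two vector fields, as derivations, is given by their Lie bracket. -/
theorem fderiv_fderiv_sub {f : E → ℝ} {A B : E → E} {x : E} (hf : ContDiffAt ℝ ∞ f x)
    (hA : DifferentiableAt ℝ A x) (hB : DifferentiableAt ℝ B x) :
    fderiv ℝ (fun y => fderiv ℝ f y (B y)) x (A x) - fderiv ℝ (fun y => fderiv ℝ f y (A y)) x (B x)
      = fderiv ℝ f x (fderiv ℝ B x (A x) - fderiv ℝ A x (B x)) := by
  have hd : DifferentiableAt ℝ (fderiv ℝ f) x :=
    (hf.fderiv_right (m := ∞) (by simp)).differentiableAt (by simp)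
  have hs := (hf.isSymmSndFDerivAt (by simpa using WithTop.coe_le_coe.2 (le_top : (2 : ℕ∞) ≤ ⊤))).eq (A x) (B x)
  rw [fderiv_clm_apply hd hB, fderiv_clm_apply hd hA]
  simp [hs]

theorem eq_of_fderiv_eq_zero {S : Set E} (hS : IsOpen S) (hc : IsPreconnected S) {f : E → ℝ}
    (hf : ContDiffOn ℝ ∞ f S) (h : ∀ x ∈ S, fderiv ℝ f x = 0) {x y : E} (hx : x ∈ S)
    (hy : y ∈ S) : f x = f y :=
  hS.is_const_of_fderiv_eq_zero hc (hf.differentiableOn (by simp)) h hx hy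

/-- If the derivative of `f` vanishes in the direction `v` on a convex open set, `f` takes the same
value at two points which differ by a multiple of `v`. -/
theorem eq_of_fderiv_apply_eq_zero {S : Set E} (hS : IsOpen S) (hc : Convex ℝ S) {f : E → ℝ}
    (hf : ContDiffOn ℝ ∞ f S) {x y : E} (h : ∀ z ∈ S, fderiv ℝ f z (y - x) = 0) (hx : x ∈ S)
    (hy : y ∈ S) : f x = f y := by
  have key : ∀ s ∈ Icc (0 : ℝ) 1,
      HasDerivWithinAt (fun s : ℝ => f (x + s • (y - x))) 0 (Icc 0 1) s := by
    intro s hs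
    have hm : x + s • (y - x) ∈ S := hc.add_smul_sub_mem hx hy hs
    have h1 := (differentiableAt_of_contDiffOn hS hf hm).hasFDerivAt
    have h2 : HasDerivAt (fun s : ℝ => x + s • (y - x)) (y - x) s := by
      simpa using ((hasDerivAt_id s).smul_const (y - x)).const_add x
    have h3 := h1.comp_hasDerivAt s h2
    rw [h _ hm] at h3
    exact h3.hasDerivWithinAt
  have := constant_of_has_deriv_right_zero (f := fun s : ℝ => f (x + s • (y - x))) (a := 0) (b := 1)
    (fun s hs => (key s hs).continuousWithinAt)
    (fun s hs => ((key s ⟨hs.1, hs.2.le⟩).mono_of_mem_nhdsWithin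
      (Icc_mem_nhdsGE_of_mem hs))) 1 (by simp)
  simpa using this.symm

/-- A version of the inverse function theorem: a smooth map between open subsets of a finite
dimensional space is a local diffeomorphism where its derivative is injective. -/
theorem exists_localDiffeomorph [FiniteDimensional ℝ E] {S : Set E} (hS : IsOpen S) {f : E → E}
    (hf : ContDiffOn ℝ ∞ f S) {x : E} (hx : x ∈ S) (hi : ∀ v, fderiv ℝ f x v = 0 → v = 0) :
    ∃ e : OpenPartialHomeomorph E E, (e : E → E) = f ∧ x ∈ e.source ∧ e.source ⊆ S ∧
      ContDiffOn ℝ ∞ e.symm e.target := by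
  have : CompleteSpace E := FiniteDimensional.complete ℝ E
  have hinj : Function.Injective (fderiv ℝ f x) :=
    (injective_iff_map_eq_zero (fderiv ℝ f x)).2 hi
  obtain ⟨f', hf'⟩ : ∃ f' : E ≃L[ℝ] E, (f' : E →L[ℝ] E) = fderiv ℝ f x := by
    refine ⟨(LinearEquiv.ofInjectiveEndo (fderiv ℝ f x : E →ₗ[ℝ] E) hinj).toContinuousLinearEquiv,
      ?_⟩
    ext v
    simp
  have hfx := hf.contDiffAt (hS.mem_nhds hx)
  have hd : HasFDerivAt f (f' : E →L[ℝ] E) x := by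
    rw [hf']; exact (differentiableAt_of_contDiffOn hS hf hx).hasFDerivAt
  let e₀ := hfx.toOpenPartialHomeomorph f hd (by simp)
  have hcont : ContinuousOn (fderiv ℝ f) S := hf.continuousOn_fderiv_of_isOpen hS (by simp)
  -- Invertibility of the derivative is an open condition; restricting to `N` makes the inverse
  -- smooth on the whole target and not only at the image of `x`.
  let N : Set E := S ∩ fderiv ℝ f ⁻¹' range ((↑) : (E ≃L[ℝ] E) → E →L[ℝ] E)
  have hN : IsOpen N := hcont.isOpen_inter_preimage hS (ContinuousLinearEquiv.isOpen)
  refine ⟨e₀.restr N, by simp [e₀], ?_, ?_, ?_⟩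
  · rw [e₀.restr_source, hN.interior_eq]
    exact ⟨hfx.mem_toOpenPartialHomeomorph_source hd (by simp), hx, f', hf'⟩
  · rw [e₀.restr_source, hN.interior_eq]
    exact fun y hy => hy.2.1
  · intro y hy
    have hy' := (e₀.restr N).map_target hy
    rw [e₀.restr_source, hN.interior_eq] at hy'
    obtain ⟨g', hg'⟩ := hy'.2.2
    refine ((e₀.restr N).contDiffAt_symm (f₀' := g') hy ?_ ?_).contDiffWithinAt
    · rw [hg']
      exact (differentiableAt_of_contDiffOn hS hf hy'.2.1).hasFDerivAt
    · exact hf.contDiffAt (hS.mem_nhds hy'.2.1)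

open MeasureTheory in
/-- A smooth function with compact support has an antiderivative in its last variable which depends
smoothly on all variables. -/
theorem exists_contDiff_antiderivative {P : Type*} [NormedAddCommGroup P] [NormedSpace ℝ P]
    {g : P × ℝ → ℝ} (hg : ContDiff ℝ ∞ g) (hc : HasCompactSupport g) :
    ∃ V : P × ℝ → ℝ, ContDiff ℝ ∞ V ∧ ∀ p c, HasDerivAt (fun s => V (p, s)) (g (p, c)) c := by
  obtain ⟨R, hR⟩ := (hc.isCompact.image continuous_snd).isBounded.subset_closedBall 0
  have hz : ∀ p x, x ∉ Icc (-R) R → g (p, x) = 0 := by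
    intro p x hx
    by_contra h
    have := hR ⟨(p, x), subset_tsupport g h, rfl⟩
    rw [Real.closedBall_eq_Icc] at this
    simp at this hx
    linarith [hx this.1]
  -- The antiderivative is the convolution of g(p, ·) with the Heaviside function, so that joint
  -- smoothness follows from the theorem on convolutions with a parameter.
  let H : ℝ → ℝ := indicator (Ici 0) 1
  have hH : LocallyIntegrable H volume :=
    (locallyIntegrable_const (1 : ℝ)).indicator measurableSet_Ici
  have key := contDiffOn_convolution_right_with_param (μ := volume) (f := H) (n := ⊤)
    (ContinuousLinearMap.mul ℝ ℝ) (g := fun p x => g (p, x)) (s := univ) isOpen_univ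
    (isCompact_Icc (a := -R) (b := R)) (fun p x _ hx => hz p x hx) hH
    (hg.contDiffOn)
  rw [univ_prod_univ, contDiffOn_univ] at key
  refine ⟨_, key, fun p c => ?_⟩
  have hgc : Continuous fun s => g (p, s) := hg.continuous.comp (by fun_prop)
  -- The lower limit lies strictly to the left of the support: every c either exceeds -R - 1, or
  -- satisfies c < -R, where the convolution vanishes nearby.
  have heq : ∀ s, -R - 1 < s → MeasureTheory.convolution H (fun x => g (p, x))
      (ContinuousLinearMap.mul ℝ ℝ) volume s = ∫ y in (-R - 1)..s, g (p, y) := by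
    intro s hs
    rw [convolution_eq_swap, intervalIntegral.integral_of_le hs.le, ← integral_indicator
      measurableSet_Ioc]
    congr 1
    ext y
    simp only [H, indicator, mem_Ici, mem_Ioc, sub_nonneg, ContinuousLinearMap.mul_apply',
      Pi.one_apply]
    by_cases h1 : y ≤ s
    · by_cases h2 : -R - 1 < y
      · simp [h1, h2]
      · have : y ∉ Icc (-R) R := fun h => by linarith [h.1]
        simp [hz p y this]
    · simp [h1]
  by_cases hcR : -R - 1 < c
  · have := (intervalIntegral.integral_hasDerivAt_right (hgc.intervalIntegrable (-R - 1) c)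
      hgc.stronglyMeasurable.stronglyMeasurableAtFilter hgc.continuousAt)
    refine this.congr_of_eventuallyEq ?_
    filter_upwards [lt_mem_nhds hcR] with s hs
    exact heq s hs
  · have hlt : c < -R := by linarith
    have h0 : g (p, c) = 0 := hz p c fun h => by linarith [h.1]
    rw [h0]
    refine (hasDerivAt_const c (0 : ℝ)).congr_of_eventuallyEq ?_
    filter_upwards [gt_mem_nhds hlt] with s hs
    rw [convolution_eq_swap]
    refine integral_eq_zero_of_ae (ae_of_all _ fun y => ?_)
    simp only [H, indicator, mem_Ici, sub_nonneg, ContinuousLinearMap.mul_apply', Pi.one_apply,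
      Pi.zero_apply]
    by_cases h1 : y ≤ s
    · have : y ∉ Icc (-R) R := fun h => by linarith [h.1]
      simp [hz p y this]
    · simp [h1]

end Calculus

/-! ### Product rules for functions of (t, x). -/

section PlaneFunctions

variable {f g h p a r b : ℝ × ℝ → ℝ} {z : ℝ × ℝ}

theorem eventually_differentiableAt {E F : Type*} [NormedAddCommGroup E]
    [NormedSpace ℝ E] [NormedAddCommGroup F] [NormedSpace ℝ F] {f : E → F} {z : E}
    (hf : ContDiffAt ℝ ∞ f z) : ∀ᶠ y in 𝓝 z, DifferentiableAt ℝ f y := by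
  have h1 : ContDiffAt ℝ 1 f z := hf.of_le (by simp)
  filter_upwards [h1.eventually (by simp)] with y hy
  exact hy.differentiableAt (by simp)

theorem contDiffAt_dx (hf : ContDiffAt ℝ ∞ f z) : ContDiffAt ℝ ∞ (dx f) z :=
  (hf.fderiv_right (m := ∞) (by simp)).clm_apply contDiffAt_const

theorem contDiffAt_dt (hf : ContDiffAt ℝ ∞ f z) : ContDiffAt ℝ ∞ (dt f) z :=
  (hf.fderiv_right (m := ∞) (by simp)).clm_apply contDiffAt_const

theorem dx_congr (h : f =ᶠ[𝓝 z] g) : dx f z = dx g z := by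
  unfold dx; rw [h.fderiv_eq]

theorem dt_congr (h : f =ᶠ[𝓝 z] g) : dt f z = dt g z := by
  unfold dt; rw [h.fderiv_eq]

theorem dx_eventuallyEq (h : f =ᶠ[𝓝 z] g) : dx f =ᶠ[𝓝 z] dx g := by
  filter_upwards [h.eventuallyEq_nhds] with y hy using dx_congr hy

theorem dx_sub_mul (hh : ContDiffAt ℝ ∞ h z) (hp : ContDiffAt ℝ ∞ p z)
    (ha : ContDiffAt ℝ ∞ a z) : dx (fun y => h y - p y * a y) =ᶠ[𝓝 z]
      fun y => dx h y - dx p y * a y - p y * dx a y := by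
  filter_upwards [eventually_differentiableAt hh, eventually_differentiableAt hp,
    eventually_differentiableAt ha] with y h1 h2 h3
  unfold dx
  rw [fderiv_fun_sub h1 (h2.fun_mul h3), fderiv_fun_mul h2 h3]
  simp
  ring

theorem dt_sub_mul (hh : ContDiffAt ℝ ∞ h z) (hp : ContDiffAt ℝ ∞ p z)
    (ha : ContDiffAt ℝ ∞ a z) : dt (fun y => h y - p y * a y) z
      = dt h z - dt p z * a z - p z * dt a z := by
  have h1 := hh.differentiableAt (by simp)
  have h2 := hp.differentiableAt (by simp)
  have h3 := ha.differentiableAt (by simp)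
  unfold dt
  rw [fderiv_fun_sub h1 (h2.fun_mul h3), fderiv_fun_mul h2 h3]
  simp
  ring

/-- The shape C - p ξ⁰ - r ξ¹ of the characteristic is stable under ∂_x: p and r are replaced by
their derivatives and the remaining terms are absorbed in the new C. Iterating this gives the
prolongation formulas. -/
theorem dx_prolongation_step {S C : ℝ × ℝ → ℝ} (hS : S =ᶠ[𝓝 z] fun y => C y - p y * a y - r y * b y)
    (hC : ContDiffAt ℝ ∞ C z) (hp : ContDiffAt ℝ ∞ p z) (ha : ContDiffAt ℝ ∞ a z)
    (hr : ContDiffAt ℝ ∞ r z) (hb : ContDiffAt ℝ ∞ b z) :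
    dx S =ᶠ[𝓝 z] fun y => (dx C y - p y * dx a y - r y * dx b y) - dx p y * a y - dx r y * b y := by
  filter_upwards [dx_eventuallyEq hS, dx_sub_mul (hC.sub (hp.mul ha)) hr hb, dx_sub_mul hC hp ha]
    with y h1 h2 h3
  have h2' : dx (fun y => C y - p y * a y - r y * b y) y = _ := h2
  rw [h1, h2', h3]
  ring

end PlaneFunctions

/-! ### Total derivatives on the jet space and the order of a function. -/

section Jets

/-- The direction `∂/∂u` in the jet space. -/
def uDir : Jet := (0, 0, 1, 0, 0)

/-- The direction `∂/∂u₁` in the jet space. -/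
def u₁Dir : Jet := (0, 0, 0, 1, 0)

/-- The direction `∂/∂u₂` in the jet space. -/
def u₂Dir : Jet := (0, 0, 0, 0, 1)

/-- The total `x`-derivative as a vector field on the jet space, with `s` in place of `u₃`. -/
def tot (s : ℝ) (j : Jet) : Jet := (0, 1, j.2.2.2.1, j.2.2.2.2, s)

/-- The total `x`-derivative of a function on the jet space, without its part in direction `u₂`. -/
noncomputable def D (f : Jet → ℝ) (j : Jet) : ℝ := fderiv ℝ f j (tot 0 j)

theorem tot_eq (s : ℝ) (j : Jet) : tot s j = tot 0 j + s • u₂Dir := by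
  simp [tot, u₂Dir]

theorem fderiv_tot_eq (f : Jet → ℝ) (s : ℝ) (j : Jet) :
    fderiv ℝ f j (tot s j) = D f j + s * fderiv ℝ f j u₂Dir := by
  rw [tot_eq, map_add, map_smul, smul_eq_mul, D]

theorem contDiff_tot (s : ℝ) : ContDiff ℝ ∞ (tot s) := by unfold tot; fun_prop

theorem hasFDerivAt_tot (s : ℝ) (j v : Jet) :
    fderiv ℝ (tot s) j v = (0, 0, v.2.2.2.1, v.2.2.2.2, 0) := by
  let p1 : Jet →L[ℝ] ℝ := (ContinuousLinearMap.fst ℝ ℝ ℝ).comp ((ContinuousLinearMap.snd ℝ ℝ _).comp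
    ((ContinuousLinearMap.snd ℝ ℝ _).comp (ContinuousLinearMap.snd ℝ ℝ _)))
  let p2 : Jet →L[ℝ] ℝ := (ContinuousLinearMap.snd ℝ ℝ ℝ).comp ((ContinuousLinearMap.snd ℝ ℝ _).comp
    ((ContinuousLinearMap.snd ℝ ℝ _).comp (ContinuousLinearMap.snd ℝ ℝ _)))
  have h : HasFDerivAt (tot s) ((0 : Jet →L[ℝ] ℝ).prod ((0 : Jet →L[ℝ] ℝ).prod
      (p1.prod (p2.prod 0)))) j :=
    (hasFDerivAt_const _ _).prodMk ((hasFDerivAt_const _ _).prodMk (p1.hasFDerivAt.prodMk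
      (p2.hasFDerivAt.prodMk (hasFDerivAt_const _ _))))
  rw [h.fderiv]
  simp [p1, p2]

variable {J : Set Jet} {f : Jet → ℝ}

theorem contDiffOn_D (hJ : IsOpen J) (hf : ContDiffOn ℝ ∞ f J) : ContDiffOn ℝ ∞ (D f) J :=
  contDiffOn_fderiv_apply hJ hf (contDiff_tot 0).contDiffOn

theorem fderiv_congr_on (hJ : IsOpen J) {g : Jet → ℝ} (h : ∀ j ∈ J, f j = g j) {j : Jet}
    (hj : j ∈ J) : fderiv ℝ f j = fderiv ℝ g j :=
  Filter.EventuallyEq.fderiv_eq (by filter_upwards [hJ.mem_nhds hj] with y hy using h y hy)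

theorem fderiv_zero_on (hJ : IsOpen J) (h : ∀ j ∈ J, f j = 0) {j : Jet}
    (hj : j ∈ J) : fderiv ℝ f j = 0 := by
  rw [fderiv_congr_on hJ (g := fun _ => 0) h hj]; simp

/-- `∂_{u₂} D f = D ∂_{u₂} f + ∂_{u₁} f`. -/
theorem fderiv_D_u₂Dir (hJ : IsOpen J) (hf : ContDiffOn ℝ ∞ f J) {j : Jet} (hj : j ∈ J) :
    fderiv ℝ (D f) j u₂Dir = D (fun y => fderiv ℝ f y u₂Dir) j + fderiv ℝ f j u₁Dir := by
  have h := fderiv_fderiv_sub (A := fun _ => u₂Dir) (B := tot 0) (hf.contDiffAt (hJ.mem_nhds hj))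
    (differentiableAt_const _) ((contDiff_tot 0).differentiable (by simp) j)
  rw [hasFDerivAt_tot] at h
  have h' : (0, 0, u₂Dir.2.2.2.1, u₂Dir.2.2.2.2, 0) - fderiv ℝ (fun _ : Jet => u₂Dir) j (tot 0 j)
      = u₁Dir := by simp [u₂Dir, u₁Dir]
  rw [h'] at h
  change fderiv ℝ (fun y => fderiv ℝ f y (tot 0 y)) j u₂Dir = _
  unfold D
  linarith

/-- `∂_{u₁} D f = D ∂_{u₁} f + ∂_u f`. -/
theorem fderiv_D_u₁Dir (hJ : IsOpen J) (hf : ContDiffOn ℝ ∞ f J) {j : Jet} (hj : j ∈ J) :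
    fderiv ℝ (D f) j u₁Dir = D (fun y => fderiv ℝ f y u₁Dir) j + fderiv ℝ f j uDir := by
  have h := fderiv_fderiv_sub (A := fun _ => u₁Dir) (B := tot 0) (hf.contDiffAt (hJ.mem_nhds hj))
    (differentiableAt_const _) ((contDiff_tot 0).differentiable (by simp) j)
  rw [hasFDerivAt_tot] at h
  have h' : (0, 0, u₁Dir.2.2.2.1, u₁Dir.2.2.2.2, 0) - fderiv ℝ (fun _ : Jet => u₁Dir) j (tot 0 j)
      = uDir := by simp [u₁Dir, uDir]
  rw [h'] at h
  change fderiv ℝ (fun y => fderiv ℝ f y (tot 0 y)) j u₁Dir = _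
  unfold D
  linarith

/-- `f` is a smooth function of `(t, x, u, u₁)`, as far as derivatives can tell. -/
structure OrderOne (J : Set Jet) (f : Jet → ℝ) : Prop where
  smooth : ContDiffOn ℝ ∞ f J
  u₂ : ∀ j ∈ J, fderiv ℝ f j u₂Dir = 0

/-- `f` is a smooth function of `(t, x, u)`, as far as derivatives can tell. -/
structure OrderZero (J : Set Jet) (f : Jet → ℝ) : Prop extends OrderOne J f where
  u₁ : ∀ j ∈ J, fderiv ℝ f j u₁Dir = 0

/-- The commutator of ∂_{u₂} with `D` is ∂_{u₁}, so differentiating a function of (t, x, u) brings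
in u₁ but not u₂. -/
theorem OrderZero.D (hJ : IsOpen J) (hf : OrderZero J f) : OrderOne J (D f) where
  smooth := contDiffOn_D hJ hf.smooth
  u₂ j hj := by
    rw [fderiv_D_u₂Dir hJ hf.smooth hj, hf.u₁ j hj, EvolutionEq.D, fderiv_zero_on hJ hf.u₂ hj]
    simp

theorem OrderZero.fderiv_D_u₁Dir (hJ : IsOpen J) (hf : OrderZero J f) {j : Jet} (hj : j ∈ J) :
    fderiv ℝ (EvolutionEq.D f) j u₁Dir = fderiv ℝ f j uDir := by
  rw [EvolutionEq.fderiv_D_u₁Dir hJ hf.smooth hj, EvolutionEq.D, fderiv_zero_on hJ hf.u₁ hj]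
  simp

theorem OrderOne.fderiv_D_u₂Dir (hJ : IsOpen J) (hf : OrderOne J f) {j : Jet} (hj : j ∈ J) :
    fderiv ℝ (EvolutionEq.D f) j u₂Dir = fderiv ℝ f j u₁Dir := by
  rw [EvolutionEq.fderiv_D_u₂Dir hJ hf.smooth hj, EvolutionEq.D, fderiv_zero_on hJ hf.u₂ hj]
  simp

theorem OrderOne.fderiv_tot (hf : OrderOne J f) {j : Jet} (hj : j ∈ J) (s : ℝ) :
    fderiv ℝ f j (tot s j) = EvolutionEq.D f j := by
  rw [fderiv_tot_eq, hf.u₂ j hj, mul_zero, add_zero]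

/-- `base` as a continuous linear map. -/
noncomputable def baseL : Jet →L[ℝ] Pt :=
  (ContinuousLinearMap.fst ℝ ℝ _).prod (((ContinuousLinearMap.fst ℝ ℝ _).comp
    (ContinuousLinearMap.snd ℝ ℝ _)).prod ((ContinuousLinearMap.fst ℝ ℝ _).comp
      ((ContinuousLinearMap.snd ℝ ℝ _).comp (ContinuousLinearMap.snd ℝ ℝ _))))

theorem coe_baseL : ⇑baseL = base := rfl

theorem contDiff_base : ContDiff ℝ ∞ base := baseL.contDiff

theorem isOpen_base_image (hJ : IsOpen J) : IsOpen (base '' J) := by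
  rw [← coe_baseL]
  exact baseL.isOpenMap (fun p => ⟨(p.1, p.2.1, p.2.2, 0, 0), rfl⟩) J hJ

theorem fderiv_comp_base {φ : Pt → ℝ} {j : Jet} (h : DifferentiableAt ℝ φ (base j)) (v : Jet) :
    fderiv ℝ (fun j => φ (base j)) j v = fderiv ℝ φ (base j) (base v) := by
  have h1 : HasFDerivAt φ (fderiv ℝ φ (base j)) (baseL j) := h.hasFDerivAt
  have := h1.comp j baseL.hasFDerivAt
  change HasFDerivAt (fun j => φ (base j)) _ j at this
  rw [this.fderiv]
  rfl

theorem orderZero_comp_base (hJ : IsOpen J) {φ : Pt → ℝ} (hφ : ContDiffOn ℝ ∞ φ (base '' J)) :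
    OrderZero J (fun j => φ (base j)) where
  smooth := hφ.comp contDiff_base.contDiffOn (fun j hj => mem_image_of_mem _ hj)
  u₂ j hj := by
    rw [fderiv_comp_base (differentiableAt_of_contDiffOn (isOpen_base_image hJ) hφ
      (mem_image_of_mem _ hj))]
    exact map_zero _
  u₁ j hj := by
    rw [fderiv_comp_base (differentiableAt_of_contDiffOn (isOpen_base_image hJ) hφ
      (mem_image_of_mem _ hj))]
    exact map_zero _

section AlongFunctions

variable {w : ℝ × ℝ → ℝ} {z : ℝ × ℝ}

theorem contDiffAt_jet (hw : ContDiffAt ℝ ∞ w z) : ContDiffAt ℝ ∞ (jet w) z :=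
  contDiffAt_fst.prodMk (contDiffAt_snd.prodMk (hw.prodMk ((contDiffAt_dx hw).prodMk
    (contDiffAt_dx (contDiffAt_dx hw)))))

theorem fderiv_jet (hw : ContDiffAt ℝ ∞ w z) (v : ℝ × ℝ) :
    fderiv ℝ (jet w) z v = (v.1, v.2, fderiv ℝ w z v, fderiv ℝ (dx w) z v,
      fderiv ℝ (dx (dx w)) z v) := by
  have h0 := (hw.differentiableAt (by simp)).hasFDerivAt
  have h1 := ((contDiffAt_dx hw).differentiableAt (by simp)).hasFDerivAt
  have h2 := ((contDiffAt_dx (contDiffAt_dx hw)).differentiableAt (by simp)).hasFDerivAt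
  have : HasFDerivAt (jet w) _ z :=
    hasFDerivAt_fst.prodMk (hasFDerivAt_snd.prodMk (h0.prodMk (h1.prodMk h2)))
  rw [this.fderiv]
  rfl

theorem fderiv_comp_jet (hw : ContDiffAt ℝ ∞ w z) (hf : DifferentiableAt ℝ f (jet w z))
    (v : ℝ × ℝ) : fderiv ℝ (fun y => f (jet w y)) z v
      = fderiv ℝ f (jet w z) (fderiv ℝ (jet w) z v) := by
  have := hf.hasFDerivAt.comp z ((contDiffAt_jet hw).differentiableAt (by simp)).hasFDerivAt
  change HasFDerivAt (fun y => f (jet w y)) _ z at this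
  rw [this.fderiv]
  rfl

theorem dx_comp_jet (hw : ContDiffAt ℝ ∞ w z) (hf : DifferentiableAt ℝ f (jet w z)) :
    dx (fun y => f (jet w y)) z = fderiv ℝ f (jet w z) (tot (dx (dx (dx w)) z) (jet w z)) := by
  rw [dx, fderiv_comp_jet hw hf, fderiv_jet hw]
  rfl

theorem OrderOne.dx_comp_jet (hJ : IsOpen J) (hf : OrderOne J f) (hw : ContDiffAt ℝ ∞ w z)
    (hz : jet w z ∈ J) : dx (fun y => f (jet w y)) z = EvolutionEq.D f (jet w z) := by
  rw [EvolutionEq.dx_comp_jet hw (differentiableAt_of_contDiffOn hJ hf.smooth hz), hf.fderiv_tot hz]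

/-- The mixed derivatives u_tx and u_txx enter only along the directions ∂_{u₁} and ∂_{u₂}, which do
not see a function of order zero. -/
theorem OrderZero.dt_comp_jet (hJ : IsOpen J) (hf : OrderZero J f) (hw : ContDiffAt ℝ ∞ w z)
    (hz : jet w z ∈ J) :
    dt (fun y => f (jet w y)) z = fderiv ℝ f (jet w z) (1, 0, dt w z, 0, 0) := by
  rw [dt, fderiv_comp_jet hw (differentiableAt_of_contDiffOn hJ hf.smooth hz), fderiv_jet hw]
  have : ((1, 0, fderiv ℝ w z (1, 0), fderiv ℝ (dx w) z (1, 0), fderiv ℝ (dx (dx w)) z (1, 0)) : Jet)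
    = (1, 0, dt w z, 0, 0) + fderiv ℝ (dx w) z (1, 0) • u₁Dir
      + fderiv ℝ (dx (dx w)) z (1, 0) • u₂Dir := by simp [u₁Dir, u₂Dir, dt]
  rw [this]
  simp [hf.u₁ _ hz, hf.u₂ _ hz]

theorem eventually_jet_mem (hJ : IsOpen J) (hw : ContDiffAt ℝ ∞ w z) (hz : jet w z ∈ J) :
    ∀ᶠ y in 𝓝 z, jet w y ∈ J :=
  (contDiffAt_jet hw).continuousAt.eventually (hJ.mem_nhds hz)

end AlongFunctions

end Jets

/-! ### Prolongation formulas on the jet space. -/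

section Prolongation

/-- The component `ξ⁰` of `Q`, on the jet space. -/
def tauJ (Q : Pt → Pt) (j : Jet) : ℝ := (Q (base j)).1

/-- The component `ξ¹` of `Q`, on the jet space. -/
def xiJ (Q : Pt → Pt) (j : Jet) : ℝ := (Q (base j)).2.1

/-- The component `η` of `Q`, on the jet space. -/
def etaJ (Q : Pt → Pt) (j : Jet) : ℝ := (Q (base j)).2.2

/-- The coefficient of `∂/∂u₁` in the prolongation of `(0, ξ¹, η)`. -/
noncomputable def eta₁ (Q : Pt → Pt) (j : Jet) : ℝ := D (etaJ Q) j - j.2.2.2.1 * D (xiJ Q) j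

/-- The coefficient of `∂/∂u₂` in the prolongation of `(0, ξ¹, η)`. -/
noncomputable def eta₂ (Q : Pt → Pt) (j : Jet) : ℝ := D (eta₁ Q) j - j.2.2.2.2 * D (xiJ Q) j

/-- The coefficient of `∂/∂u₃` in the prolongation of `(0, ξ¹, η)`, where `u₃ = s`. -/
noncomputable def eta₃ (Q : Pt → Pt) (s : ℝ) (j : Jet) : ℝ :=
  fderiv ℝ (eta₂ Q) j (tot s j) - s * D (xiJ Q) j

/-- The second prolongation of `(0, ξ¹, η)`. -/
noncomputable def prol (Q : Pt → Pt) (j : Jet) : Jet := (0, xiJ Q j, etaJ Q j, eta₁ Q j, eta₂ Q j)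

variable {J : Set Jet} {Q : Pt → Pt} {F G : Jet → ℝ}

theorem orderZero_tauJ (hJ : IsOpen J) (hQ : ContDiffOn ℝ ∞ Q (base '' J)) :
    OrderZero J (tauJ Q) := orderZero_comp_base hJ (φ := fun p => (Q p).1) hQ.fst

theorem orderZero_xiJ (hJ : IsOpen J) (hQ : ContDiffOn ℝ ∞ Q (base '' J)) :
    OrderZero J (xiJ Q) := orderZero_comp_base hJ (φ := fun p => (Q p).2.1) hQ.snd.fst

theorem orderZero_etaJ (hJ : IsOpen J) (hQ : ContDiffOn ℝ ∞ Q (base '' J)) :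
    OrderZero J (etaJ Q) := orderZero_comp_base hJ (φ := fun p => (Q p).2.2) hQ.snd.snd

theorem contDiff_u₁ : ContDiff ℝ ∞ (fun j : Jet => j.2.2.2.1) := by fun_prop

theorem contDiff_u₂ : ContDiff ℝ ∞ (fun j : Jet => j.2.2.2.2) := by fun_prop

theorem fderiv_u₁ (j v : Jet) : fderiv ℝ (fun j : Jet => j.2.2.2.1) j v = v.2.2.2.1 := by
  let L : Jet →L[ℝ] ℝ := (ContinuousLinearMap.fst ℝ ℝ ℝ).comp
    ((ContinuousLinearMap.snd ℝ ℝ _).comp ((ContinuousLinearMap.snd ℝ ℝ _).comp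
      (ContinuousLinearMap.snd ℝ ℝ _)))
  have : HasFDerivAt (fun j : Jet => j.2.2.2.1) L j := L.hasFDerivAt
  rw [this.fderiv]; rfl

theorem fderiv_u₂ (j v : Jet) : fderiv ℝ (fun j : Jet => j.2.2.2.2) j v = v.2.2.2.2 := by
  let L : Jet →L[ℝ] ℝ := (ContinuousLinearMap.snd ℝ ℝ ℝ).comp
    ((ContinuousLinearMap.snd ℝ ℝ _).comp ((ContinuousLinearMap.snd ℝ ℝ _).comp
      (ContinuousLinearMap.snd ℝ ℝ _)))
  have : HasFDerivAt (fun j : Jet => j.2.2.2.2) L j := L.hasFDerivAt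
  rw [this.fderiv]; rfl

theorem orderOne_eta₁ (hJ : IsOpen J) (hQ : ContDiffOn ℝ ∞ Q (base '' J)) :
    OrderOne J (eta₁ Q) where
  smooth := (contDiffOn_D hJ (orderZero_etaJ hJ hQ).smooth).sub
    (contDiff_u₁.contDiffOn.mul (contDiffOn_D hJ (orderZero_xiJ hJ hQ).smooth))
  u₂ j hj := by
    have h1 := (orderZero_etaJ hJ hQ).D hJ
    have h2 := (orderZero_xiJ hJ hQ).D hJ
    have d1 := differentiableAt_of_contDiffOn hJ h1.smooth hj
    have d2 := differentiableAt_of_contDiffOn hJ h2.smooth hj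
    have d3 : DifferentiableAt ℝ (fun j : Jet => j.2.2.2.1) j :=
      contDiff_u₁.differentiable (by simp) j
    have : eta₁ Q = fun j => D (etaJ Q) j - j.2.2.2.1 * D (xiJ Q) j := rfl
    rw [this, fderiv_fun_sub d1 (d3.fun_mul d2), fderiv_fun_mul d3 d2]
    simp [h1.u₂ j hj, h2.u₂ j hj, fderiv_u₁]
    simp [u₂Dir]

theorem contDiffOn_eta₂ (hJ : IsOpen J) (hQ : ContDiffOn ℝ ∞ Q (base '' J)) :
    ContDiffOn ℝ ∞ (eta₂ Q) J :=
  (contDiffOn_D hJ (orderOne_eta₁ hJ hQ).smooth).sub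
    (contDiff_u₂.contDiffOn.mul (contDiffOn_D hJ (orderZero_xiJ hJ hQ).smooth))

theorem contDiffOn_prol (hJ : IsOpen J) (hQ : ContDiffOn ℝ ∞ Q (base '' J)) :
    ContDiffOn ℝ ∞ (prol Q) J :=
  contDiffOn_const.prodMk ((orderZero_xiJ hJ hQ).smooth.prodMk ((orderZero_etaJ hJ hQ).smooth.prodMk
    ((orderOne_eta₁ hJ hQ).smooth.prodMk (contDiffOn_eta₂ hJ hQ))))

variable {w : ℝ × ℝ → ℝ} {z : ℝ × ℝ}

theorem contDiffAt_comp_jet {f : Jet → ℝ} (hJ : IsOpen J) (hf : ContDiffOn ℝ ∞ f J)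
    (hw : ContDiffAt ℝ ∞ w z) (hz : jet w z ∈ J) : ContDiffAt ℝ ∞ (fun y => f (jet w y)) z :=
  (hf.contDiffAt (hJ.mem_nhds hz)).comp z (contDiffAt_jet hw)

theorem OrderOne.dx_comp_jet_eventuallyEq {f : Jet → ℝ} (hJ : IsOpen J) (hf : OrderOne J f)
    (hw : ContDiff ℝ ∞ w) (hz : jet w z ∈ J) :
    dx (fun y => f (jet w y)) =ᶠ[𝓝 z] fun y => EvolutionEq.D f (jet w y) := by
  filter_upwards [eventually_jet_mem hJ hw.contDiffAt hz] with y hy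
  exact hf.dx_comp_jet hJ hw.contDiffAt hy

/-- The coefficients of the prolongation of `Q` as functions on the jet space. -/
theorem prolongationCoeff_eq (hJ : IsOpen J) (hQ : ContDiffOn ℝ ∞ Q (base '' J))
    (hw : ContDiff ℝ ∞ w) (hz : jet w z ∈ J) :
    prolongationCoeff dt Q w z = fderiv ℝ (etaJ Q) (jet w z) (1, 0, dt w z, 0, 0)
      - dt w z * fderiv ℝ (tauJ Q) (jet w z) (1, 0, dt w z, 0, 0)
      - dx w z * fderiv ℝ (xiJ Q) (jet w z) (1, 0, dt w z, 0, 0) ∧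
    prolongationCoeff dx Q w z = eta₁ Q (jet w z) - dt w z * D (tauJ Q) (jet w z) ∧
    prolongationCoeff (fun f => dx (dx f)) Q w z = eta₂ Q (jet w z)
      - 2 * dx (dt w) z * D (tauJ Q) (jet w z) - dt w z * D (D (tauJ Q)) (jet w z) ∧
    prolongationCoeff (fun f => dx (dx (dx f))) Q w z = eta₃ Q (dx (dx (dx w)) z) (jet w z)
      - 3 * dx (dx (dt w)) z * D (tauJ Q) (jet w z) - 3 * dx (dt w) z * D (D (tauJ Q)) (jet w z)
      - dt w z * fderiv ℝ (D (D (tauJ Q))) (jet w z) (tot (dx (dx (dx w)) z) (jet w z)) := by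
  have hτ := orderZero_tauJ hJ hQ
  have hξ := orderZero_xiJ hJ hQ
  have hη := orderZero_etaJ hJ hQ
  have hη₁ := orderOne_eta₁ hJ hQ
  have sw := hw.contDiffAt (x := z)
  have sp := contDiffAt_dt sw
  have sp1 := contDiffAt_dx sp
  have sp2 := contDiffAt_dx sp1
  have sr := contDiffAt_dx sw
  have sr1 := contDiffAt_dx sr
  have sr2 := contDiffAt_dx sr1
  have sa := contDiffAt_comp_jet hJ hτ.smooth sw hz
  have sb := contDiffAt_comp_jet hJ hξ.smooth sw hz
  have sh := contDiffAt_comp_jet hJ hη.smooth sw hz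
  have sDa := contDiffAt_comp_jet hJ (contDiffOn_D hJ hτ.smooth) sw hz
  have sDDa := contDiffAt_comp_jet hJ (contDiffOn_D hJ (contDiffOn_D hJ hτ.smooth)) sw hz
  have sη₁ := contDiffAt_comp_jet hJ hη₁.smooth sw hz
  have sη₂ := contDiffAt_comp_jet hJ (contDiffOn_eta₂ hJ hQ) sw hz
  have ea := hτ.dx_comp_jet_eventuallyEq hJ hw hz
  have eb := hξ.dx_comp_jet_eventuallyEq hJ hw hz
  have eh := hη.dx_comp_jet_eventuallyEq hJ hw hz
  have eDa := (hτ.D hJ).dx_comp_jet_eventuallyEq hJ hw hz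
  have eη₁ := hη₁.dx_comp_jet_eventuallyEq hJ hw hz
  have char : characteristic Q w = fun y => etaJ Q (jet w y) - dt w y * tauJ Q (jet w y)
    - dx w y * xiJ Q (jet w y) := rfl
  have e0 : characteristic Q w =ᶠ[𝓝 z] fun y => etaJ Q (jet w y) - dt w y * tauJ Q (jet w y)
    - dx w y * xiJ Q (jet w y) := by rw [char]
  -- The last two terms of each derivative of the characteristic are exactly those that the
  -- prolongation formula adds back; what precedes them is the coefficient sought.
  have e1 : dx (characteristic Q w) =ᶠ[𝓝 z] fun y =>
      (eta₁ Q (jet w y) - dt w y * D (tauJ Q) (jet w y))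
        - dx (dt w) y * tauJ Q (jet w y) - dx (dx w) y * xiJ Q (jet w y) := by
    filter_upwards [dx_prolongation_step e0 sh sp sa sr sb, ea, eb, eh] with y h h1 h2 h3
    rw [h, h1, h2, h3, eta₁]
    simp only [jet]
    ring
  have e2 : dx (dx (characteristic Q w)) =ᶠ[𝓝 z] fun y =>
      ((eta₂ Q (jet w y) - 2 * dx (dt w) y * D (tauJ Q) (jet w y)) -
          dt w y * D (D (tauJ Q)) (jet w y))
        - dx (dx (dt w)) y * tauJ Q (jet w y) - dx (dx (dx w)) y * xiJ Q (jet w y) := by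
    filter_upwards [dx_prolongation_step e1 (sη₁.sub (sp.mul sDa)) sp1 sa sr1 sb, ea, eb,
      dx_sub_mul sη₁ sp sDa, eDa, eη₁] with y h h1 h2 h3 h4 h5
    rw [h, h1, h2, h3, h4, h5, eta₂]
    simp only [jet]
    ring
  have e3 := (dx_prolongation_step e2 ((sη₂.sub ((contDiffAt_const.mul sp1).mul sDa)).sub
    (sp.mul sDDa)) sp2 sa sr2 sb).eq_of_nhds
  refine ⟨?_, ?_, ?_, ?_⟩
  · have h1 := dt_sub_mul (sh.sub (sp.mul sa)) sr sb
    have h2 := dt_sub_mul sh sp sa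
    have h1' : dt (characteristic Q w) z = _ := h1
    rw [prolongationCoeff, h1', h2, hη.dt_comp_jet hJ sw hz, hτ.dt_comp_jet hJ sw hz,
      hξ.dt_comp_jet hJ sw hz]
    simp only [tauJ, xiJ, jet, base, graphPt]
    ring
  · rw [prolongationCoeff, e1.eq_of_nhds]
    simp only [tauJ, xiJ, jet, base, graphPt]
    ring
  · simp only [prolongationCoeff]
    rw [e2.eq_of_nhds]
    simp only [tauJ, xiJ, jet, base, graphPt]
    ring
  · simp only [prolongationCoeff]
    have h1 := (dx_sub_mul (sη₂.sub ((contDiffAt_const (c := (2 : ℝ)).mul sp1).mul sDa))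
      sp sDDa).eq_of_nhds
    have h2 := (dx_sub_mul sη₂ (contDiffAt_const (c := (2 : ℝ)).mul sp1) sDa).eq_of_nhds
    -- The factor 2 is treated as 0 - (-2) · u_tx, an instance of the product rule already
    -- available.
    have h3 : dx (fun y => 2 * dx (dt w) y) z = 2 * dx (dx (dt w)) z := by
      have := (dx_sub_mul (contDiffAt_const (c := (0 : ℝ))) (contDiffAt_const (c := (-2 : ℝ)))
        sp1).eq_of_nhds
      simpa [dx] using this
    rw [e3, h1, h2, h3, ea.eq_of_nhds, eb.eq_of_nhds, eDa.eq_of_nhds,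
      dx_comp_jet sw (differentiableAt_of_contDiffOn hJ (contDiffOn_eta₂ hJ hQ) hz),
      dx_comp_jet sw (differentiableAt_of_contDiffOn hJ
        (contDiffOn_D hJ (contDiffOn_D hJ hτ.smooth)) hz), eta₃]
    simp only [tauJ, xiJ, jet, base, graphPt]
    ring

end Prolongation

/-! ### Polynomials with prescribed jets. -/

section TestFunctions

theorem dx_eq_of_hasDerivAt {f : ℝ × ℝ → ℝ} {z : ℝ × ℝ} {d : ℝ} (hf : DifferentiableAt ℝ f z)
    (h : HasDerivAt (fun y => f (z.1, y)) d z.2) : dx f z = d := by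
  have h1 : HasDerivAt (fun y : ℝ => (z.1, y)) ((0 : ℝ), (1 : ℝ)) z.2 :=
    (hasDerivAt_const _ _).prodMk (hasDerivAt_id _)
  have h2 : HasFDerivAt f (fderiv ℝ f z) (z.1, z.2) := hf.hasFDerivAt
  exact (h2.comp_hasDerivAt z.2 h1).unique h

theorem dt_eq_of_hasDerivAt {f : ℝ × ℝ → ℝ} {z : ℝ × ℝ} {d : ℝ} (hf : DifferentiableAt ℝ f z)
    (h : HasDerivAt (fun y => f (y, z.2)) d z.1) : dt f z = d := by
  have h1 : HasDerivAt (fun y : ℝ => (y, z.2)) ((1 : ℝ), (0 : ℝ)) z.1 :=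
    (hasDerivAt_id _).prodMk (hasDerivAt_const _ _)
  have h2 : HasFDerivAt f (fderiv ℝ f z) (z.1, z.2) := hf.hasFDerivAt
  exact (h2.comp_hasDerivAt z.1 h1).unique h

theorem hasDerivAt_cubic (a₀ a₁ a₂ a₃ x y : ℝ) :
    HasDerivAt (fun y => a₀ + a₁ * (y - x) + a₂ * (y - x) ^ 2 / 2 + a₃ * (y - x) ^ 3 / 6)
      (a₁ + a₂ * (y - x) + a₃ * (y - x) ^ 2 / 2) y := by
  have h := (hasDerivAt_id y).sub_const x
  convert! (((h.const_mul a₁).const_add a₀).add (((h.pow 2).const_mul a₂).div_const 2)).add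
    (((h.pow 3).const_mul a₃).div_const 6) using 1
  simp; ring

/-- Every third-order jet is the jet of a polynomial. -/
theorem exists_jet_eq (j : Jet) (s q c : ℝ) : ∃ w : ℝ × ℝ → ℝ, ContDiff ℝ ∞ w ∧
    jet w (j.1, j.2.1) = j ∧ dx (dx (dx w)) (j.1, j.2.1) = s ∧ dt w (j.1, j.2.1) = q ∧
    dx (dt w) (j.1, j.2.1) = 0 ∧ dx (dx (dt w)) (j.1, j.2.1) = c := by
  obtain ⟨t, x, u, u₁, u₂⟩ := j
  -- A Taylor polynomial in the space variable; the term with `c` sets u_txx at the base point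
  -- without changing u_t, u_tx or the pure x-derivatives there.
  let w₀ : ℝ × ℝ → ℝ := fun y => (u + q * (y.1 - t)) + u₁ * (y.2 - x)
    + (u₂ + c * (y.1 - t)) * (y.2 - x) ^ 2 / 2 + s * (y.2 - x) ^ 3 / 6
  let w₁ : ℝ × ℝ → ℝ := fun y => u₁ + (u₂ + c * (y.1 - t)) * (y.2 - x) + s * (y.2 - x) ^ 2 / 2
  let w₂ : ℝ × ℝ → ℝ := fun y => (u₂ + c * (y.1 - t)) + s * (y.2 - x)
  let p₀ : ℝ × ℝ → ℝ := fun y => q + c * (y.2 - x) ^ 2 / 2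
  let p₁ : ℝ × ℝ → ℝ := fun y => c * (y.2 - x)
  have cw₀ : ContDiff ℝ ∞ w₀ := by fun_prop
  have cw₁ : ContDiff ℝ ∞ w₁ := by fun_prop
  have cw₂ : ContDiff ℝ ∞ w₂ := by fun_prop
  have cp₀ : ContDiff ℝ ∞ p₀ := by fun_prop
  have cp₁ : ContDiff ℝ ∞ p₁ := by fun_prop
  have e₁ : dx w₀ = w₁ := by
    ext y
    exact dx_eq_of_hasDerivAt (cw₀.differentiable (by simp) y)
      (hasDerivAt_cubic (u + q * (y.1 - t)) u₁ (u₂ + c * (y.1 - t)) s x y.2)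
  have e₂ : dx w₁ = w₂ := by
    ext y
    refine dx_eq_of_hasDerivAt (cw₁.differentiable (by simp) y) ?_
    convert! hasDerivAt_cubic u₁ (u₂ + c * (y.1 - t)) s 0 x y.2 using 1
    · ext v; simp [w₁]
    · simp [w₂]
  have e₃ : ∀ y, dx w₂ y = s := by
    intro y
    refine dx_eq_of_hasDerivAt (cw₂.differentiable (by simp) y) ?_
    convert! hasDerivAt_cubic (u₂ + c * (y.1 - t)) s 0 0 x y.2 using 1
    · ext v; simp [w₂]
    · simp
  have e₄ : dt w₀ = p₀ := by
    ext y
    refine dt_eq_of_hasDerivAt (cw₀.differentiable (by simp) y) ?_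
    convert! hasDerivAt_cubic (u + u₁ * (y.2 - x) + u₂ * (y.2 - x) ^ 2 / 2 + s * (y.2 - x) ^ 3 / 6)
      (q + c * (y.2 - x) ^ 2 / 2) 0 0 t y.1 using 1
    · ext v; simp [w₀]; ring
    · simp [p₀]
  have e₅ : dx p₀ = p₁ := by
    ext y
    refine dx_eq_of_hasDerivAt (cp₀.differentiable (by simp) y) ?_
    convert! hasDerivAt_cubic q 0 c 0 x y.2 using 1
    · ext v; simp [p₀]
    · simp [p₁]
  have e₆ : ∀ y, dx p₁ y = c := by
    intro y
    refine dx_eq_of_hasDerivAt (cp₁.differentiable (by simp) y) ?_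
    convert! hasDerivAt_cubic 0 c 0 0 x y.2 using 1
    · ext v; simp [p₁]
    · simp
  refine ⟨w₀, cw₀, ?_, ?_, ?_, ?_, ?_⟩
  · simp [jet, e₁, e₂, w₀, w₁, w₂]
  · simp [e₁, e₂, e₃]
  · simp [e₄, p₀]
  · simp [e₄, e₅, p₁]
  · simp [e₄, e₅, e₆]

end TestFunctions

/-! ### The symmetry condition as an identity in jet coordinates. -/

section JetForm

variable {J : Set Jet} {Q : Pt → Pt} {F G : Jet → ℝ}

/-- The component `ξ⁰` of a point symmetry depends on `t` only. -/
theorem IsPointSymmetry.D_tauJ (hJ : IsOpen J) (hQ : ContDiffOn ℝ ∞ Q (base '' J))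
    (hF0 : ∀ j ∈ J, F j ≠ 0) (hs : IsPointSymmetry J F G Q) {j : Jet} (hj : j ∈ J) :
    D (tauJ Q) j = 0 := by
  -- Two solutions at the point that agree in all relevant derivatives except u_txx. This derivative
  -- enters the symmetry condition only through 3 F u_txx D ξ⁰, so the difference of the two
  -- conditions isolates that term.
  obtain ⟨w₀, c₀, j₀, s₀, q₀, p₀, r₀⟩ := exists_jet_eq j 0 (G j) 0
  obtain ⟨w₁, c₁, j₁, s₁, q₁, p₁, r₁⟩ := exists_jet_eq j 0 (G j) 1
  have hx : ∀ w z, jet w z = j → dx w z = j.2.2.2.1 := by rintro w z rfl; rfl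
  have hg : ∀ w z, jet w z = j → graphPt w z = base j := by rintro w z rfl; rfl
  have h₀ := hs w₀ c₀ (j.1, j.2.1) (by rwa [j₀]) (by rw [HoldsAt, j₀, s₀, q₀]; ring)
  have h₁ := hs w₁ c₁ (j.1, j.2.1) (by rwa [j₁]) (by rw [HoldsAt, j₁, s₁, q₁]; ring)
  obtain ⟨a₀, b₀, d₀, f₀⟩ := prolongationCoeff_eq hJ hQ c₀ (z := (j.1, j.2.1)) (by rwa [j₀])
  obtain ⟨a₁, b₁, d₁, f₁⟩ := prolongationCoeff_eq hJ hQ c₁ (z := (j.1, j.2.1)) (by rwa [j₁])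
  rw [prolongedVector, a₀, b₀, d₀, f₀, hx _ _ j₀, hg _ _ j₀, j₀, s₀, q₀, p₀, r₀] at h₀
  rw [prolongedVector, a₁, b₁, d₁, f₁, hx _ _ j₁, hg _ _ j₁, j₁, s₁, q₁, p₁, r₁] at h₁
  have : F j * D (tauJ Q) j = 0 := by linear_combination (h₁ - h₀) / 3
  exact (mul_eq_zero.1 this).resolve_left (hF0 j hj)

/-- The symmetry condition for a vector field with `ξ⁰ = 0`, as an identity on the jet space. -/
theorem IsPointSymmetry.jet_identity (hJ : IsOpen J) (hQ : ContDiffOn ℝ ∞ Q (base '' J))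
    (hτ : ∀ p ∈ base '' J, (Q p).1 = 0) (hs : IsPointSymmetry J F G Q) {j : Jet} (hj : j ∈ J)
    (s : ℝ) :
    fderiv ℝ (etaJ Q) j (1, 0, F j * s + G j, 0, 0)
      - j.2.2.2.1 * fderiv ℝ (xiJ Q) j (1, 0, F j * s + G j, 0, 0)
      - fderiv ℝ F j (prol Q j) * s - F j * eta₃ Q s j - fderiv ℝ G j (prol Q j) = 0 := by
  obtain ⟨w, c, hw, hws, hq, -, -⟩ := exists_jet_eq j s (F j * s + G j) 0
  have hx : dx w (j.1, j.2.1) = j.2.2.2.1 := congrArg (fun j : Jet => j.2.2.2.1) hw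
  have hg : graphPt w (j.1, j.2.1) = base j := congrArg base hw
  have h := hs w c (j.1, j.2.1) (by rwa [hw]) (by rw [HoldsAt, hw, hws, hq])
  obtain ⟨a, b, d, f⟩ := prolongationCoeff_eq hJ hQ c (z := (j.1, j.2.1)) (by rwa [hw])
  have t0 : ∀ j ∈ J, tauJ Q j = 0 := fun j hj => hτ _ (mem_image_of_mem _ hj)
  have t1 : ∀ j ∈ J, D (tauJ Q) j = 0 := fun j hj => by rw [D, fderiv_zero_on hJ t0 hj]; simp
  have t2 : ∀ j ∈ J, D (D (tauJ Q)) j = 0 := fun j hj => by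
    rw [D, fderiv_zero_on hJ t1 hj]; simp
  rw [prolongedVector, a, b, d, f, hx, hg, hw, hws, hq, fderiv_zero_on hJ t0 hj, t1 j hj, t2 j hj,
    fderiv_zero_on hJ t2 hj, hτ _ (mem_image_of_mem _ hj)] at h
  simpa [prol, xiJ, etaJ] using h

end JetForm

/-! ### Commutators of prolonged vector fields with total derivatives. -/

section Commutation

variable {J : Set Jet} {Q : Pt → Pt} {f : Jet → ℝ}

theorem fderiv_prol (hJ : IsOpen J) (hQ : ContDiffOn ℝ ∞ Q (base '' J)) {j : Jet} (hj : j ∈ J)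
    (v : Jet) : fderiv ℝ (prol Q) j v = (0, fderiv ℝ (xiJ Q) j v, fderiv ℝ (etaJ Q) j v,
      fderiv ℝ (eta₁ Q) j v, fderiv ℝ (eta₂ Q) j v) := by
  have h1 := (differentiableAt_of_contDiffOn hJ (orderZero_xiJ hJ hQ).smooth hj).hasFDerivAt
  have h2 := (differentiableAt_of_contDiffOn hJ (orderZero_etaJ hJ hQ).smooth hj).hasFDerivAt
  have h3 := (differentiableAt_of_contDiffOn hJ (orderOne_eta₁ hJ hQ).smooth hj).hasFDerivAt
  have h4 := (differentiableAt_of_contDiffOn hJ (contDiffOn_eta₂ hJ hQ) hj).hasFDerivAt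
  have : HasFDerivAt (prol Q) _ j :=
    (hasFDerivAt_const (0 : ℝ) j).prodMk (h1.prodMk (h2.prodMk (h3.prodMk h4)))
  rw [this.fderiv]
  rfl

/-- The commutator of a prolonged vector field with the total `x`-derivative. -/
theorem prol_tot (hJ : IsOpen J) (hQ : ContDiffOn ℝ ∞ Q (base '' J)) (hf : ContDiffOn ℝ ∞ f J)
    {j : Jet} (hj : j ∈ J) (s : ℝ) :
    fderiv ℝ (fun y => fderiv ℝ f y (tot s y)) j (prol Q j) + eta₃ Q s j * fderiv ℝ f j u₂Dir
      = fderiv ℝ (fun y => fderiv ℝ f y (prol Q y)) j (tot s j)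
        - D (xiJ Q) j * fderiv ℝ f j (tot s j) := by
  have h := fderiv_fderiv_sub (A := prol Q) (B := tot s) (hf.contDiffAt (hJ.mem_nhds hj))
    (differentiableAt_of_contDiffOn hJ (contDiffOn_prol hJ hQ) hj)
    ((contDiff_tot s).differentiable (by simp) j)
  -- This is the identity [pr Q, D_x] = -(D ξ¹) D_x, truncated: u₃ is frozen at `s`, so the missing
  -- u₃-component of the prolongation reappears as the multiple of `u₂Dir`.
  have h' : fderiv ℝ (tot s) j (prol Q j) - fderiv ℝ (prol Q) j (tot s j)
      = -(D (xiJ Q) j) • tot s j - eta₃ Q s j • u₂Dir := by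
    rw [hasFDerivAt_tot, fderiv_prol hJ hQ hj, (orderZero_xiJ hJ hQ).fderiv_tot hj,
      (orderZero_etaJ hJ hQ).fderiv_tot hj, (orderOne_eta₁ hJ hQ).fderiv_tot hj]
    simp only [prol, tot, u₂Dir, Prod.smul_mk, Prod.mk_sub_mk, smul_eq_mul, eta₃]
    rw [eta₂, eta₁]
    simp only [Prod.mk.injEq]
    refine ⟨by ring, by ring, by ring, by ring, by ring⟩
  rw [h', map_sub, map_smul, map_smul, smul_eq_mul, smul_eq_mul] at h
  linarith

/-- For a function without u₂ the truncation term disappears and the exact commutator remains. -/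
theorem OrderOne.prol_D (hJ : IsOpen J) (hQ : ContDiffOn ℝ ∞ Q (base '' J)) (hf : OrderOne J f)
    {j : Jet} (hj : j ∈ J) :
    fderiv ℝ (EvolutionEq.D f) j (prol Q j)
      = EvolutionEq.D (fun y => fderiv ℝ f y (prol Q y)) j
        - EvolutionEq.D (xiJ Q) j * EvolutionEq.D f j := by
  have := prol_tot hJ hQ hf.smooth hj 0
  rw [hf.u₂ j hj, mul_zero, add_zero] at this
  exact this

/-- The commutator of a prolonged vector field with `∂/∂t + q ∂/∂u`. -/
theorem OrderZero.prol_time (hJ : IsOpen J) (hQ : ContDiffOn ℝ ∞ Q (base '' J))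
    (hf : OrderZero J f) {j : Jet} (hj : j ∈ J) (q : ℝ) :
    fderiv ℝ (fun y => fderiv ℝ f y (1, 0, q, 0, 0)) j (prol Q j)
        + (fderiv ℝ (etaJ Q) j (1, 0, q, 0, 0)
          - j.2.2.2.1 * fderiv ℝ (xiJ Q) j (1, 0, q, 0, 0)) * fderiv ℝ f j uDir
      = fderiv ℝ (fun y => fderiv ℝ f y (prol Q y)) j (1, 0, q, 0, 0)
        - fderiv ℝ (xiJ Q) j (1, 0, q, 0, 0) * EvolutionEq.D f j := by
  have h := fderiv_fderiv_sub (A := prol Q) (B := fun _ => (1, 0, q, 0, 0))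
    (hf.smooth.contDiffAt (hJ.mem_nhds hj))
    (differentiableAt_of_contDiffOn hJ (contDiffOn_prol hJ hQ) hj) (differentiableAt_const _)
  -- Only the parts along `tot 0 j` and `uDir` matter: those along `u₁Dir` and `u₂Dir` annihilate a
  -- function of order zero.
  have h' : fderiv ℝ (fun _ : Jet => ((1, 0, q, 0, 0) : Jet)) j (prol Q j)
      - fderiv ℝ (prol Q) j (1, 0, q, 0, 0)
      = -(fderiv ℝ (xiJ Q) j (1, 0, q, 0, 0)) • tot 0 j
        - (fderiv ℝ (etaJ Q) j (1, 0, q, 0, 0)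
          - j.2.2.2.1 * fderiv ℝ (xiJ Q) j (1, 0, q, 0, 0)) • uDir
        + (-fderiv ℝ (eta₁ Q) j (1, 0, q, 0, 0)
          + fderiv ℝ (xiJ Q) j (1, 0, q, 0, 0) * j.2.2.2.2) • u₁Dir
        - fderiv ℝ (eta₂ Q) j (1, 0, q, 0, 0) • u₂Dir := by
    rw [fderiv_prol hJ hQ hj]
    simp only [tot, uDir, u₁Dir, u₂Dir, Prod.smul_mk, Prod.mk_sub_mk, Prod.mk_add_mk, smul_eq_mul,
      fderiv_fun_const, Pi.zero_apply, zero_apply, zero_sub, Prod.neg_mk,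
      Prod.mk.injEq]
    refine ⟨by ring, by ring, by ring, by ring, by ring⟩
  rw [h'] at h
  simp only [map_sub, map_add, map_smul, smul_eq_mul, hf.u₁ j hj, hf.u₂ j hj] at h
  rw [EvolutionEq.D]
  linarith

theorem fderiv_comp_pair {X : Jet → ℝ} {Φ : ℝ × ℝ → ℝ} {j : Jet} (hX : DifferentiableAt ℝ X j)
    (hΦ : DifferentiableAt ℝ Φ (j.1, X j)) (v : Jet) :
    fderiv ℝ (fun y : Jet => Φ (y.1, X y)) j v
      = v.1 * dt Φ (j.1, X j) + fderiv ℝ X j v * dx Φ (j.1, X j) := by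
  have h1 : HasFDerivAt (fun y : Jet => (y.1, X y))
    ((ContinuousLinearMap.fst ℝ ℝ _).prod (fderiv ℝ X j)) j :=
    hasFDerivAt_fst.prodMk hX.hasFDerivAt
  have h2 := hΦ.hasFDerivAt.comp j h1
  change HasFDerivAt (fun y : Jet => Φ (y.1, X y)) _ j at h2
  rw [h2.fderiv]
  have : ((v.1, fderiv ℝ X j v) : ℝ × ℝ) = v.1 • (1, 0) + fderiv ℝ X j v • (0, 1) := by simp
  change fderiv ℝ Φ (j.1, X j) (v.1, fderiv ℝ X j v) = _
  rw [this, map_add, map_smul, map_smul]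
  rfl

end Commutation

/-! ### The transformed equation and the action of symmetries on it. -/

section Transformation

variable {J : Set Jet} {X U : Jet → ℝ}

/-- The new variable `u'₁ = D U / D X`. -/
noncomputable def newU₁ (X U : Jet → ℝ) (j : Jet) : ℝ := D U j / D X j

/-- The new variable `u'₂ = D u'₁ / D X`. -/
noncomputable def newU₂ (X U : Jet → ℝ) (j : Jet) : ℝ := D (newU₁ X U) j / D X j

/-- The part of `u'_{t'}` free of `u_t`. -/
noncomputable def timeShift (X U : Jet → ℝ) (j : Jet) : ℝ :=
  fderiv ℝ U j (1, 0, 0, 0, 0) - newU₁ X U j * fderiv ℝ X j (1, 0, 0, 0, 0)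

/-- The coefficient of `u_t` in `u'_{t'}`. -/
noncomputable def timeFactor (X U : Jet → ℝ) (j : Jet) : ℝ :=
  fderiv ℝ U j uDir - newU₁ X U j * fderiv ℝ X j uDir

/-- The transformed coefficient of `u'₃`, as a function of the old variables. -/
noncomputable def newF (X : Jet → ℝ) (F : Jet → ℝ) (j : Jet) : ℝ := F j * D X j ^ 3

/-- The transformed lower-order term, as a function of the old variables. -/
noncomputable def newG (X U F G : Jet → ℝ) (j : Jet) : ℝ :=
  timeShift X U j + timeFactor X U j * G j - F j * (D X j ^ 2 * D (newU₂ X U) j)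

theorem orderOne_newU₁ (hJ : IsOpen J) (hX : OrderZero J X) (hU : OrderZero J U)
    (hDX : ∀ j ∈ J, D X j ≠ 0) : OrderOne J (newU₁ X U) where
  smooth := (hU.D hJ).smooth.div (hX.D hJ).smooth hDX
  u₂ j hj := by
    have d0 := differentiableAt_of_contDiffOn hJ
      ((hU.D hJ).smooth.div (hX.D hJ).smooth hDX) hj
    have d2 := differentiableAt_of_contDiffOn hJ (hX.D hJ).smooth hj
    change DifferentiableAt ℝ (newU₁ X U) j at d0
    -- Differentiating the product relation D U = u'₁ D X replaces the quotient rule; the same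
    -- device is used for u'₂ and in the following lemmas.
    have h := DFunLike.congr_fun (fderiv_congr_on hJ (g := fun y => newU₁ X U y * D X y)
      (fun j hj => (div_mul_cancel₀ _ (hDX j hj)).symm) hj) u₂Dir
    rw [fderiv_fun_mul d0 d2, (hU.D hJ).u₂ j hj] at h
    simp only [add_apply, smul_apply, smul_eq_mul,
      (hX.D hJ).u₂ j hj, mul_zero, zero_add] at h
    exact (mul_eq_zero.1 h.symm).resolve_left (hDX j hj)

theorem contDiffOn_newU₂ (hJ : IsOpen J) (hX : OrderZero J X) (hU : OrderZero J U)
    (hDX : ∀ j ∈ J, D X j ≠ 0) : ContDiffOn ℝ ∞ (newU₂ X U) J :=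
  (contDiffOn_D hJ (orderOne_newU₁ hJ hX hU hDX).smooth).div (hX.D hJ).smooth hDX

theorem D_eq_newU₁_mul (hDX : ∀ j ∈ J, D X j ≠ 0) :
    ∀ j ∈ J, D U j = newU₁ X U j * D X j := fun j hj => (div_mul_cancel₀ _ (hDX j hj)).symm

theorem D_newU₁_eq_newU₂_mul (hDX : ∀ j ∈ J, D X j ≠ 0) :
    ∀ j ∈ J, D (newU₁ X U) j = newU₂ X U j * D X j :=
  fun j hj => (div_mul_cancel₀ _ (hDX j hj)).symm

/-- Here `timeFactor` equals (X_x U_u - X_u U_x) / D X, the Jacobian of the point transformation in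
the fibre divided by D X. It governs the dependence of u'₁ on u₁, of u'₂ on u₂ and of u'_{t'} on u_t
alike, so its non-vanishing is the only nondegeneracy needed. -/
theorem fderiv_newU₁_u₁Dir (hJ : IsOpen J) (hX : OrderZero J X) (hU : OrderZero J U)
    (hDX : ∀ j ∈ J, D X j ≠ 0) {j : Jet} (hj : j ∈ J) :
    fderiv ℝ (newU₁ X U) j u₁Dir * D X j = timeFactor X U j := by
  have d0 := differentiableAt_of_contDiffOn hJ (orderOne_newU₁ hJ hX hU hDX).smooth hj
  have d2 := differentiableAt_of_contDiffOn hJ (hX.D hJ).smooth hj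
  have h := DFunLike.congr_fun (fderiv_congr_on hJ (D_eq_newU₁_mul (U := U) hDX) hj) u₁Dir
  rw [fderiv_fun_mul d0 d2, hU.fderiv_D_u₁Dir hJ hj] at h
  simp only [add_apply, smul_apply, smul_eq_mul,
    hX.fderiv_D_u₁Dir hJ hj] at h
  rw [timeFactor]
  linarith

theorem fderiv_newU₂_u₂Dir (hJ : IsOpen J) (hX : OrderZero J X) (hU : OrderZero J U)
    (hDX : ∀ j ∈ J, D X j ≠ 0) {j : Jet} (hj : j ∈ J) :
    fderiv ℝ (newU₂ X U) j u₂Dir * D X j ^ 2 = timeFactor X U j := by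
  have d0 := differentiableAt_of_contDiffOn hJ (contDiffOn_newU₂ hJ hX hU hDX) hj
  have d2 := differentiableAt_of_contDiffOn hJ (hX.D hJ).smooth hj
  have h := DFunLike.congr_fun (fderiv_congr_on hJ (D_newU₁_eq_newU₂_mul (U := U) hDX) hj) u₂Dir
  rw [fderiv_fun_mul d0 d2, (orderOne_newU₁ hJ hX hU hDX).fderiv_D_u₂Dir hJ hj] at h
  simp only [add_apply, smul_apply, smul_eq_mul,
    (hX.D hJ).u₂ j hj] at h
  rw [← fderiv_newU₁_u₁Dir hJ hX hU hDX hj, h]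
  ring

/-- If the prolonged vector field maps `R` to `Φ (t, X)` and annihilates `X`, it maps `D R / D X`
to `Φ_x (t, X)`. -/
theorem prol_newDerivative (hJ : IsOpen J) {Q : Pt → Pt} (hQ : ContDiffOn ℝ ∞ Q (base '' J))
    (hX : OrderZero J X) (hDX : ∀ j ∈ J, D X j ≠ 0) (hQX : ∀ j ∈ J, fderiv ℝ X j (prol Q j) = 0)
    {R R' : Jet → ℝ} (hR : OrderOne J R) (hR' : ContDiffOn ℝ ∞ R' J)
    (h : ∀ j ∈ J, D R j = R' j * D X j) {Φ : ℝ × ℝ → ℝ}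
    (hΦ : ∀ j ∈ J, DifferentiableAt ℝ Φ (j.1, X j))
    (hQR : ∀ j ∈ J, fderiv ℝ R j (prol Q j) = Φ (j.1, X j)) {j : Jet} (hj : j ∈ J) :
    fderiv ℝ R' j (prol Q j) = dx Φ (j.1, X j) := by
  have d0 := differentiableAt_of_contDiffOn hJ hR' hj
  have d1 := differentiableAt_of_contDiffOn hJ hX.smooth hj
  have d2 := differentiableAt_of_contDiffOn hJ (hX.D hJ).smooth hj
  have e := DFunLike.congr_fun (fderiv_congr_on hJ h hj) (prol Q j)
  rw [fderiv_fun_mul d0 d2, hR.prol_D hJ hQ hj] at e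
  simp only [add_apply, smul_apply, smul_eq_mul,
    hX.prol_D hJ hQ hj] at e
  have e1 : D (fun y => fderiv ℝ X y (prol Q y)) j = 0 := by
    rw [D, fderiv_zero_on hJ hQX hj]; simp
  have e2 : D (fun y => fderiv ℝ R y (prol Q y)) j = D X j * dx Φ (j.1, X j) := by
    rw [D, fderiv_congr_on hJ hQR hj, fderiv_comp_pair d1 (hΦ j hj)]
    simp [D, tot]
  rw [e1, e2, h j hj] at e
  refine mul_left_cancel₀ (hDX j hj) ?_
  linarith

/-- The action of a symmetry `Q` with `Q X = 0` and `Q U = Φ (t, X)` on the new variables and on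
the coefficients of the transformed equation. -/
theorem prol_transformed (hJ : IsOpen J) {Q : Pt → Pt} {F G : Jet → ℝ}
    (hF : ContDiffOn ℝ ∞ F J) (hG : ContDiffOn ℝ ∞ G J)
    (hQ : ContDiffOn ℝ ∞ Q (base '' J))
    (hτ : ∀ p ∈ base '' J, (Q p).1 = 0) (hs : IsPointSymmetry J F G Q)
    (hX : OrderZero J X) (hU : OrderZero J U) (hDX : ∀ j ∈ J, D X j ≠ 0)
    (hT : ∀ j ∈ J, timeFactor X U j ≠ 0)
    (hQX : ∀ j ∈ J, fderiv ℝ X j (prol Q j) = 0) {Φ : ℝ × ℝ → ℝ}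
    (hΦ : ∀ j ∈ J, ContDiffAt ℝ ∞ Φ (j.1, X j))
    (hQU : ∀ j ∈ J, fderiv ℝ U j (prol Q j) = Φ (j.1, X j)) :
    (∀ j ∈ J, fderiv ℝ (newU₁ X U) j (prol Q j) = dx Φ (j.1, X j)) ∧
    (∀ j ∈ J, fderiv ℝ (newU₂ X U) j (prol Q j) = dx (dx Φ) (j.1, X j)) ∧
    (∀ j ∈ J, fderiv ℝ (newF X F) j (prol Q j) = 0) ∧
    (∀ j ∈ J, fderiv ℝ (newG X U F G) j (prol Q j)
      = dt Φ (j.1, X j) - newF X F j * dx (dx (dx Φ)) (j.1, X j)) := by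
  have o₁ := orderOne_newU₁ hJ hX hU hDX
  have o₂ := contDiffOn_newU₂ hJ hX hU hDX
  have hΦd : ∀ j ∈ J, DifferentiableAt ℝ Φ (j.1, X j) := fun j hj =>
    (hΦ j hj).differentiableAt (by simp)
  have hΦ₁d : ∀ j ∈ J, DifferentiableAt ℝ (dx Φ) (j.1, X j) := fun j hj =>
    (contDiffAt_dx (hΦ j hj)).differentiableAt (by simp)
  have hΦ₂d : ∀ j ∈ J, DifferentiableAt ℝ (dx (dx Φ)) (j.1, X j) := fun j hj =>
    (contDiffAt_dx (contDiffAt_dx (hΦ j hj))).differentiableAt (by simp)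
  have r₁ : ∀ j ∈ J, fderiv ℝ (newU₁ X U) j (prol Q j) = dx Φ (j.1, X j) := fun j hj =>
    prol_newDerivative hJ hQ hX hDX hQX hU.toOrderOne o₁.smooth (D_eq_newU₁_mul hDX) hΦd hQU hj
  have r₂ : ∀ j ∈ J, fderiv ℝ (newU₂ X U) j (prol Q j) = dx (dx Φ) (j.1, X j) := fun j hj =>
    prol_newDerivative hJ hQ hX hDX hQX o₁ o₂ (D_newU₁_eq_newU₂_mul hDX) hΦ₁d r₁ hj
  refine ⟨r₁, r₂, ?_⟩
  suffices h : ∀ j ∈ J, fderiv ℝ (newF X F) j (prol Q j) = 0 ∧ fderiv ℝ (newG X U F G) j (prol Q j)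
      = dt Φ (j.1, X j) - newF X F j * dx (dx (dx Φ)) (j.1, X j) from
    ⟨fun j hj => (h j hj).1, fun j hj => (h j hj).2⟩
  intro j hj
  have sA : ContDiffOn ℝ ∞ (fun y => fderiv ℝ (newU₂ X U) y u₂Dir) J :=
    contDiffOn_fderiv_const hJ _ o₂
  have sUt : ∀ v, ContDiffOn ℝ ∞ (fun y => fderiv ℝ U y v) J := fun v =>
    contDiffOn_fderiv_const hJ _ hU.smooth
  have sXt : ∀ v, ContDiffOn ℝ ∞ (fun y => fderiv ℝ X y v) J := fun v =>
    contDiffOn_fderiv_const hJ _ hX.smooth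
  have sc₀ : ContDiffOn ℝ ∞ (timeShift X U) J := (sUt _).sub (o₁.smooth.mul (sXt _))
  have sc₁ : ContDiffOn ℝ ∞ (timeFactor X U) J := (sUt _).sub (o₁.smooth.mul (sXt _))
  have dA := differentiableAt_of_contDiffOn hJ sA hj
  have dB := differentiableAt_of_contDiffOn hJ (contDiffOn_D hJ o₂) hj
  have dDX := differentiableAt_of_contDiffOn hJ (hX.D hJ).smooth hj
  have dc₀ := differentiableAt_of_contDiffOn hJ sc₀ hj
  have dc₁ := differentiableAt_of_contDiffOn hJ sc₁ hj
  have dF := differentiableAt_of_contDiffOn hJ hF hj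
  have dG := differentiableAt_of_contDiffOn hJ hG hj
  have d₁ := differentiableAt_of_contDiffOn hJ o₁.smooth hj
  -- the derivative of `D X`
  have eDX : fderiv ℝ (D X) j (prol Q j) = -D (xiJ Q) j * D X j := by
    have : D (fun y => fderiv ℝ X y (prol Q y)) j = 0 := by
      rw [D, fderiv_zero_on hJ hQX hj]; simp
    rw [hX.prol_D hJ hQ hj, this]; ring
  -- the derivative of the leading coefficient of `u'₃`
  have ec₁ : fderiv ℝ (timeFactor X U) j (prol Q j)
      = fderiv ℝ (fun y => fderiv ℝ (newU₂ X U) y u₂Dir) j (prol Q j) * D X j ^ 2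
        - 2 * fderiv ℝ (newU₂ X U) j u₂Dir * D X j * (D (xiJ Q) j * D X j) := by
    rw [fderiv_congr_on hJ (fun y hy => (fderiv_newU₂_u₂Dir hJ hX hU hDX hy).symm) hj,
      (dA.hasFDerivAt.fun_mul (dDX.hasFDerivAt.pow 2)).fderiv]
    simp [eDX]
    ring
  -- the derivative of `u'₃`
  have e₃ : ∀ s, fderiv ℝ (D (newU₂ X U)) j (prol Q j)
        + s * fderiv ℝ (fun y => fderiv ℝ (newU₂ X U) y u₂Dir) j (prol Q j)
        + eta₃ Q s j * fderiv ℝ (newU₂ X U) j u₂Dir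
      = D X j * dx (dx (dx Φ)) (j.1, X j)
        - D (xiJ Q) j * (D (newU₂ X U) j + s * fderiv ℝ (newU₂ X U) j u₂Dir) := by
    intro s
    have h := prol_tot hJ hQ o₂ hj s
    have h1 : (fun y => fderiv ℝ (newU₂ X U) y (tot s y))
        = fun y => D (newU₂ X U) y + s * fderiv ℝ (newU₂ X U) y u₂Dir := by
      ext y; rw [fderiv_tot_eq]
    rw [h1, fderiv_fun_add dB (dA.const_mul s), fderiv_const_mul dA, fderiv_tot_eq (newU₂ X U),
      fderiv_congr_on hJ r₂ hj, fderiv_comp_pair (differentiableAt_of_contDiffOn hJ hX.smooth hj)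
      (hΦ₂d j hj), hX.fderiv_tot hj] at h
    simpa [tot] using h
  -- the derivative of `u'_{t'}`
  have e_t : ∀ q, fderiv ℝ (timeShift X U) j (prol Q j) + q * fderiv ℝ (timeFactor X U) j (prol Q j)
      + timeFactor X U j * (fderiv ℝ (etaJ Q) j (1, 0, q, 0, 0)
          - j.2.2.2.1 * fderiv ℝ (xiJ Q) j (1, 0, q, 0, 0)) = dt Φ (j.1, X j) := by
    intro q
    have hU' := hU.prol_time hJ hQ hj q
    have hX' := hX.prol_time hJ hQ hj q
    rw [fderiv_zero_on hJ hQX hj] at hX'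
    rw [fderiv_congr_on hJ hQU hj, fderiv_comp_pair
      (differentiableAt_of_contDiffOn hJ hX.smooth hj) (hΦd j hj)] at hU'
    have hsum : ∀ y, timeShift X U y + q * timeFactor X U y
        = fderiv ℝ U y (1, 0, q, 0, 0) - newU₁ X U y * fderiv ℝ X y (1, 0, q, 0, 0) := by
      intro y
      have : ((1, 0, q, 0, 0) : Jet) = (1, 0, 0, 0, 0) + q • uDir := by simp [uDir]
      rw [this, map_add, map_add, map_smul, map_smul, smul_eq_mul, smul_eq_mul, timeShift,
        timeFactor]
      ring
    have h := DFunLike.congr_fun (fderiv_congr_on hJ (fun y _ => hsum y) hj) (prol Q j)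
    have dU := differentiableAt_of_contDiffOn hJ (sUt (1, 0, q, 0, 0)) hj
    have dX := differentiableAt_of_contDiffOn hJ (sXt (1, 0, q, 0, 0)) hj
    rw [fderiv_fun_add dc₀ (dc₁.const_mul q), fderiv_const_mul dc₁,
      fderiv_fun_sub dU (d₁.fun_mul dX), fderiv_fun_mul d₁ dX] at h
    simp only [add_apply, smul_apply, smul_eq_mul,
      sub_apply, r₁ j hj] at h
    simp only [zero_apply] at hX'
    rw [D_eq_newU₁_mul hDX j hj] at hU'
    rw [timeFactor]
    linear_combination h + hU' - newU₁ X U j * hX'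
  -- the derivatives of the transformed coefficients
  have eF : fderiv ℝ (newF X F) j (prol Q j) = D X j ^ 3 *
      (fderiv ℝ F j (prol Q j) - 3 * F j * D (xiJ Q) j) := by
    have : newF X F = fun y => F y * D X y ^ 3 := rfl
    rw [this, (dF.hasFDerivAt.fun_mul (dDX.hasFDerivAt.pow 3)).fderiv]
    simp [eDX]
    ring
  have eG : fderiv ℝ (newG X U F G) j (prol Q j)
      = fderiv ℝ (timeShift X U) j (prol Q j)
        + (fderiv ℝ (timeFactor X U) j (prol Q j) * G j
          + timeFactor X U j * fderiv ℝ G j (prol Q j))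
        - fderiv ℝ F j (prol Q j) * (D X j ^ 2 * D (newU₂ X U) j)
        - F j * (-2 * D X j ^ 2 * D (xiJ Q) j * D (newU₂ X U) j
          + D X j ^ 2 * fderiv ℝ (D (newU₂ X U)) j (prol Q j)) := by
    have : newG X U F G = fun y => timeShift X U y + timeFactor X U y * G y
        - F y * (D X y ^ 2 * D (newU₂ X U) y) := rfl
    rw [this, ((dc₀.hasFDerivAt.fun_add (dc₁.hasFDerivAt.fun_mul dG.hasFDerivAt)).fun_sub
      (dF.hasFDerivAt.fun_mul ((dDX.hasFDerivAt.pow 2).fun_mul dB.hasFDerivAt))).fderiv]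
    simp [eDX]
    ring
  have hc := fderiv_newU₂_u₂Dir hJ hX hU hDX hj
  have hsym := fun s => hs.jet_identity hJ hQ hτ hj s
  have hA0 : fderiv ℝ (newU₂ X U) j u₂Dir ≠ 0 := by
    intro h0
    rw [h0, zero_mul] at hc
    exact hT j hj hc.symm
  have hDX0 := hDX j hj
  rw [ec₁] at e_t eG
  generalize fderiv ℝ (newU₂ X U) j u₂Dir = A at *
  generalize fderiv ℝ (fun y => fderiv ℝ (newU₂ X U) y u₂Dir) j (prol Q j) = A' at *
  generalize fderiv ℝ (timeShift X U) j (prol Q j) = c0' at *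
  generalize fderiv ℝ (D (newU₂ X U)) j (prol Q j) = B' at *
  rw [← hc] at e_t eG
  -- On solutions u_t = F s + G with u₃ = s; the symmetry condition, the action on u'_{t'} and the
  -- action on u'₃ then combine to an identity affine in s. Both coefficients vanish: the linear one
  -- gives the invariance of the new F, the constant one the action on the new G.
  have main : ∀ s, c0' + G j * (A' * D X j ^ 2 - 2 * A * D X j * (D (xiJ Q) j * D X j))
      + A * D X j ^ 2 * fderiv ℝ G j (prol Q j) + F j * D X j ^ 2 *
        (D X j * dx (dx (dx Φ)) (j.1, X j) - D (xiJ Q) j * D (newU₂ X U) j - B')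
      - dt Φ (j.1, X j)
      + s * (A * D X j ^ 2 * (fderiv ℝ F j (prol Q j) - 3 * F j * D (xiJ Q) j)) = 0 := by
    intro s
    linear_combination e_t (F j * s + G j) - A * D X j ^ 2 * hsym s - F j * D X j ^ 2 * e₃ s
  have m0 := main 0
  have m1 := main 1
  have hF' : fderiv ℝ F j (prol Q j) - 3 * F j * D (xiJ Q) j = 0 := by
    have : A * D X j ^ 2 * (fderiv ℝ F j (prol Q j) - 3 * F j * D (xiJ Q) j) = 0 := by
      linear_combination m1 - m0
    exact (mul_eq_zero.1 this).resolve_left (mul_ne_zero hA0 (pow_ne_zero 2 hDX0))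
  refine ⟨by rw [eF, hF', mul_zero], ?_⟩
  rw [eG, newF]
  linear_combination m0 - D X j ^ 2 * D (newU₂ X U) j * hF'

end Transformation

/-! ### Transformation of functions and of the equation they satisfy. -/

section TransformFunctions

theorem fderiv_comp_graph {g χ : ℝ × ℝ → ℝ} {z : ℝ × ℝ} (hχ : DifferentiableAt ℝ χ z)
    (hg : DifferentiableAt ℝ g (z.1, χ z)) :
    dx (fun y => g (y.1, χ y)) z = dx g (z.1, χ z) * dx χ z ∧
    dt (fun y => g (y.1, χ y)) z = dt g (z.1, χ z) + dx g (z.1, χ z) * dt χ z := by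
  have h1 : HasFDerivAt (fun y : ℝ × ℝ => (y.1, χ y))
    ((ContinuousLinearMap.fst ℝ ℝ _).prod (fderiv ℝ χ z)) z :=
    hasFDerivAt_fst.prodMk hχ.hasFDerivAt
  have h2 := hg.hasFDerivAt.comp z h1
  change HasFDerivAt (fun y : ℝ × ℝ => g (y.1, χ y)) _ z at h2
  have h3 : ∀ a b : ℝ, fderiv ℝ g (z.1, χ z) (a, b) = a * dt g (z.1, χ z) + b * dx g (z.1, χ z) := by
    intro a b
    have : ((a, b) : ℝ × ℝ) = a • (1, 0) + b • (0, 1) := by simp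
    rw [this, map_add, map_smul, map_smul]
    rfl
  constructor
  · rw [dx, h2.fderiv]
    change fderiv ℝ g (z.1, χ z) (0, fderiv ℝ χ z (0, 1)) = _
    rw [h3, zero_mul, zero_add, mul_comm]
    rfl
  · rw [dt, h2.fderiv]
    change fderiv ℝ g (z.1, χ z) (1, fderiv ℝ χ z (1, 0)) = _
    rw [h3, one_mul, mul_comm (fderiv ℝ χ z (1, 0))]
    rfl

variable {J : Set Jet} {X U : Jet → ℝ} {w v : ℝ × ℝ → ℝ} {z : ℝ × ℝ}

/-- If the function `v` extends `R` along the transformed graph of `w`, then `v_x` extends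
`D R / D X`. -/
theorem dx_transformed (hJ : IsOpen J) (hX : OrderZero J X) (hDX : ∀ j ∈ J, D X j ≠ 0)
    (hw : ContDiffAt ℝ ∞ w z) (hw1 : ∀ᶠ y in 𝓝 z, dx (fun y => X (jet w y)) y = D X (jet w y))
    (hz : jet w z ∈ J) (hv : ContDiffAt ℝ ∞ v (z.1, X (jet w z)))
    {R : Jet → ℝ} {R' : ℝ × ℝ → ℝ}
    (hR : ∀ᶠ y in 𝓝 z, dx (fun y => R (jet w y)) y = R' y)
    (h : ∀ᶠ y in 𝓝 z, v (y.1, X (jet w y)) = R (jet w y)) :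
    ∀ᶠ y in 𝓝 z, dx v (y.1, X (jet w y)) = R' y / D X (jet w y) := by
  have sX := contDiffAt_comp_jet hJ hX.smooth hw hz
  have cont : ContinuousAt (fun y : ℝ × ℝ => (y.1, X (jet w y))) z :=
    continuousAt_fst.prodMk sX.continuousAt
  filter_upwards [hw1, hR, h.eventually_nhds, eventually_jet_mem hJ hw hz,
    cont.eventually (eventually_differentiableAt hv), eventually_differentiableAt sX]
    with y h1 h2 h3 h4 h5 h6
  have h7 := (fderiv_comp_graph h6 h5).1
  rw [dx_congr h3, h2, h1] at h7
  rw [h7, mul_div_cancel_right₀ _ (hDX _ h4)]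

/-- The third-order jet of the transformed function. -/
theorem jet_transformed (hJ : IsOpen J) (hX : OrderZero J X) (hU : OrderZero J U)
    (hDX : ∀ j ∈ J, D X j ≠ 0) (hw : ContDiffAt ℝ ∞ w z) (hz : jet w z ∈ J)
    (hv : ContDiffAt ℝ ∞ v (z.1, X (jet w z)))
    (h : ∀ᶠ y in 𝓝 z, v (y.1, X (jet w y)) = U (jet w y)) :
    jet v (z.1, X (jet w z)) = (z.1, X (jet w z), U (jet w z), newU₁ X U (jet w z),
      newU₂ X U (jet w z)) ∧
    dt v (z.1, X (jet w z)) = timeShift X U (jet w z) + timeFactor X U (jet w z) * dt w z ∧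
    dx (dx (dx v)) (z.1, X (jet w z)) = (D (newU₂ X U) (jet w z)
      + dx (dx (dx w)) z * fderiv ℝ (newU₂ X U) (jet w z) u₂Dir) / D X (jet w z) := by
  have o₁ := orderOne_newU₁ hJ hX hU hDX
  have sX := contDiffAt_comp_jet hJ hX.smooth hw hz
  have sw : ∀ᶠ y in 𝓝 z, DifferentiableAt ℝ w y ∧ DifferentiableAt ℝ (dx w) y ∧
      DifferentiableAt ℝ (dx (dx w)) y :=
    (eventually_differentiableAt hw).and ((eventually_differentiableAt (contDiffAt_dx hw)).and
      (eventually_differentiableAt (contDiffAt_dx (contDiffAt_dx hw))))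
  have ev : ∀ f : Jet → ℝ, ContDiffOn ℝ ∞ f J → ∀ᶠ y in 𝓝 z,
      dx (fun y => f (jet w y)) y = fderiv ℝ f (jet w y) (tot (dx (dx (dx w)) y) (jet w y)) := by
    intro f hf
    filter_upwards [sw, eventually_jet_mem hJ hw hz] with y h1 h2
    have hj : HasFDerivAt (jet w) _ y :=
      hasFDerivAt_fst.prodMk (hasFDerivAt_snd.prodMk (h1.1.hasFDerivAt.prodMk
        (h1.2.1.hasFDerivAt.prodMk h1.2.2.hasFDerivAt)))
    have := (differentiableAt_of_contDiffOn hJ hf h2).hasFDerivAt.comp y hj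
    change HasFDerivAt (fun y => f (jet w y)) _ y at this
    rw [dx, this.fderiv]
    rfl
  have ev₁ : ∀ f : Jet → ℝ, OrderOne J f → ∀ᶠ y in 𝓝 z,
      dx (fun y => f (jet w y)) y = D f (jet w y) := by
    intro f hf
    filter_upwards [ev f hf.smooth, eventually_jet_mem hJ hw hz] with y h1 h2
    rw [h1, hf.fderiv_tot h2]
  have hX1 := ev₁ X hX.toOrderOne
  have v1 : ∀ᶠ y in 𝓝 z, dx v (y.1, X (jet w y)) = newU₁ X U (jet w y) :=
    dx_transformed hJ hX hDX hw hX1 hz hv (ev₁ U hU.toOrderOne) h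
  have v2 : ∀ᶠ y in 𝓝 z, dx (dx v) (y.1, X (jet w y)) = newU₂ X U (jet w y) :=
    dx_transformed hJ hX hDX hw hX1 hz (contDiffAt_dx hv) (ev₁ _ o₁) v1
  have v3 := dx_transformed hJ hX hDX hw hX1 hz (contDiffAt_dx (contDiffAt_dx hv))
    (ev _ (contDiffOn_newU₂ hJ hX hU hDX)) v2
  refine ⟨?_, ?_, ?_⟩
  · rw [jet, h.self_of_nhds, v1.self_of_nhds, v2.self_of_nhds]
  · have h1 := (fderiv_comp_graph (sX.differentiableAt (by simp))
      (hv.differentiableAt (by simp))).2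
    rw [dt_congr h, hU.dt_comp_jet hJ hw hz, hX.dt_comp_jet hJ hw hz, v1.self_of_nhds] at h1
    have h2 : ((1, 0, dt w z, 0, 0) : Jet) = (1, 0, 0, 0, 0) + dt w z • uDir := by simp [uDir]
    rw [h2] at h1
    simp only [map_add, map_smul, smul_eq_mul] at h1
    rw [timeShift, timeFactor]
    linarith
  · rw [v3.self_of_nhds, fderiv_tot_eq]

/-- The equation satisfied by the transformed function. -/
theorem holdsAt_transformed (hJ : IsOpen J) (hX : OrderZero J X) (hU : OrderZero J U)
    (hDX : ∀ j ∈ J, D X j ≠ 0) (hT : ∀ j ∈ J, timeFactor X U j ≠ 0) (F G : Jet → ℝ)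
    (hw : ContDiffAt ℝ ∞ w z) (hz : jet w z ∈ J)
    (hv : ContDiffAt ℝ ∞ v (z.1, X (jet w z)))
    (h : ∀ᶠ y in 𝓝 z, v (y.1, X (jet w y)) = U (jet w y)) :
    HoldsAt F G w z ↔ dt v (z.1, X (jet w z)) =
      newF X F (jet w z) * dx (dx (dx v)) (z.1, X (jet w z)) + newG X U F G (jet w z) := by
  obtain ⟨-, h1, h2⟩ := jet_transformed hJ hX hU hDX hw hz hv h
  rw [h1, h2, HoldsAt, newF, newG]
  have hA := fderiv_newU₂_u₂Dir hJ hX hU hDX hz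
  have hD := hDX _ hz
  have hc := hT _ hz
  -- With this rewriting, the transformed equation becomes `timeFactor` times the original one: the
  -- terms with D u'₂ cancel against those in `newG`.
  have key : F (jet w z) * D X (jet w z) ^ 3 * ((D (newU₂ X U) (jet w z)
        + dx (dx (dx w)) z * fderiv ℝ (newU₂ X U) (jet w z) u₂Dir) / D X (jet w z))
      = F (jet w z) * (D X (jet w z) ^ 2 * D (newU₂ X U) (jet w z)) +
        timeFactor X U (jet w z) * (F (jet w z) * dx (dx (dx w)) z) := by
    rw [← hA]
    field_simp
  rw [key]
  constructor
  · intro h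
    rw [h]; ring
  · intro h
    refine mul_left_cancel₀ hc ?_
    linarith

end TransformFunctions

/-! ### The new variables form a coordinate system on jets. -/

section NewCoordinates

variable {J : Set Jet} {X U : Jet → ℝ}

/-- The new coordinates on the jet space. -/
noncomputable def newJet (X U : Jet → ℝ) (j : Jet) : Jet :=
  (j.1, X j, U j, newU₁ X U j, newU₂ X U j)

theorem contDiffOn_newJet (hJ : IsOpen J) (hX : OrderZero J X) (hU : OrderZero J U)
    (hDX : ∀ j ∈ J, D X j ≠ 0) : ContDiffOn ℝ ∞ (newJet X U) J :=
  contDiffOn_fst.prodMk (hX.smooth.prodMk (hU.smooth.prodMk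
    ((orderOne_newU₁ hJ hX hU hDX).smooth.prodMk (contDiffOn_newU₂ hJ hX hU hDX))))

theorem fderiv_newJet (hJ : IsOpen J) (hX : OrderZero J X) (hU : OrderZero J U)
    (hDX : ∀ j ∈ J, D X j ≠ 0) {j : Jet} (hj : j ∈ J) (v : Jet) :
    fderiv ℝ (newJet X U) j v = (v.1, fderiv ℝ X j v, fderiv ℝ U j v, fderiv ℝ (newU₁ X U) j v,
      fderiv ℝ (newU₂ X U) j v) := by
  have h1 := (differentiableAt_of_contDiffOn hJ hX.smooth hj).hasFDerivAt
  have h2 := (differentiableAt_of_contDiffOn hJ hU.smooth hj).hasFDerivAt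
  have h3 := (differentiableAt_of_contDiffOn hJ
    (orderOne_newU₁ hJ hX hU hDX).smooth hj).hasFDerivAt
  have h4 := (differentiableAt_of_contDiffOn hJ (contDiffOn_newU₂ hJ hX hU hDX) hj).hasFDerivAt
  have : HasFDerivAt (newJet X U) _ j :=
    hasFDerivAt_fst.prodMk (h1.prodMk (h2.prodMk (h3.prodMk h4)))
  rw [this.fderiv]
  rfl

/-- In the basis `tot 0 j`, `uDir` of the (x, u)-directions (modulo u₁, u₂), the differential of (X,
U) has determinant D X · `timeFactor`, which is not zero. -/
theorem eq_zero_of_fderiv_eq_zero (hX : OrderZero J X) (hU : OrderZero J U)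
    (hDX : ∀ j ∈ J, D X j ≠ 0) (hT : ∀ j ∈ J, timeFactor X U j ≠ 0) {j : Jet} (hj : j ∈ J)
    {v : Jet} (h0 : v.1 = 0) (h1 : fderiv ℝ X j v = 0) (h2 : fderiv ℝ U j v = 0) :
    v.2.1 = 0 ∧ v.2.2.1 = 0 := by
  have hv : v = v.2.1 • tot 0 j + (v.2.2.1 - v.2.1 * j.2.2.2.1) • uDir
      + (v.2.2.2.1 - v.2.1 * j.2.2.2.2) • u₁Dir + v.2.2.2.2 • u₂Dir := by
    obtain ⟨a, b, c, d, e⟩ := v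
    simp only at h0
    simp [tot, uDir, u₁Dir, u₂Dir, h0]
  rw [hv] at h1 h2
  simp only [map_add, map_smul, smul_eq_mul, hX.u₁ j hj, hX.u₂ j hj, hU.u₁ j hj,
    hU.u₂ j hj] at h1 h2
  change v.2.1 * D X j + _ + _ + _ = 0 at h1
  change v.2.1 * D U j + _ + _ + _ = 0 at h2
  rw [D_eq_newU₁_mul hDX j hj] at h2
  have h3 : (v.2.2.1 - v.2.1 * j.2.2.2.1) * timeFactor X U j = 0 := by
    rw [timeFactor]; linear_combination h2 - newU₁ X U j * h1
  have h4 := (mul_eq_zero.1 h3).resolve_right (hT j hj)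
  rw [h4] at h1
  have h5 : v.2.1 = 0 := by
    have : v.2.1 * D X j = 0 := by linarith
    exact (mul_eq_zero.1 this).resolve_right (hDX j hj)
  refine ⟨h5, ?_⟩
  rw [h5] at h4
  linarith

/-- The Jacobian is block triangular: after (t, X, U), the function u'₁ depends on u₁ but not on u₂,
and u'₂ depends on u₂, with nonzero partial derivatives. -/
theorem fderiv_newJet_injective (hJ : IsOpen J) (hX : OrderZero J X) (hU : OrderZero J U)
    (hDX : ∀ j ∈ J, D X j ≠ 0) (hT : ∀ j ∈ J, timeFactor X U j ≠ 0) {j : Jet} (hj : j ∈ J)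
    (v : Jet) (hv : fderiv ℝ (newJet X U) j v = 0) : v = 0 := by
  rw [fderiv_newJet hJ hX hU hDX hj] at hv
  simp only [Prod.mk_eq_zero] at hv
  obtain ⟨h0, h1, h2, h3, h4⟩ := hv
  obtain ⟨h5, h6⟩ := eq_zero_of_fderiv_eq_zero hX hU hDX hT hj h0 h1 h2
  have hv : v = v.2.2.2.1 • u₁Dir + v.2.2.2.2 • u₂Dir := by
    obtain ⟨a, b, c, d, e⟩ := v
    simp only at h0 h5 h6
    simp [u₁Dir, u₂Dir, h0, h5, h6]
  have a1 := fderiv_newU₁_u₁Dir hJ hX hU hDX hj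
  have a2 := fderiv_newU₂_u₂Dir hJ hX hU hDX hj
  have b1 : fderiv ℝ (newU₁ X U) j u₁Dir ≠ 0 := by
    intro h; rw [h, zero_mul] at a1; exact hT j hj a1.symm
  have b2 : fderiv ℝ (newU₂ X U) j u₂Dir ≠ 0 := by
    intro h; rw [h, zero_mul] at a2; exact hT j hj a2.symm
  rw [hv] at h3
  simp only [map_add, map_smul, smul_eq_mul, (orderOne_newU₁ hJ hX hU hDX).u₂ j hj, mul_zero,
    add_zero] at h3
  have h7 := (mul_eq_zero.1 h3).resolve_right b1
  rw [hv, h7] at h4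
  simp only [map_smul, smul_eq_mul, zero_smul, zero_add] at h4
  have h8 := (mul_eq_zero.1 h4).resolve_right b2
  rw [hv, h7, h8]
  simp

end NewCoordinates

/-- Coordinates `X₀`, `U₀` in which three symmetries take the form `∂_u`, `x ∂_u`, `Ψ (t, x) ∂_u`. -/
structure Adapted (J : Set Jet) (F G : Jet → ℝ) (X₀ U₀ : Pt → ℝ) (Ψ : ℝ × ℝ → ℝ)
    (Q : Fin 3 → Pt → Pt) : Prop where
  isOpen : IsOpen J
  smooth_F : ContDiffOn ℝ ∞ F J
  smooth_G : ContDiffOn ℝ ∞ G J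
  smooth_X : ContDiffOn ℝ ∞ X₀ (base '' J)
  smooth_U : ContDiffOn ℝ ∞ U₀ (base '' J)
  smooth_Ψ : ∀ p ∈ base '' J, ContDiffAt ℝ ∞ Ψ (p.1, X₀ p)
  DX_ne_zero : ∀ j ∈ J, D (fun j => X₀ (base j)) j ≠ 0
  smooth_Q : ∀ i, ContDiffOn ℝ ∞ (Q i) (base '' J)
  tau : ∀ i, ∀ p ∈ base '' J, (Q i p).1 = 0
  symmetry : ∀ i, IsPointSymmetry J F G (Q i)
  Q_X : ∀ i, ∀ p ∈ base '' J, fderiv ℝ X₀ p (Q i p) = 0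
  Q₀_U : ∀ p ∈ base '' J, fderiv ℝ U₀ p (Q 0 p) = 1
  Q₁_U : ∀ p ∈ base '' J, fderiv ℝ U₀ p (Q 1 p) = X₀ p
  Q₂_U : ∀ p ∈ base '' J, fderiv ℝ U₀ p (Q 2 p) = Ψ (p.1, X₀ p)

/-! ### Equations with the symmetries ∂_u, x ∂_u and Ψ(t, x) ∂_u. -/

namespace Adapted

variable {J : Set Jet} {F G : Jet → ℝ} {X₀ U₀ : Pt → ℝ} {Ψ : ℝ × ℝ → ℝ} {Q : Fin 3 → Pt → Pt}

theorem orderZero_X (h : Adapted J F G X₀ U₀ Ψ Q) : OrderZero J (fun j => X₀ (base j)) :=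
  orderZero_comp_base h.isOpen h.smooth_X

theorem orderZero_U (h : Adapted J F G X₀ U₀ Ψ Q) : OrderZero J (fun j => U₀ (base j)) :=
  orderZero_comp_base h.isOpen h.smooth_U

theorem fderiv_prol_comp_base (h : Adapted J F G X₀ U₀ Ψ Q) {φ : Pt → ℝ}
    (hφ : ContDiffOn ℝ ∞ φ (base '' J)) (i : Fin 3) {j : Jet} (hj : j ∈ J) :
    fderiv ℝ (fun j => φ (base j)) j (prol (Q i) j) = fderiv ℝ φ (base j) (Q i (base j)) := by
  rw [fderiv_comp_base (differentiableAt_of_contDiffOn (isOpen_base_image h.isOpen) hφ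
    (mem_image_of_mem _ hj))]
  congr 1
  have := h.tau i (base j) (mem_image_of_mem _ hj)
  rw [base, prol, ← this]
  rfl

/-- If it vanished, the fibre parts of dX and dU would be proportional, and Q₀ X = 0 would give Q₀ U
= 0 instead of 1. -/
theorem timeFactor_ne_zero (h : Adapted J F G X₀ U₀ Ψ Q) :
    ∀ j ∈ J, timeFactor (fun j => X₀ (base j)) (fun j => U₀ (base j)) j ≠ 0 := by
  intro j hj h0
  have hX := h.orderZero_X
  have hU := h.orderZero_U
  have hQX := h.fderiv_prol_comp_base h.smooth_X 0 hj
  have hQU := h.fderiv_prol_comp_base h.smooth_U 0 hj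
  rw [h.Q_X 0 _ (mem_image_of_mem _ hj)] at hQX
  rw [h.Q₀_U _ (mem_image_of_mem _ hj)] at hQU
  have hd := D_eq_newU₁_mul (U := fun j => U₀ (base j)) h.DX_ne_zero j hj
  set X : Jet → ℝ := fun j => X₀ (base j)
  set U : Jet → ℝ := fun j => U₀ (base j)
  set v := prol (Q 0) j with hvdef
  have hv : v = v.2.1 • tot 0 j + (v.2.2.1 - v.2.1 * j.2.2.2.1) • uDir
      + (v.2.2.2.1 - v.2.1 * j.2.2.2.2) • u₁Dir + v.2.2.2.2 • u₂Dir := by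
    simp [tot, uDir, u₁Dir, u₂Dir, hvdef, prol]
  rw [hv] at hQX hQU
  simp only [map_add, map_smul, smul_eq_mul, hX.u₁ j hj, hX.u₂ j hj, hU.u₁ j hj,
    hU.u₂ j hj] at hQX hQU
  change v.2.1 * D X j + _ + _ + _ = 0 at hQX
  change v.2.1 * D U j + _ + _ + _ = 1 at hQU
  rw [hd] at hQU
  rw [timeFactor] at h0
  have : (0 : ℝ) = 1 := by
    linear_combination hQU - newU₁ X U j * hQX - (v.2.2.1 - v.2.1 * j.2.2.2.1) * h0
  exact zero_ne_one this

theorem action_aux (h : Adapted J F G X₀ U₀ Ψ Q) (i : Fin 3) {Φ : ℝ × ℝ → ℝ}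
    (hΦ : ∀ p ∈ base '' J, ContDiffAt ℝ ∞ Φ (p.1, X₀ p))
    (hQU : ∀ p ∈ base '' J, fderiv ℝ U₀ p (Q i p) = Φ (p.1, X₀ p)) {j : Jet} (hj : j ∈ J) :
    fderiv ℝ (newJet (fun j => X₀ (base j)) (fun j => U₀ (base j))) j (prol (Q i) j)
      = (0, 0, Φ (j.1, X₀ (base j)), dx Φ (j.1, X₀ (base j)), dx (dx Φ) (j.1, X₀ (base j))) ∧
    fderiv ℝ (newF (fun j => X₀ (base j)) F) j (prol (Q i) j) = 0 ∧
    fderiv ℝ (newG (fun j => X₀ (base j)) (fun j => U₀ (base j)) F G) j (prol (Q i) j)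
      = dt Φ (j.1, X₀ (base j)) - newF (fun j => X₀ (base j)) F j
        * dx (dx (dx Φ)) (j.1, X₀ (base j)) := by
  have hQX : ∀ j ∈ J, fderiv ℝ (fun j => X₀ (base j)) j (prol (Q i) j) = 0 := fun j hj => by
    rw [h.fderiv_prol_comp_base h.smooth_X i hj, h.Q_X i _ (mem_image_of_mem _ hj)]
  have hQU' : ∀ j ∈ J, fderiv ℝ (fun j => U₀ (base j)) j (prol (Q i) j)
      = Φ (j.1, X₀ (base j)) := fun j hj => by
    rw [h.fderiv_prol_comp_base h.smooth_U i hj, hQU _ (mem_image_of_mem _ hj)]; rfl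
  obtain ⟨a, b, c, d⟩ := prol_transformed h.isOpen h.smooth_F h.smooth_G (h.smooth_Q i) (h.tau i)
    (h.symmetry i) h.orderZero_X h.orderZero_U h.DX_ne_zero h.timeFactor_ne_zero hQX
    (Φ := Φ) (fun j hj => hΦ _ (mem_image_of_mem _ hj)) hQU'
  refine ⟨?_, c j hj, d j hj⟩
  rw [fderiv_newJet h.isOpen h.orderZero_X h.orderZero_U h.DX_ne_zero hj, hQX j hj, hQU' j hj,
    a j hj, b j hj]
  rfl

theorem dx_const (c : ℝ) : dx (fun _ => c) = fun _ => 0 := by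
  ext z; simp [dx]

theorem dx_snd : dx (fun z => z.2) = fun _ => 1 := by
  ext z
  have : HasFDerivAt (fun z : ℝ × ℝ => z.2) (ContinuousLinearMap.snd ℝ ℝ ℝ) z := hasFDerivAt_snd
  rw [dx, this.fderiv]; rfl

theorem dt_snd : dt (fun z => z.2) = fun _ => 0 := by
  ext z
  have : HasFDerivAt (fun z : ℝ × ℝ => z.2) (ContinuousLinearMap.snd ℝ ℝ ℝ) z := hasFDerivAt_snd
  rw [dt, this.fderiv]; rfl

/-- The action of the three symmetries on new coordinates and on the transformed equation. -/
theorem action (h : Adapted J F G X₀ U₀ Ψ Q) {j : Jet} (hj : j ∈ J) :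
    (fderiv ℝ (newJet (fun j => X₀ (base j)) (fun j => U₀ (base j))) j (prol (Q 0) j)
        = (0, 0, 1, 0, 0) ∧
      fderiv ℝ (newF (fun j => X₀ (base j)) F) j (prol (Q 0) j) = 0 ∧
      fderiv ℝ (newG (fun j => X₀ (base j)) (fun j => U₀ (base j)) F G) j (prol (Q 0) j) = 0) ∧
    (fderiv ℝ (newJet (fun j => X₀ (base j)) (fun j => U₀ (base j))) j (prol (Q 1) j)
        = (0, 0, X₀ (base j), 1, 0) ∧
      fderiv ℝ (newF (fun j => X₀ (base j)) F) j (prol (Q 1) j) = 0 ∧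
      fderiv ℝ (newG (fun j => X₀ (base j)) (fun j => U₀ (base j)) F G) j (prol (Q 1) j) = 0) ∧
    (fderiv ℝ (newJet (fun j => X₀ (base j)) (fun j => U₀ (base j))) j (prol (Q 2) j)
        = (0, 0, Ψ (j.1, X₀ (base j)), dx Ψ (j.1, X₀ (base j)), dx (dx Ψ) (j.1, X₀ (base j))) ∧
      fderiv ℝ (newF (fun j => X₀ (base j)) F) j (prol (Q 2) j) = 0 ∧
      fderiv ℝ (newG (fun j => X₀ (base j)) (fun j => U₀ (base j)) F G) j (prol (Q 2) j)
        = dt Ψ (j.1, X₀ (base j)) - newF (fun j => X₀ (base j)) F j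
          * dx (dx (dx Ψ)) (j.1, X₀ (base j))) := by
  have h0 := h.action_aux 0 (Φ := fun _ => 1) (fun _ _ => contDiffAt_const) h.Q₀_U hj
  have h1 := h.action_aux 1 (Φ := fun z => z.2) (fun _ _ => contDiffAt_snd) h.Q₁_U hj
  have h2 := h.action_aux 2 h.smooth_Ψ h.Q₂_U hj
  refine ⟨?_, ?_, h2⟩
  · simpa [dx_const, dt] using h0
  · simpa [dx_const, dx_snd, dt_snd] using h1

/-- If `Ψ` is affine in `x`, then it does not depend on `t`. -/
theorem dt_eq_zero (h : Adapted J F G X₀ U₀ Ψ Q)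
    (h2 : ∀ p ∈ base '' J, dx (dx Ψ) (p.1, X₀ p) = 0) : ∀ p ∈ base '' J, dt Ψ (p.1, X₀ p) = 0 := by
  rintro _ ⟨j, hj, rfl⟩
  obtain ⟨⟨a0, -, c0⟩, ⟨a1, -, c1⟩, ⟨a2, -, c2⟩⟩ := h.action hj
  have hinj := fderiv_newJet_injective h.isOpen h.orderZero_X h.orderZero_U h.DX_ne_zero
    h.timeFactor_ne_zero hj
  have hxx : dx (dx Ψ) (j.1, X₀ (base j)) = 0 := h2 _ (mem_image_of_mem _ hj)
  -- Total differentiation of Ψ_xx(t, X) = 0 gives D X · Ψ_xxx = 0.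
  have hxxx : dx (dx (dx Ψ)) (j.1, X₀ (base j)) = 0 := by
    have e := DFunLike.congr_fun (fderiv_zero_on h.isOpen
      (f := fun j => dx (dx Ψ) (j.1, X₀ (base j)))
      (fun j hj => h2 _ (mem_image_of_mem _ hj)) hj) (tot 0 j)
    rw [fderiv_comp_pair (X := fun j => X₀ (base j))
      (differentiableAt_of_contDiffOn h.isOpen h.orderZero_X.smooth hj)
      ((contDiffAt_dx (contDiffAt_dx (h.smooth_Ψ _ (mem_image_of_mem _ hj)))).differentiableAt
        (by simp))] at e
    simp only [tot, zero_mul, zero_add, zero_apply] at e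
    exact (mul_eq_zero.1 e).resolve_left (h.DX_ne_zero j hj)
  rw [hxx] at a2
  -- With Ψ_xx = 0 both sides have the same new coordinates (u, u₁, u₂), so they agree. The new G is
  -- annihilated by the right side, whereas the third symmetry maps it to Ψ_t.
  have hv : prol (Q 2) j = Ψ (j.1, X₀ (base j)) • prol (Q 0) j + dx Ψ (j.1, X₀ (base j)) •
      (prol (Q 1) j - X₀ (base j) • prol (Q 0) j) := by
    refine sub_eq_zero.1 (hinj _ ?_)
    rw [map_sub, map_add, map_smul, map_smul, map_sub, map_smul, a0, a1, a2]
    simp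
  rw [hv, map_add, map_smul, map_smul, map_sub, map_smul, c0, c1, hxxx] at c2
  change dt Ψ (j.1, X₀ (base j)) = 0
  simpa using c2.symm

/-- Since Ψ_xx ≠ 0, the three prolonged symmetries span the (u, u₁, u₂)-directions, so their action
determines all derivatives of the new coefficients in these directions. Integrating over a convex
box gives the linear form. -/
theorem linearizableNear (h : Adapted J F G X₀ U₀ Ψ Q) (hF0 : ∀ j ∈ J, F j ≠ 0) {j₀ : Jet}
    (hj₀ : j₀ ∈ J) (hΨ : dx (dx Ψ) (j₀.1, X₀ (base j₀)) ≠ 0) : LinearizableNear F G j₀ := by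
  have hJ := h.isOpen
  have hX := h.orderZero_X
  have hU := h.orderZero_U
  have hDX := h.DX_ne_zero
  have hT := h.timeFactor_ne_zero
  have hact := fun j hj => h.action (j := j) hj
  have hΩ := isOpen_base_image hJ
  have hp₀ : base j₀ ∈ base '' J := mem_image_of_mem _ hj₀
  set X : Jet → ℝ := fun j => X₀ (base j) with hXdef
  set U : Jet → ℝ := fun j => U₀ (base j) with hUdef
  -- the point transformation
  let E : Pt → Pt := fun p => (p.1, X₀ p, U₀ p)
  have hE : ContDiffOn ℝ ∞ E (base '' J) := contDiffOn_fst.prodMk (h.smooth_X.prodMk h.smooth_U)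
  have hEi : ∀ v, fderiv ℝ E (base j₀) v = 0 → v = 0 := by
    intro v hv
    have d1 := differentiableAt_of_contDiffOn hΩ h.smooth_X hp₀
    have d2 := differentiableAt_of_contDiffOn hΩ h.smooth_U hp₀
    have hd : HasFDerivAt E _ (base j₀) :=
      hasFDerivAt_fst.prodMk (d1.hasFDerivAt.prodMk d2.hasFDerivAt)
    rw [hd.fderiv] at hv
    have hv' : (v.1, fderiv ℝ X₀ (base j₀) v, fderiv ℝ U₀ (base j₀) v) = 0 := hv
    simp only [Prod.mk_eq_zero] at hv'
    obtain ⟨v0, v1, v2⟩ := hv'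
    have := eq_zero_of_fderiv_eq_zero hX hU hDX hT hj₀ (v := (v.1, v.2.1, v.2.2, 0, 0)) v0
      (by rw [hXdef, fderiv_comp_base d1]; exact v1) (by rw [hUdef, fderiv_comp_base d2]; exact v2)
    exact Prod.ext v0 (Prod.ext this.1 this.2)
  obtain ⟨e, he, hes, hesub, hesymm⟩ := exists_localDiffeomorph hΩ hE hp₀ hEi
  obtain ⟨P, hP, hPs, hPsub, hPsymm⟩ := exists_localDiffeomorph hJ
    (contDiffOn_newJet hJ hX hU hDX) hj₀ (fderiv_newJet_injective hJ hX hU hDX hT hj₀)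
  set k₀ := newJet X U j₀ with hk₀
  -- a box in the new coordinates
  have hΨ₀ : ContDiffAt ℝ ∞ Ψ (k₀.1, k₀.2.1) := h.smooth_Ψ _ hp₀
  -- Balls in the product metric are boxes, so one radius serves for jets, points and (t, x)-pairs,
  -- and these balls project into one another.
  obtain ⟨r, hr, hrP, hre, hrΨ⟩ : ∃ r > 0, Metric.ball k₀ r ⊆ P.target ∧
      Metric.ball (base k₀) r ⊆ e.target ∧
      ∀ y ∈ Metric.ball (k₀.1, k₀.2.1) r, dx (dx Ψ) y ≠ 0 := by
    have h1 : P.target ∈ 𝓝 k₀ := P.open_target.mem_nhds (by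
      have := P.map_source hPs; rwa [hP] at this)
    have h2 : e.target ∈ 𝓝 (base k₀) := e.open_target.mem_nhds (by
      have := e.map_source hes; rwa [he] at this)
    have h3 : ∀ᶠ y in 𝓝 (k₀.1, k₀.2.1), dx (dx Ψ) y ≠ 0 :=
      (contDiffAt_dx (contDiffAt_dx hΨ₀)).continuousAt.eventually_ne hΨ
    obtain ⟨r1, hr1, s1⟩ := Metric.mem_nhds_iff.1 h1
    obtain ⟨r2, hr2, s2⟩ := Metric.mem_nhds_iff.1 h2
    obtain ⟨r3, hr3, s3⟩ := Metric.mem_nhds_iff.1 h3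
    refine ⟨min r1 (min r2 r3), by positivity, ?_, ?_, ?_⟩
    · exact (Metric.ball_subset_ball (min_le_left _ _)).trans s1
    · exact (Metric.ball_subset_ball ((min_le_right _ _).trans (min_le_left _ _))).trans s2
    · intro y hy
      exact s3 (Metric.ball_subset_ball ((min_le_right _ _).trans (min_le_right _ _)) hy)
  set B := Metric.ball k₀ r with hB
  set B₂ := Metric.ball ((k₀.1, k₀.2.1) : ℝ × ℝ) r with hB₂
  have hBo : IsOpen B := Metric.isOpen_ball
  have hBc : Convex ℝ B := convex_ball _ _
  have hBB₂ : ∀ k ∈ B, (k.1, k.2.1) ∈ B₂ := by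
    intro k hk
    simp only [hB, hB₂, Metric.mem_ball, Prod.dist_eq, max_lt_iff] at hk ⊢
    exact ⟨hk.1, hk.2.1⟩
  have hB₂B : ∀ y ∈ B₂, ((y.1, y.2, k₀.2.2) : Jet) ∈ B := by
    intro y hy
    simp only [hB, hB₂, Metric.mem_ball, Prod.dist_eq, max_lt_iff] at hy ⊢
    simp [hy.1, hy.2, hr]
  have hsec : ContDiff ℝ ∞ (fun y : ℝ × ℝ => ((y.1, y.2, k₀.2.2) : Jet)) := by fun_prop
  have hPB : ∀ k ∈ B, P.symm k ∈ J ∧ newJet X U (P.symm k) = k := by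
    intro k hk
    refine ⟨hPsub (P.map_target (hrP hk)), ?_⟩
    have := P.right_inv (hrP hk)
    rwa [hP] at this
  -- the coefficients as functions of the new coordinates
  have hat : ∀ {f : Jet → ℝ}, ContDiffOn ℝ ∞ f J → ContDiffOn ℝ ∞ (fun k => f (P.symm k)) B :=
    fun hf => hf.comp (hPsymm.mono hrP) fun k hk => (hPB k hk).1
  have hat' : ∀ {f : Jet → ℝ}, ContDiffOn ℝ ∞ f J → ∀ k ∈ B, ∀ v,
      fderiv ℝ (fun k => f (P.symm k)) k (fderiv ℝ (newJet X U) (P.symm k) v)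
        = fderiv ℝ f (P.symm k) v := by
    intro f hf k hk v
    obtain ⟨hm, hk'⟩ := hPB k hk
    have hd1 : HasFDerivAt (fun k => f (P.symm k)) (fderiv ℝ (fun k => f (P.symm k)) k)
        (newJet X U (P.symm k)) := by
      rw [hk']
      exact (differentiableAt_of_contDiffOn hBo (hat hf) hk).hasFDerivAt
    have hd2 := (differentiableAt_of_contDiffOn hJ (contDiffOn_newJet hJ hX hU hDX) hm).hasFDerivAt
    have hd := hd1.comp (P.symm k) hd2
    have he : (fun k => f (P.symm k)) ∘ newJet X U =ᶠ[𝓝 (P.symm k)] f := by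
      filter_upwards [P.open_source.mem_nhds (P.map_target (hrP hk))] with j hj
      have := P.left_inv hj
      rw [hP] at this
      simp [this]
    have hd' := he.fderiv_eq (𝕜 := ℝ)
    rw [hd.fderiv] at hd'
    rw [← hd']
    rfl
  have sF : ContDiffOn ℝ ∞ (newF X F) J := h.smooth_F.mul ((hX.D hJ).smooth.pow 3)
  have sG : ContDiffOn ℝ ∞ (newG X U F G) J := by
    have o₁ := orderOne_newU₁ hJ hX hU hDX
    have o₂ := contDiffOn_newU₂ hJ hX hU hDX
    exact (((contDiffOn_fderiv_const hJ _ hU.smooth).sub (o₁.smooth.mul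
      (contDiffOn_fderiv_const hJ _ hX.smooth))).add (((contDiffOn_fderiv_const hJ _ hU.smooth).sub
        (o₁.smooth.mul (contDiffOn_fderiv_const hJ _ hX.smooth))).mul h.smooth_G)).sub
        (h.smooth_F.mul (((hX.D hJ).smooth.pow 2).mul (contDiffOn_D hJ o₂)))
  set Fh : Jet → ℝ := fun k => newF X F (P.symm k) with hFh
  set Gh : Jet → ℝ := fun k => newG X U F G (P.symm k) with hGh
  have ctΨ : ∀ y ∈ B₂, ContDiffAt ℝ ∞ Ψ y := by
    intro y hy
    obtain ⟨hm, hk⟩ := hPB _ (hB₂B y hy)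
    have := h.smooth_Ψ _ (mem_image_of_mem base hm)
    have e1 : (base (P.symm (y.1, y.2, k₀.2.2))).1 = y.1 := congrArg (fun k : Jet => k.1) hk
    have e2 : X₀ (base (P.symm (y.1, y.2, k₀.2.2))) = y.2 := congrArg (fun k : Jet => k.2.1) hk
    rwa [e1, e2] at this
  have dF : ∀ k ∈ B, ∀ a b c : ℝ, fderiv ℝ Fh k (0, 0, a, b, c) = 0 := by
    intro k hk a b c
    obtain ⟨hm, hk'⟩ := hPB k hk
    obtain ⟨⟨a0, b0, -⟩, ⟨a1, b1, -⟩, ⟨a2, b2, -⟩⟩ := hact _ hm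
    have e1 : (P.symm k).1 = k.1 :=
      show (newJet X U (P.symm k)).1 = k.1 by rw [hk']
    have e2 : X₀ (base (P.symm k)) = k.2.1 :=
      show (newJet X U (P.symm k)).2.1 = k.2.1 by rw [hk']
    rw [← hat' sF k hk, a0] at b0
    rw [← hat' sF k hk, a1, e2] at b1
    rw [← hat' sF k hk, a2, e1, e2] at b2
    have hne := hrΨ _ (hBB₂ k hk)
    generalize Ψ (k.1, k.2.1) = q0 at *
    generalize dx Ψ (k.1, k.2.1) = q1 at *
    generalize dx (dx Ψ) (k.1, k.2.1) = q2 at *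
    -- The prolonged symmetries form a triangular frame whose only nontrivial diagonal entry is
    -- Ψ_xx; the coefficients come from solving for c, then b, then a.
    have hv : ((0, 0, a, b, c) : Jet) = (c / q2) • (0, 0, q0, q1, q2)
        + (b - c / q2 * q1) • (0, 0, k.2.1, 1, 0)
        + (a - c / q2 * q0 - (b - c / q2 * q1) * k.2.1) • (0, 0, 1, 0, 0) := by
      simp only [Prod.smul_mk, Prod.mk_add_mk, smul_eq_mul, Prod.mk.injEq]
      refine ⟨by ring, by ring, by ring, by ring, by field_simp; ring⟩
    rw [hv, map_add, map_add, map_smul, map_smul, map_smul, b0, b1, b2]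
    simp
  have Feq : ∀ k ∈ B, Fh k = Fh (k.1, k.2.1, k₀.2.2) := by
    intro k hk
    refine eq_of_fderiv_apply_eq_zero hBo hBc (hat sF) (fun y hy => ?_) hk (hB₂B _ (hBB₂ k hk))
    convert! dF y hy (k₀.2.2.1 - k.2.2.1) (k₀.2.2.2.1 - k.2.2.2.1) (k₀.2.2.2.2 - k.2.2.2.2) using 2
    simp [Prod.ext_iff]
  let f : ℝ × ℝ → ℝ := fun y => Fh (y.1, y.2, k₀.2.2)
  have sf : ContDiffOn ℝ ∞ f B₂ := (hat sF).comp hsec.contDiffOn hB₂B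
  -- Forced by the third symmetry, which reads Ψ_xx ∂G'/∂u₂ = Ψ_t - f Ψ_xxx.
  let h₂ : ℝ × ℝ → ℝ := fun y => (dt Ψ y - f y * dx (dx (dx Ψ)) y) / dx (dx Ψ) y
  have sh₂ : ContDiffOn ℝ ∞ h₂ B₂ := by
    intro y hy
    have c1 := (contDiffAt_dt (ctΨ y hy)).contDiffWithinAt (s := B₂)
    have c2 := (contDiffAt_dx (contDiffAt_dx (ctΨ y hy))).contDiffWithinAt (s := B₂)
    have c3 := (contDiffAt_dx (contDiffAt_dx (contDiffAt_dx (ctΨ y hy)))).contDiffWithinAt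
      (s := B₂)
    exact (c1.sub ((sf y hy).mul c3)).div c2 (hrΨ y hy)
  have dG : ∀ k ∈ B, ∀ a b c : ℝ, fderiv ℝ Gh k (0, 0, a, b, c) = h₂ (k.1, k.2.1) * c := by
    intro k hk a b c
    obtain ⟨hm, hk'⟩ := hPB k hk
    obtain ⟨⟨a0, -, b0⟩, ⟨a1, -, b1⟩, ⟨a2, -, b2⟩⟩ := hact _ hm
    have e1 : (P.symm k).1 = k.1 :=
      show (newJet X U (P.symm k)).1 = k.1 by rw [hk']
    have e2 : X₀ (base (P.symm k)) = k.2.1 :=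
      show (newJet X U (P.symm k)).2.1 = k.2.1 by rw [hk']
    have e3 : newF X F (P.symm k) = f (k.1, k.2.1) := Feq k hk
    rw [← hat' sG k hk, a0] at b0
    rw [← hat' sG k hk, a1, e2] at b1
    rw [← hat' sG k hk, a2, e1, e2, e3] at b2
    have hne := hrΨ _ (hBB₂ k hk)
    simp only [h₂]
    generalize Ψ (k.1, k.2.1) = q0 at *
    generalize dx Ψ (k.1, k.2.1) = q1 at *
    generalize dx (dx (dx Ψ)) (k.1, k.2.1) = q3 at *
    generalize dx (dx Ψ) (k.1, k.2.1) = q2 at *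
    have hv : ((0, 0, a, b, c) : Jet) = (c / q2) • (0, 0, q0, q1, q2)
        + (b - c / q2 * q1) • (0, 0, k.2.1, 1, 0)
        + (a - c / q2 * q0 - (b - c / q2 * q1) * k.2.1) • (0, 0, 1, 0, 0) := by
      simp only [Prod.smul_mk, Prod.mk_add_mk, smul_eq_mul, Prod.mk.injEq]
      refine ⟨by ring, by ring, by ring, by ring, by field_simp; ring⟩
    rw [hv, map_add, map_add, map_smul, map_smul, map_smul, b0, b1, b2, smul_eq_mul]
    simp only [smul_zero, add_zero]
    ring
  -- The remainder G' - h₂ u₂, evaluated with (u, u₁, u₂) frozen at the centre of the box.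
  let g : ℝ × ℝ → ℝ := fun y => Gh (y.1, y.2, k₀.2.2) - h₂ y * k₀.2.2.2.2
  have sg : ContDiffOn ℝ ∞ g B₂ :=
    ((hat sG).comp hsec.contDiffOn hB₂B).sub (sh₂.mul contDiffOn_const)
  have Geq : ∀ k ∈ B, Gh k = h₂ (k.1, k.2.1) * k.2.2.2.2 + g (k.1, k.2.1) := by
    intro k hk
    have sH : ContDiffOn ℝ ∞ (fun k : Jet => h₂ (k.1, k.2.1)) B :=
      sh₂.comp (contDiffOn_fst.prodMk contDiffOn_snd.fst) hBB₂
    have key := eq_of_fderiv_apply_eq_zero hBo hBc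
      (f := fun k => Gh k - h₂ (k.1, k.2.1) * k.2.2.2.2)
      ((hat sG).sub (sH.mul contDiff_u₂.contDiffOn)) (x := k) (y := (k.1, k.2.1, k₀.2.2)) ?_ hk
      (hB₂B _ (hBB₂ k hk))
    · simp only at key
      simp only [g]
      linarith
    · intro y hy
      have d1 := differentiableAt_of_contDiffOn hBo (hat sG) hy
      have d2 := differentiableAt_of_contDiffOn hBo sH hy
      have d3 : DifferentiableAt ℝ (fun j : Jet => j.2.2.2.2) y :=
        contDiff_u₂.differentiable (by simp) y
      have hv : ((k.1, k.2.1, k₀.2.2) : Jet) - k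
          = (0, 0, k₀.2.2.1 - k.2.2.1, k₀.2.2.2.1 - k.2.2.2.1, k₀.2.2.2.2 - k.2.2.2.2) := by
        simp [Prod.ext_iff]
      have d4 := fderiv_comp_pair (X := fun k : Jet => k.2.1) (Φ := h₂) (j := y) (by fun_prop)
        ((sh₂.contDiffAt (Metric.isOpen_ball.mem_nhds (hBB₂ y hy))).differentiableAt (by simp))
      have d5 : ∀ v : Jet, fderiv ℝ (fun k : Jet => k.2.1) y v = v.2.1 := by
        intro v
        let L : Jet →L[ℝ] ℝ := (ContinuousLinearMap.fst ℝ ℝ _).comp (ContinuousLinearMap.snd ℝ ℝ _)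
        have : HasFDerivAt (fun k : Jet => k.2.1) L y := L.hasFDerivAt
        rw [this.fderiv]; rfl
      rw [hv, fderiv_fun_sub d1 (d2.fun_mul d3), fderiv_fun_mul d2 d3]
      simp only [sub_apply, add_apply, smul_apply, smul_eq_mul, fderiv_u₂, d4, d5]
      have := dG y hy (k₀.2.2.1 - k.2.2.1) (k₀.2.2.2.1 - k.2.2.2.1) (k₀.2.2.2.2 - k.2.2.2.2)
      rw [hGh] at this
      rw [this]
      ring
  -- the restricted point transformation
  have hs₀ : IsOpen (e.source ∩ e ⁻¹' Metric.ball (base k₀) r) :=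
    e.isOpen_inter_preimage Metric.isOpen_ball
  let e' := e.restr (e.source ∩ e ⁻¹' Metric.ball (base k₀) r)
  have he's : e'.source = e.source ∩ e ⁻¹' Metric.ball (base k₀) r := by
    rw [e.restr_source, hs₀.interior_eq, ← inter_assoc, inter_self]
  have he' : (e' : Pt → Pt) = E := he
  have hnew : newVars e' '' e'.source ⊆ B₂ := by
    rintro _ ⟨p, hp, rfl⟩
    rw [he's] at hp
    have hp2 : e p ∈ Metric.ball (base k₀) r := hp.2
    simp only [Metric.mem_ball, Prod.dist_eq, max_lt_iff, base] at hp2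
    simp only [hB₂, Metric.mem_ball, Prod.dist_eq, max_lt_iff]
    exact ⟨hp2.1, hp2.2.1⟩
  have hWo : IsOpen ((P.source ∩ P ⁻¹' B) ∩ base ⁻¹' e'.source) :=
    (P.isOpen_inter_preimage hBo).inter (e'.open_source.preimage contDiff_base.continuous)
  have hWJ : ∀ j ∈ (P.source ∩ P ⁻¹' B) ∩ base ⁻¹' e'.source, j ∈ J ∧ newJet X U j ∈ B ∧
      P.symm (newJet X U j) = j := by
    intro j hj
    refine ⟨hPsub hj.1.1, ?_, ?_⟩
    · have := hj.1.2
      rwa [hP] at this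
    · have := P.left_inv hj.1.1
      rwa [hP] at this
  -- Invariance under ∂_u and x ∂_u leaves no terms in u and u₁, so h₁ = h₀ = 0; time is unchanged,
  -- so T is the identity.
  refine ⟨(P.source ∩ P ⁻¹' B) ∩ base ⁻¹' e'.source, e', f, h₂, fun _ => 0, fun _ => 0, g, hWo, ?_,
    ⟨?_, ?_, id, fun p _ => ?_⟩, sf.mono hnew, sh₂.mono hnew, contDiffOn_const, contDiffOn_const,
    sg.mono hnew, ?_, ?_, ?_, ?_⟩
  · refine ⟨⟨hPs, ?_⟩, ?_⟩
    · rw [hP]; exact Metric.mem_ball_self hr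
    · rw [he's]
      refine ⟨hes, ?_⟩
      rw [he]
      exact Metric.mem_ball_self hr
  · rw [he']
    exact hE.mono fun p hp => hesub (he's ▸ hp).1
  · refine hesymm.mono fun p hp => ?_
    exact hp.1
  · rw [he']; rfl
  · intro y hy
    have hy' := hB₂B y (hnew hy)
    exact mul_ne_zero (hF0 _ (hPB _ hy').1) (pow_ne_zero 3 (hDX _ (hPB _ hy').1))
  · exact fun j hj => hj.2
  · intro j hj
    rw [he']
    have := hDX j (hWJ j hj).1
    rw [D, hXdef, fderiv_comp_base (differentiableAt_of_contDiffOn hΩ h.smooth_X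
      (mem_image_of_mem _ (hWJ j hj).1))] at this
    exact this
  · intro w v z hw hz hv hwv
    obtain ⟨hz1, hz2, hz3⟩ := hWJ _ hz
    have hn : ∀ y, newVars e' (graphPt w y) = (y.1, X (jet w y)) := by
      intro y; rw [newVars, he']; rfl
    have hwv' : ∀ᶠ y in 𝓝 z, v (y.1, X (jet w y)) = U (jet w y) := by
      filter_upwards [hwv] with y hy
      rw [hn, he'] at hy
      exact hy
    rw [hn] at hv ⊢
    rw [holdsAt_transformed hJ hX hU hDX hT F G hw hz1 hv hwv', HoldsAt,
      (jet_transformed hJ hX hU hDX hw hz1 hv hwv').1]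
    have e1 : newF X F (jet w z) = f (z.1, X (jet w z)) := by
      have := Feq _ hz2
      simp only [hFh] at this
      rw [hz3] at this
      rw [this]
      rfl
    have e2 : newG X U F G (jet w z) = h₂ (z.1, X (jet w z)) * newU₂ X U (jet w z)
        + g (z.1, X (jet w z)) := by
      have := Geq _ hz2
      simp only [hGh] at this
      rw [hz3] at this
      rw [this]
      rfl
    rw [e1, e2]
    simp

end Adapted

/-! ### Polynomial identities in u₁ and functions of t alone. -/

section Fibres

variable {J : Set Jet}

/-- A polynomial of degree one in `u₁` which vanishes on an open set has vanishing coefficients. -/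
theorem eq_zero_of_add_u₁_mul (hJ : IsOpen J) {A B : Pt → ℝ}
    (h : ∀ j ∈ J, A (base j) + j.2.2.2.1 * B (base j) = 0) {p : Pt} (hp : p ∈ base '' J) :
    A p = 0 ∧ B p = 0 := by
  obtain ⟨j, hj, rfl⟩ := hp
  obtain ⟨r, hr, hb⟩ := Metric.isOpen_iff.1 hJ j hj
  have h1 := h j hj
  have h2 := h (j.1, j.2.1, j.2.2.1, j.2.2.2.1 + r / 2, j.2.2.2.2) (hb (by
    simp [Prod.dist_eq, hr, abs_of_pos hr]))
  change A (base j) + (j.2.2.2.1 + r / 2) * B (base j) = 0 at h2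
  have h3 : r / 2 * B (base j) = 0 := by linarith
  have h4 := (mul_eq_zero.1 h3).resolve_left (by positivity)
  rw [h4] at h1
  exact ⟨by linarith, h4⟩

theorem D_comp_base (hJ : IsOpen J) {φ : Pt → ℝ} (hφ : ContDiffOn ℝ ∞ φ (base '' J)) {j : Jet}
    (hj : j ∈ J) : D (fun j => φ (base j)) j = fderiv ℝ φ (base j) (0, 1, 0)
      + j.2.2.2.1 * fderiv ℝ φ (base j) (0, 0, 1) := by
  rw [D, fderiv_comp_base (differentiableAt_of_contDiffOn (isOpen_base_image hJ) hφ
    (mem_image_of_mem _ hj))]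
  have : base (tot 0 j) = (0, 1, 0) + j.2.2.2.1 • (0, 0, 1) := by simp [base, tot]
  rw [this, map_add, map_smul, smul_eq_mul]

/-- D φ = φ_x + u₁ φ_u vanishes for an open set of values of u₁, so both coefficients vanish. -/
theorem fderiv_vertical_eq_zero (hJ : IsOpen J) {φ : Pt → ℝ} (hφ : ContDiffOn ℝ ∞ φ (base '' J))
    (h : ∀ j ∈ J, D (fun j => φ (base j)) j = 0) {p : Pt} (hp : p ∈ base '' J) (a b : ℝ) :
    fderiv ℝ φ p (0, a, b) = 0 := by
  have h1 := eq_zero_of_add_u₁_mul hJ (A := fun p => fderiv ℝ φ p (0, 1, 0))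
    (B := fun p => fderiv ℝ φ p (0, 0, 1)) (fun j hj => by rw [← D_comp_base hJ hφ hj, h j hj]) hp
  have : ((0, a, b) : Pt) = a • (0, 1, 0) + b • (0, 0, 1) := by simp
  rw [this, map_add, map_smul, map_smul, h1.1, h1.2]
  simp

end Fibres

/-! ### Combinations of symmetries with coefficients depending on t. -/

section Combination

variable {J : Set Jet} {F G : Jet → ℝ}

/-- The derivatives of A and B are kept in a separate group because it drops out along total
x-derivatives when A and B depend on t only. -/
theorem fderiv_combination (hJ : IsOpen J) {A B f₁ f₂ f₃ : Jet → ℝ} (hA : ContDiffOn ℝ ∞ A J)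
    (hB : ContDiffOn ℝ ∞ B J) (h₁ : ContDiffOn ℝ ∞ f₁ J) (h₂ : ContDiffOn ℝ ∞ f₂ J)
    (h : ∀ j ∈ J, f₃ j = A j * f₁ j + B j * f₂ j) {j : Jet} (hj : j ∈ J) (v : Jet) :
    fderiv ℝ f₃ j v = A j * fderiv ℝ f₁ j v + B j * fderiv ℝ f₂ j v
      + (fderiv ℝ A j v * f₁ j + fderiv ℝ B j v * f₂ j) := by
  have dA := differentiableAt_of_contDiffOn hJ hA hj
  have dB := differentiableAt_of_contDiffOn hJ hB hj
  have d1 := differentiableAt_of_contDiffOn hJ h₁ hj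
  have d2 := differentiableAt_of_contDiffOn hJ h₂ hj
  rw [fderiv_congr_on hJ h hj, fderiv_fun_add (dA.fun_mul d1) (dB.fun_mul d2),
    fderiv_fun_mul dA d1, fderiv_fun_mul dB d2]
  simp
  ring

/-- If three symmetries are related by `Q₃ = a(t) Q₁ + b(t) Q₂`, then `a' Q₁ + b' Q₂ = 0`. -/
theorem symmetry_combination (hJ : IsOpen J) {Q₁ Q₂ Q₃ : Pt → Pt}
    (hQ₁ : ContDiffOn ℝ ∞ Q₁ (base '' J)) (hQ₂ : ContDiffOn ℝ ∞ Q₂ (base '' J))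
    (hQ₃ : ContDiffOn ℝ ∞ Q₃ (base '' J)) (t₁ : ∀ p ∈ base '' J, (Q₁ p).1 = 0)
    (t₂ : ∀ p ∈ base '' J, (Q₂ p).1 = 0) (t₃ : ∀ p ∈ base '' J, (Q₃ p).1 = 0)
    (s₁ : IsPointSymmetry J F G Q₁) (s₂ : IsPointSymmetry J F G Q₂)
    (s₃ : IsPointSymmetry J F G Q₃) {a b : Pt → ℝ} (ha : ContDiffOn ℝ ∞ a (base '' J))
    (hb : ContDiffOn ℝ ∞ b (base '' J)) (h : ∀ p ∈ base '' J, Q₃ p = a p • Q₁ p + b p • Q₂ p)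
    (va : ∀ p ∈ base '' J, ∀ y z : ℝ, fderiv ℝ a p (0, y, z) = 0)
    (vb : ∀ p ∈ base '' J, ∀ y z : ℝ, fderiv ℝ b p (0, y, z) = 0) {p : Pt} (hp : p ∈ base '' J) :
    fderiv ℝ a p (1, 0, 0) • Q₁ p + fderiv ℝ b p (1, 0, 0) • Q₂ p = 0 := by
  have hΩ := isOpen_base_image hJ
  set A : Jet → ℝ := fun j => a (base j)
  set B : Jet → ℝ := fun j => b (base j)
  have hA : ContDiffOn ℝ ∞ A J := (orderZero_comp_base hJ ha).smooth
  have hB : ContDiffOn ℝ ∞ B J := (orderZero_comp_base hJ hb).smooth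
  have dA : ∀ j ∈ J, ∀ s, fderiv ℝ A j (tot s j) = 0 := fun j hj s => by
    rw [fderiv_comp_base (differentiableAt_of_contDiffOn hΩ ha (mem_image_of_mem _ hj))]
    exact va _ (mem_image_of_mem _ hj) _ _
  have dB : ∀ j ∈ J, ∀ s, fderiv ℝ B j (tot s j) = 0 := fun j hj s => by
    rw [fderiv_comp_base (differentiableAt_of_contDiffOn hΩ hb (mem_image_of_mem _ hj))]
    exact vb _ (mem_image_of_mem _ hj) _ _
  have tA : ∀ j ∈ J, ∀ q, fderiv ℝ A j (1, 0, q, 0, 0) = fderiv ℝ a (base j) (1, 0, 0) :=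
    fun j hj q => by
      rw [fderiv_comp_base (differentiableAt_of_contDiffOn hΩ ha (mem_image_of_mem _ hj))]
      have : base (1, 0, q, 0, 0) = (1, 0, 0) + (0, 0, q) := by simp [base]
      rw [this, map_add, va _ (mem_image_of_mem _ hj), add_zero]
  have tB : ∀ j ∈ J, ∀ q, fderiv ℝ B j (1, 0, q, 0, 0) = fderiv ℝ b (base j) (1, 0, 0) :=
    fun j hj q => by
      rw [fderiv_comp_base (differentiableAt_of_contDiffOn hΩ hb (mem_image_of_mem _ hj))]
      have : base (1, 0, q, 0, 0) = (1, 0, 0) + (0, 0, q) := by simp [base]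
      rw [this, map_add, vb _ (mem_image_of_mem _ hj), add_zero]
  have exi : ∀ j ∈ J, xiJ Q₃ j = A j * xiJ Q₁ j + B j * xiJ Q₂ j := fun j hj => by
    simp [xiJ, h _ (mem_image_of_mem base hj), A, B]
  have eeta : ∀ j ∈ J, etaJ Q₃ j = A j * etaJ Q₁ j + B j * etaJ Q₂ j := fun j hj => by
    simp [etaJ, h _ (mem_image_of_mem base hj), A, B]
  have x1 := (orderZero_xiJ hJ hQ₁).smooth
  have x2 := (orderZero_xiJ hJ hQ₂).smooth
  have n1 := (orderZero_etaJ hJ hQ₁).smooth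
  have n2 := (orderZero_etaJ hJ hQ₂).smooth
  have Dxi : ∀ j ∈ J, D (xiJ Q₃) j = A j * D (xiJ Q₁) j + B j * D (xiJ Q₂) j := fun j hj => by
    simp only [D]
    rw [fderiv_combination hJ hA hB x1 x2 exi hj, dA j hj, dB j hj]; ring
  have e1 : ∀ j ∈ J, eta₁ Q₃ j = A j * eta₁ Q₁ j + B j * eta₁ Q₂ j := fun j hj => by
    simp only [eta₁]
    rw [Dxi j hj]
    simp only [D]
    rw [fderiv_combination hJ hA hB n1 n2 eeta hj, dA j hj, dB j hj]; ring
  have e2 : ∀ j ∈ J, eta₂ Q₃ j = A j * eta₂ Q₁ j + B j * eta₂ Q₂ j := fun j hj => by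
    simp only [eta₂]
    rw [Dxi j hj]
    simp only [D]
    rw [fderiv_combination hJ hA hB (orderOne_eta₁ hJ hQ₁).smooth (orderOne_eta₁ hJ hQ₂).smooth
      e1 hj, dA j hj, dB j hj]; ring
  have e3 : ∀ j ∈ J, ∀ s, eta₃ Q₃ s j = A j * eta₃ Q₁ s j + B j * eta₃ Q₂ s j := fun j hj s => by
    simp only [eta₃]
    rw [Dxi j hj, fderiv_combination hJ hA hB (contDiffOn_eta₂ hJ hQ₁) (contDiffOn_eta₂ hJ hQ₂)
      e2 hj, dA j hj, dB j hj]; ring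
  have eprol : ∀ j ∈ J, prol Q₃ j = A j • prol Q₁ j + B j • prol Q₂ j := fun j hj => by
    simp [prol, exi j hj, eeta j hj, e1 j hj, e2 j hj]
  -- Coefficients depending on t pass through all x-derivatives of the prolongation, so in the
  -- symmetry condition for Q₃ everything cancels except the terms in which ∂_t hits a or b. At u₃ =
  -- 0 these form a polynomial of degree one in u₁.
  have key : ∀ j ∈ J, (fderiv ℝ a (base j) (1, 0, 0) * (Q₁ (base j)).2.2
        + fderiv ℝ b (base j) (1, 0, 0) * (Q₂ (base j)).2.2)
      + j.2.2.2.1 * (-(fderiv ℝ a (base j) (1, 0, 0) * (Q₁ (base j)).2.1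
        + fderiv ℝ b (base j) (1, 0, 0) * (Q₂ (base j)).2.1)) = 0 := by
    intro j hj
    have i1 := s₁.jet_identity hJ hQ₁ t₁ hj 0
    have i2 := s₂.jet_identity hJ hQ₂ t₂ hj 0
    have i3 := s₃.jet_identity hJ hQ₃ t₃ hj 0
    rw [fderiv_combination hJ hA hB n1 n2 eeta hj, fderiv_combination hJ hA hB x1 x2 exi hj,
      tA j hj, tB j hj, eprol j hj, e3 j hj] at i3
    simp only [map_add, map_smul, smul_eq_mul] at i3
    change _ at i3
    simp only [etaJ, xiJ] at i1 i2 i3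
    linear_combination i3 - A j * i1 - B j * i2
  have k := eq_zero_of_add_u₁_mul hJ
    (A := fun p => fderiv ℝ a p (1, 0, 0) * (Q₁ p).2.2 + fderiv ℝ b p (1, 0, 0) * (Q₂ p).2.2)
    (B := fun p => -(fderiv ℝ a p (1, 0, 0) * (Q₁ p).2.1 + fderiv ℝ b p (1, 0, 0) * (Q₂ p).2.1))
    key hp
  refine Prod.ext ?_ (Prod.ext ?_ ?_)
  · simp [t₁ p hp, t₂ p hp]
  · simpa [add_comm, neg_eq_zero] using neg_eq_zero.1 k.2
  · simpa using k.1

end Combination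

/-- Three commuting symmetries without `∂_t` component, linearly independent as germs. -/
structure Triple (J : Set Jet) (F G : Jet → ℝ) (Q : Fin 3 → Pt → Pt) : Prop where
  isOpen : IsOpen J
  smooth_F : ContDiffOn ℝ ∞ F J
  smooth_G : ContDiffOn ℝ ∞ G J
  smooth_Q : ∀ i, ContDiffOn ℝ ∞ (Q i) (base '' J)
  tau : ∀ i, ∀ p ∈ base '' J, (Q i p).1 = 0
  symmetry : ∀ i, IsPointSymmetry J F G (Q i)
  commute : ∀ i k, ∀ p ∈ base '' J, VectorField.lieBracket ℝ (Q i) (Q k) p = 0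
  independent : ∀ V : Set Pt, IsOpen V → V.Nonempty → V ⊆ base '' J → ∀ c : Fin 3 → ℝ,
    (∀ p ∈ V, ∑ i, c i • Q i p = 0) → c = 0

theorem IsPointSymmetry.mono {J J' : Set Jet} {F G : Jet → ℝ} {Q : Pt → Pt}
    (h : IsPointSymmetry J F G Q) (hJ : J' ⊆ J) : IsPointSymmetry J' F G Q :=
  fun w hw z hz => h w hw z (hJ hz)

/-- Commuting vector fields: the coefficients of a combination are constant along the fields. -/
theorem lieBracket_combination {Ω : Set Pt} (hΩ : IsOpen Ω) {Q Q₁ Q₂ Q₃ : Pt → Pt} {a b : Pt → ℝ}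
    (hQ₁ : ContDiffOn ℝ ∞ Q₁ Ω) (hQ₂ : ContDiffOn ℝ ∞ Q₂ Ω)
    (ha : ContDiffOn ℝ ∞ a Ω) (hb : ContDiffOn ℝ ∞ b Ω)
    (h : ∀ p ∈ Ω, Q₃ p = a p • Q₁ p + b p • Q₂ p)
    {p : Pt} (hp : p ∈ Ω) (c₁ : VectorField.lieBracket ℝ Q Q₁ p = 0)
    (c₂ : VectorField.lieBracket ℝ Q Q₂ p = 0) (c₃ : VectorField.lieBracket ℝ Q Q₃ p = 0) :
    fderiv ℝ a p (Q p) • Q₁ p + fderiv ℝ b p (Q p) • Q₂ p = 0 := by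
  have d1 := differentiableAt_of_contDiffOn hΩ hQ₁ hp
  have d2 := differentiableAt_of_contDiffOn hΩ hQ₂ hp
  have da := differentiableAt_of_contDiffOn hΩ ha hp
  have db := differentiableAt_of_contDiffOn hΩ hb hp
  have e : Q₃ =ᶠ[𝓝 p] (fun p => a p • Q₁ p) + fun p => b p • Q₂ p := by
    filter_upwards [hΩ.mem_nhds hp] with y hy using h y hy
  rw [Filter.EventuallyEq.lieBracket_vectorField_eq (EventuallyEq.refl _ _) e,
    VectorField.lieBracket_add_right (da.fun_smul d1) (db.fun_smul d2),
    VectorField.lieBracket_smul_right da d1, VectorField.lieBracket_smul_right db d2, c₁, c₂] at c₃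
  simpa using c₃

theorem eq_of_fderiv_eq_zero_base {J : Set Jet} (hJ : IsOpen J) (hc : IsPreconnected J)
    {φ : Pt → ℝ} (hφ : ContDiffOn ℝ ∞ φ (base '' J))
    (h0 : ∀ p ∈ base '' J, ∀ y z : ℝ, fderiv ℝ φ p (0, y, z) = 0)
    (h1 : ∀ p ∈ base '' J, fderiv ℝ φ p (1, 0, 0) = 0) {p q : Pt} (hp : p ∈ base '' J)
    (hq : q ∈ base '' J) : φ p = φ q := by
  refine eq_of_fderiv_eq_zero (isOpen_base_image hJ)
    (hc.image base contDiff_base.continuous.continuousOn) hφ (fun y hy => ?_) hp hq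
  refine ContinuousLinearMap.ext fun v => ?_
  have : v = v.1 • (1, 0, 0) + (0, v.2.1, v.2.2) := by ext <;> simp
  rw [this, map_add, map_smul, h1 y hy, h0 y hy]
  simp

/-- Every nonempty open set of jets contains a nonempty connected open set. -/
theorem exists_connected {J S : Set Jet} (hJ : IsOpen J) {f : Jet → ℝ} (hf : ContDiffOn ℝ ∞ f J)
    (hS : S = {j ∈ J | f j ≠ 0}) {j : Jet} (hj : j ∈ S) : ∃ J' ⊆ S, IsOpen J' ∧
      IsPreconnected J' ∧ j ∈ J' := by
  have : IsOpen S := by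
    rw [hS]
    exact hf.continuousOn.isOpen_inter_preimage hJ isOpen_ne
  obtain ⟨r, hr, hb⟩ := Metric.isOpen_iff.1 this j hj
  exact ⟨_, hb, Metric.isOpen_ball, (convex_ball _ _).isPreconnected, Metric.mem_ball_self hr⟩

/-! ### Three commuting symmetries with ξ⁰ = 0 are pointwise parallel. -/

namespace Triple

variable {J : Set Jet} {F G : Jet → ℝ} {Q : Fin 3 → Pt → Pt}

theorem mono (h : Triple J F G Q) {J' : Set Jet} (hJ' : IsOpen J') (hs : J' ⊆ J) :
    Triple J' F G Q where
  isOpen := hJ'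
  smooth_F := h.smooth_F.mono hs
  smooth_G := h.smooth_G.mono hs
  smooth_Q i := (h.smooth_Q i).mono (image_mono hs)
  tau i p hp := h.tau i p (image_mono hs hp)
  symmetry i := (h.symmetry i).mono hs
  commute i k p hp := h.commute i k p (image_mono hs hp)
  independent V h1 h2 h3 := h.independent V h1 h2 (h3.trans (image_mono hs))

theorem perm (h : Triple J F G Q) (σ : Equiv.Perm (Fin 3)) : Triple J F G (fun i => Q (σ i)) where
  isOpen := h.isOpen
  smooth_F := h.smooth_F
  smooth_G := h.smooth_G
  smooth_Q i := h.smooth_Q _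
  tau i := h.tau _
  symmetry i := h.symmetry _
  commute i k := h.commute _ _
  independent V h1 h2 h3 c hc := by
    have := h.independent V h1 h2 h3 (fun i => c (σ.symm i)) (fun p hp => by
      rw [← hc p hp, ← Equiv.sum_comp σ]; simp)
    ext i
    simpa using congrFun this (σ i)

/-- The symmetries are pointwise linearly dependent. -/
theorem minor_zero_one (h : Triple J F G Q) {p : Pt} (hp : p ∈ base '' J) :
    (Q 0 p).2.1 * (Q 1 p).2.2 - (Q 1 p).2.1 * (Q 0 p).2.2 = 0 := by
  by_contra hne
  obtain ⟨j, hj, rfl⟩ := hp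
  have sx := fun i => (orderZero_xiJ h.isOpen (h.smooth_Q i)).smooth
  have sy := fun i => (orderZero_etaJ h.isOpen (h.smooth_Q i)).smooth
  obtain ⟨J', hJ'S, hJ'o, hJ'c, hjJ'⟩ := exists_connected h.isOpen
    (((sx 0).mul (sy 1)).sub ((sx 1).mul (sy 0))) rfl (j := j) ⟨hj, hne⟩
  replace h := h.mono hJ'o (fun j hj => (hJ'S hj).1)
  have hm : ∀ p ∈ base '' J', (Q 0 p).2.1 * (Q 1 p).2.2 - (Q 1 p).2.1 * (Q 0 p).2.2 ≠ 0 := by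
    rintro _ ⟨j, hj, rfl⟩
    exact (hJ'S hj).2
  have hΩ := isOpen_base_image hJ'o
  have px := fun i => (h.smooth_Q i).snd.fst
  have py := fun i => (h.smooth_Q i).snd.snd
  -- Cramer's rule for Q 2 in terms of Q 0 and Q 1, on a connected set where these span the (x,
  -- u)-plane.
  let a : Pt → ℝ := fun p => ((Q 2 p).2.1 * (Q 1 p).2.2 - (Q 1 p).2.1 * (Q 2 p).2.2)
    / ((Q 0 p).2.1 * (Q 1 p).2.2 - (Q 1 p).2.1 * (Q 0 p).2.2)
  let b : Pt → ℝ := fun p => ((Q 0 p).2.1 * (Q 2 p).2.2 - (Q 2 p).2.1 * (Q 0 p).2.2)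
    / ((Q 0 p).2.1 * (Q 1 p).2.2 - (Q 1 p).2.1 * (Q 0 p).2.2)
  have ha : ContDiffOn ℝ ∞ a (base '' J') := (((px 2).mul (py 1)).sub ((px 1).mul (py 2))).div
    (((px 0).mul (py 1)).sub ((px 1).mul (py 0))) hm
  have hb : ContDiffOn ℝ ∞ b (base '' J') := (((px 0).mul (py 2)).sub ((px 2).mul (py 0))).div
    (((px 0).mul (py 1)).sub ((px 1).mul (py 0))) hm
  have hcomb : ∀ p ∈ base '' J', Q 2 p = a p • Q 0 p + b p • Q 1 p := by
    intro p hp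
    have := hm p hp
    refine Prod.ext ?_ (Prod.ext ?_ ?_)
    · simp [h.tau _ p hp]
    · simp only [a, b, Prod.snd_add, Prod.fst_add, Prod.smul_snd, Prod.smul_fst, smul_eq_mul]
      rw [div_mul_eq_mul_div, div_mul_eq_mul_div, ← add_div, eq_div_iff this]
      ring
    · simp only [a, b, Prod.snd_add, Prod.smul_snd, smul_eq_mul]
      rw [div_mul_eq_mul_div, div_mul_eq_mul_div, ← add_div, eq_div_iff this]
      ring
  have hind : ∀ p ∈ base '' J', ∀ y z : ℝ, y • Q 0 p + z • Q 1 p = 0 → y = 0 ∧ z = 0 := by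
    intro p hp y z hyz
    have := hm p hp
    have e1 : y * (Q 0 p).2.1 + z * (Q 1 p).2.1 = 0 := congrArg (fun q : Pt => q.2.1) hyz
    have e2 : y * (Q 0 p).2.2 + z * (Q 1 p).2.2 = 0 := congrArg (fun q : Pt => q.2.2) hyz
    constructor
    · refine (mul_eq_zero.1 ?_).resolve_right this
      linear_combination (Q 1 p).2.2 * e1 - (Q 1 p).2.1 * e2
    · refine (mul_eq_zero.1 ?_).resolve_right this
      linear_combination (Q 0 p).2.1 * e2 - (Q 0 p).2.2 * e1
  -- Every Q i commutes with all three fields, so it annihilates a and b; as Q 0 and Q 1 span the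
  -- fibre, a and b depend on t only.
  have hbr : ∀ i, ∀ p ∈ base '' J', fderiv ℝ a p (Q i p) = 0 ∧ fderiv ℝ b p (Q i p) = 0 :=
    fun i p hp => hind p hp _ _ (lieBracket_combination hΩ (h.smooth_Q 0) (h.smooth_Q 1) ha hb hcomb
      hp (h.commute i 0 p hp) (h.commute i 1 p hp) (h.commute i 2 p hp))
  have hvert : ∀ p ∈ base '' J', ∀ y z : ℝ,
      fderiv ℝ a p (0, y, z) = 0 ∧ fderiv ℝ b p (0, y, z) = 0 := by
    intro p hp y z
    have := hm p hp
    have hv : ((0, y, z) : Pt) = ((y * (Q 1 p).2.2 - z * (Q 1 p).2.1)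
        / ((Q 0 p).2.1 * (Q 1 p).2.2 - (Q 1 p).2.1 * (Q 0 p).2.2)) • Q 0 p
        + ((z * (Q 0 p).2.1 - y * (Q 0 p).2.2)
        / ((Q 0 p).2.1 * (Q 1 p).2.2 - (Q 1 p).2.1 * (Q 0 p).2.2)) • Q 1 p := by
      refine Prod.ext ?_ (Prod.ext ?_ ?_)
      · simp [h.tau _ p hp]
      · simp only [Prod.snd_add, Prod.fst_add, Prod.smul_snd, Prod.smul_fst, smul_eq_mul]
        rw [div_mul_eq_mul_div, div_mul_eq_mul_div, ← add_div, eq_div_iff this]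
        ring
      · simp only [Prod.snd_add, Prod.smul_snd, smul_eq_mul]
        rw [div_mul_eq_mul_div, div_mul_eq_mul_div, ← add_div, eq_div_iff this]
        ring
    rw [hv]
    simp [(hbr 0 p hp).1, (hbr 0 p hp).2, (hbr 1 p hp).1, (hbr 1 p hp).2]
  have ht : ∀ p ∈ base '' J', fderiv ℝ a p (1, 0, 0) = 0 ∧ fderiv ℝ b p (1, 0, 0) = 0 :=
    fun p hp => hind p hp _ _ (symmetry_combination hJ'o (h.smooth_Q 0) (h.smooth_Q 1)
      (h.smooth_Q 2) (h.tau 0) (h.tau 1) (h.tau 2) (h.symmetry 0) (h.symmetry 1) (h.symmetry 2)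
      ha hb hcomb (fun p hp y z => (hvert p hp y z).1) (fun p hp y z => (hvert p hp y z).2) hp)
  have hp₀ : base j ∈ base '' J' := mem_image_of_mem _ hjJ'
  -- Now a and b are constant, and Q 2 = a Q 0 + b Q 1 contradicts independence.
  have := h.independent _ hΩ ⟨_, hp₀⟩ Subset.rfl ![a (base j), b (base j), -1] (fun p hp => by
    rw [Fin.sum_univ_three]
    simp only [Matrix.cons_val]
    rw [eq_of_fderiv_eq_zero_base hJ'o hJ'c ha (fun p hp y z => (hvert p hp y z).1)
      (fun p hp => (ht p hp).1) hp₀ hp, eq_of_fderiv_eq_zero_base hJ'o hJ'c hb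
      (fun p hp y z => (hvert p hp y z).2) (fun p hp => (ht p hp).2) hp₀ hp, hcomb p hp]
    module)
  have := congrFun this 2
  simp at this

theorem minor (h : Triple J F G Q) (i : Fin 3) {p : Pt} (hp : p ∈ base '' J) :
    (Q 0 p).2.1 * (Q i p).2.2 - (Q i p).2.1 * (Q 0 p).2.2 = 0 := by
  fin_cases i
  · simp
  · exact h.minor_zero_one hp
  · have := (h.perm (Equiv.swap 1 2)).minor_zero_one hp
    simpa [show Equiv.swap (1 : Fin 3) 2 0 = 0 by decide] using this

end Triple

/-- Near a point where `g ≠ 0`, the function `1 / g` has a smooth antiderivative in the variable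
`u`. -/
theorem exists_antiderivative_inv {S : Set Pt} (hS : IsOpen S) {g : Pt → ℝ}
    (hg : ContDiffOn ℝ ∞ g S) (hg0 : ∀ k ∈ S, g k ≠ 0) {k₀ : Pt} (hk₀ : k₀ ∈ S) :
    ∃ V : Pt → ℝ, ∃ r > 0, ContDiff ℝ ∞ V ∧ Metric.ball k₀ r ⊆ S ∧
      ∀ k ∈ Metric.ball k₀ r, fderiv ℝ V k (0, 0, 1) = (g k)⁻¹ := by
  obtain ⟨R, hR, hRS⟩ := Metric.nhds_basis_closedBall.mem_iff.1 (hS.mem_nhds hk₀)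
  let b : ContDiffBump k₀ := ⟨R / 2, R, by positivity, by linarith⟩
  -- The bump function extends 1/g by zero to a compactly supported smooth function, without
  -- changing it on the smaller ball.
  let G : Pt → ℝ := fun k => b k * (g k)⁻¹
  have hts : tsupport b ⊆ S := by rw [b.tsupport_eq]; exact hRS
  have hG : ContDiff ℝ ∞ G := by
    rw [contDiff_iff_contDiffAt]
    intro k
    by_cases hk : k ∈ S
    · exact b.contDiffAt.mul ((hg.contDiffAt (hS.mem_nhds hk)).inv (hg0 k hk))
    · have h1 : (b : Pt → ℝ) =ᶠ[𝓝 k] 0 := notMem_tsupport_iff_eventuallyEq.1 fun h => hk (hts h)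
      refine (contDiffAt_const (c := (0 : ℝ))).congr_of_eventuallyEq ?_
      filter_upwards [h1] with y hy
      simp [G, hy]
  have hGc : HasCompactSupport G := b.hasCompactSupport.mul_right
  let φ : (ℝ × ℝ) × ℝ ≃ₜ Pt := Homeomorph.prodAssoc ℝ ℝ ℝ
  have hφ : ContDiff ℝ ∞ φ := by
    change ContDiff ℝ ∞ fun y : (ℝ × ℝ) × ℝ => ((y.1.1, y.1.2, y.2) : Pt)
    fun_prop
  obtain ⟨V, hV, hV'⟩ := exists_contDiff_antiderivative (hG.comp hφ) (hGc.comp_homeomorph φ)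
  have hψ : ContDiff ℝ ∞ fun k : Pt => (((k.1, k.2.1), k.2.2) : (ℝ × ℝ) × ℝ) := by fun_prop
  have hVs : ContDiff ℝ ∞ fun k : Pt => V ((k.1, k.2.1), k.2.2) := hV.comp hψ
  refine ⟨_, R / 2, by positivity, hVs, ?_, fun k hk => ?_⟩
  · exact (Metric.ball_subset_closedBall.trans
      (Metric.closedBall_subset_closedBall (by linarith))).trans hRS
  · have h1 := ((hVs.differentiable (by simp)) k).hasFDerivAt
    have h2 : HasDerivAt (fun s : ℝ => ((k.1, k.2.1, s) : Pt)) (0, 0, 1) k.2.2 :=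
      (hasDerivAt_const _ _).prodMk ((hasDerivAt_const _ _).prodMk (hasDerivAt_id _))
    have h3 := HasFDerivAt.comp_hasDerivAt (f := fun s : ℝ => ((k.1, k.2.1, s) : Pt)) k.2.2 h1 h2
    have h4 := hV' (k.1, k.2.1) k.2.2
    have h5 := h3.unique h4
    rw [h5]
    change b k * (g k)⁻¹ = _
    rw [b.one_of_mem_closedBall (Metric.ball_subset_closedBall hk), one_mul]

theorem fderiv_comp_pair_pt {X : Pt → ℝ} {Φ : ℝ × ℝ → ℝ} {p : Pt} (hX : DifferentiableAt ℝ X p)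
    (hΦ : DifferentiableAt ℝ Φ (p.1, X p)) (v : Pt) :
    fderiv ℝ (fun y : Pt => Φ (y.1, X y)) p v
      = v.1 * dt Φ (p.1, X p) + fderiv ℝ X p v * dx Φ (p.1, X p) := by
  have h1 : HasFDerivAt (fun y : Pt => (y.1, X y))
    ((ContinuousLinearMap.fst ℝ ℝ _).prod (fderiv ℝ X p)) p :=
    hasFDerivAt_fst.prodMk hX.hasFDerivAt
  have h2 := hΦ.hasFDerivAt.comp p h1
  change HasFDerivAt (fun y : Pt => Φ (y.1, X y)) _ p at h2
  rw [h2.fderiv]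
  have : ((v.1, fderiv ℝ X p v) : ℝ × ℝ) = v.1 • (1, 0) + fderiv ℝ X p v • (0, 1) := by simp
  change fderiv ℝ Φ (p.1, X p) (v.1, fderiv ℝ X p v) = _
  rw [this, map_add, map_smul, map_smul]
  rfl

theorem dx_dt_eq {Φ : ℝ × ℝ → ℝ} {z : ℝ × ℝ} (hΦ : ContDiffAt ℝ ∞ Φ z) :
    dx (dt Φ) z = dt (dx Φ) z := by
  have := fderiv_fderiv_sub (A := fun _ => ((0, 1) : ℝ × ℝ)) (B := fun _ => ((1, 0) : ℝ × ℝ)) hΦ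
    (differentiableAt_const _) (differentiableAt_const _)
  simp only [fderiv_fun_const, Pi.zero_apply, zero_apply, sub_self, map_zero] at this
  exact sub_eq_zero.1 this

/-! ### Straightening three parallel symmetries. -/

namespace Triple

variable {J : Set Jet} {F G : Jet → ℝ} {Q : Fin 3 → Pt → Pt}

/-- The symmetries restrict to multiples of the first one on a suitable open set. -/
theorem exists_multiples (h : Triple J F G Q) (hne : J.Nonempty) :
    ∃ J' ⊆ J, Triple J' F G Q ∧ J'.Nonempty ∧ (∀ p ∈ base '' J', Q 0 p ≠ 0) ∧
      ∀ i, ∃ φ : Pt → ℝ, ContDiffOn ℝ ∞ φ (base '' J') ∧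
        (∀ p ∈ base '' J', Q i p = φ p • Q 0 p) ∧
        (∀ p ∈ base '' J', fderiv ℝ φ p (Q 0 p) = 0) := by
  have sx := (orderZero_xiJ h.isOpen (h.smooth_Q 0)).smooth
  have sy := (orderZero_etaJ h.isOpen (h.smooth_Q 0)).smooth
  obtain ⟨j, hj, hj0⟩ : ∃ j ∈ J, xiJ (Q 0) j * xiJ (Q 0) j + etaJ (Q 0) j * etaJ (Q 0) j ≠ 0 := by
    by_contra! hall
    have := h.independent _ (isOpen_base_image h.isOpen) (hne.image _) Subset.rfl ![1, 0, 0] (by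
      rintro _ ⟨j, hj, rfl⟩
      rw [Fin.sum_univ_three]
      have h0 := hall j hj
      obtain ⟨h1, h2⟩ := mul_self_add_mul_self_eq_zero.1 h0
      have h3 : Q 0 (base j) = 0 :=
        Prod.ext (h.tau 0 _ (mem_image_of_mem _ hj)) (Prod.ext h1 h2)
      simp [h3])
    simpa using congrFun this 0
  obtain ⟨J', hJ'S, hJ'o, -, hjJ'⟩ := exists_connected h.isOpen
    ((sx.mul sx).add (sy.mul sy)) rfl (j := j) ⟨hj, hj0⟩
  have hsub : J' ⊆ J := fun j hj => (hJ'S hj).1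
  have h' := h.mono hJ'o hsub
  have hm : ∀ p ∈ base '' J', (Q 0 p).2.1 * (Q 0 p).2.1 + (Q 0 p).2.2 * (Q 0 p).2.2 ≠ 0 := by
    rintro _ ⟨j, hj, rfl⟩
    exact (hJ'S hj).2
  have hΩ := isOpen_base_image hJ'o
  have px := fun i => (h'.smooth_Q i).snd.fst
  have py := fun i => (h'.smooth_Q i).snd.snd
  have hQ0 : ∀ p ∈ base '' J', Q 0 p ≠ 0 := fun p hp h0 => by
    have := hm p hp
    rw [h0] at this
    simp at this
  refine ⟨J', hsub, h', ⟨j, hjJ'⟩, hQ0, fun i => ?_⟩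
  -- The factor of the Euclidean projection onto Q 0: a smooth formula, and the exact factor because
  -- the fields are parallel.
  let φ : Pt → ℝ := fun p => ((Q 0 p).2.1 * (Q i p).2.1 + (Q 0 p).2.2 * (Q i p).2.2)
    / ((Q 0 p).2.1 * (Q 0 p).2.1 + (Q 0 p).2.2 * (Q 0 p).2.2)
  have hφ : ContDiffOn ℝ ∞ φ (base '' J') := (((px 0).mul (px i)).add ((py 0).mul (py i))).div
    (((px 0).mul (px 0)).add ((py 0).mul (py 0))) hm
  have hmul : ∀ p ∈ base '' J', Q i p = φ p • Q 0 p := by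
    intro p hp
    have := hm p hp
    have hmin := h'.minor i hp
    refine Prod.ext ?_ (Prod.ext ?_ ?_)
    · simp [h'.tau _ p hp]
    · simp only [φ, Prod.smul_snd, Prod.smul_fst, smul_eq_mul]
      rw [div_mul_eq_mul_div, eq_div_iff this]
      linear_combination -(Q 0 p).2.2 * hmin
    · simp only [φ, Prod.smul_snd, smul_eq_mul]
      rw [div_mul_eq_mul_div, eq_div_iff this]
      linear_combination (Q 0 p).2.1 * hmin
  refine ⟨φ, hφ, hmul, fun p hp => ?_⟩
  -- The bracket of Q 0 with φ Q 0 is (Q 0 φ) Q 0, which vanishes.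
  have := lieBracket_combination hΩ (Q := Q 0) (h'.smooth_Q 0) (h'.smooth_Q 0) hφ
    (contDiffOn_const (c := (0 : ℝ))) (fun p hp => by rw [hmul p hp, zero_smul, add_zero]) hp
    (h'.commute 0 0 p hp) (h'.commute 0 0 p hp) (h'.commute 0 i p hp)
  simp only [fderiv_fun_const, Pi.zero_apply, zero_apply, zero_smul, add_zero] at this
  exact (smul_eq_zero.1 this).resolve_right (hQ0 p hp)

/-- The factor φ = Q 1 / Q 0 serves as x', and a function U with Q 0 U = 1 as u'; the factor ψ = Q 2
/ Q 0 then becomes Ψ(t, x'). Independence excludes that φ depends on t alone and that Ψ is affine in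
x' throughout. -/
theorem exists_linearizableNear (h : Triple J F G Q) (hF0 : ∀ j ∈ J, F j ≠ 0)
    (hne : J.Nonempty) : ∃ j ∈ J, LinearizableNear F G j := by
  obtain ⟨J₁, hJ₁, h₁, hne₁, hQ0, hφ⟩ := h.exists_multiples hne
  obtain ⟨φ, hφs, hφQ, hφ0⟩ := hφ 1
  obtain ⟨ψ, hψs, hψQ, hψ0⟩ := hφ 2
  -- a point where `φ` can be used as the new variable `x'`
  obtain ⟨j₁, hj₁, hD₁⟩ : ∃ j ∈ J₁, D (fun j => φ (base j)) j ≠ 0 := by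
    by_contra! hall
    obtain ⟨j, hj⟩ := hne₁
    -- The function 1 serves because only a connected neighbourhood is wanted; on it φ depends on t
    -- alone and will turn out constant, so that Q 1 is a constant multiple of Q 0.
    obtain ⟨J', hJ'S, hJ'o, hJ'c, hjJ'⟩ := exists_connected h₁.isOpen
      (contDiffOn_const (c := (1 : ℝ))) rfl (j := j) ⟨hj, one_ne_zero⟩
    have hsub : J' ⊆ J₁ := fun j hj => (hJ'S hj).1
    have hsub' := image_mono (f := base) hsub
    have h' := h₁.mono hJ'o hsub
    have hv : ∀ p ∈ base '' J', ∀ y z : ℝ, fderiv ℝ φ p (0, y, z) = 0 := fun p hp y z =>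
      fderiv_vertical_eq_zero h₁.isOpen hφs hall (hsub' hp) y z
    have ht : ∀ p ∈ base '' J', fderiv ℝ φ p (1, 0, 0) = 0 := by
      intro p hp
      have := symmetry_combination hJ'o (h'.smooth_Q 0) (h'.smooth_Q 0) (h'.smooth_Q 1)
        (h'.tau 0) (h'.tau 0) (h'.tau 1) (h'.symmetry 0) (h'.symmetry 0) (h'.symmetry 1)
        (hφs.mono hsub') (contDiffOn_const (c := (0 : ℝ)))
        (fun p hp => by rw [hφQ p (hsub' hp), zero_smul, add_zero]) hv (by simp) hp
      simp only [fderiv_fun_const, Pi.zero_apply, zero_apply, zero_smul, add_zero] at this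
      exact (smul_eq_zero.1 this).resolve_right (hQ0 p (hsub' hp))
    have hp₀ : base j ∈ base '' J' := mem_image_of_mem _ hjJ'
    have := h'.independent _ (isOpen_base_image hJ'o) ⟨_, hp₀⟩ Subset.rfl ![φ (base j), -1, 0]
      (fun p hp => by
        rw [Fin.sum_univ_three]
        simp only [Matrix.cons_val]
        rw [eq_of_fderiv_eq_zero_base hJ'o hJ'c (hφs.mono hsub') hv ht hp₀ hp, hφQ p (hsub' hp)]
        module)
    simpa using congrFun this 1
  have hΩ₁ := isOpen_base_image h₁.isOpen
  set p₁ := base j₁ with hp₁def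
  have hp₁ : p₁ ∈ base '' J₁ := mem_image_of_mem _ hj₁
  -- coordinates `(t, φ, c)` with `c` linear
  set α := (Q 0 p₁).2.1 with hα
  set β := (Q 0 p₁).2.2 with hβ
  have hαβ : α * α + β * β ≠ 0 := by
    intro h0
    obtain ⟨h1, h2⟩ := mul_self_add_mul_self_eq_zero.1 h0
    exact hQ0 p₁ hp₁ (Prod.ext (h₁.tau 0 _ hp₁) (Prod.ext h1 h2))
  -- At p₁ the derivative of c along Q 0 is α² + β² ≠ 0 while that of φ is zero, so φ and c are
  -- independent in the fibre.
  let c : Pt → ℝ := fun p => α * p.2.1 + β * p.2.2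
  have hc : ContDiff ℝ ∞ c := by fun_prop
  have hc' : ∀ p v, fderiv ℝ c p v = α * v.2.1 + β * v.2.2 := by
    intro p v
    let L : Pt →L[ℝ] ℝ := α • (ContinuousLinearMap.fst ℝ ℝ ℝ).comp (ContinuousLinearMap.snd ℝ ℝ _)
      + β • (ContinuousLinearMap.snd ℝ ℝ ℝ).comp (ContinuousLinearMap.snd ℝ ℝ _)
    have : HasFDerivAt c L p := L.hasFDerivAt
    rw [this.fderiv]; rfl
  let E : Pt → Pt := fun p => (p.1, φ p, c p)
  have hE : ContDiffOn ℝ ∞ E (base '' J₁) := contDiffOn_fst.prodMk (hφs.prodMk hc.contDiffOn)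
  have hE' : ∀ p ∈ base '' J₁, ∀ v, fderiv ℝ E p v = (v.1, fderiv ℝ φ p v, fderiv ℝ c p v) := by
    intro p hp v
    have hd : HasFDerivAt E _ p := hasFDerivAt_fst.prodMk
      ((differentiableAt_of_contDiffOn hΩ₁ hφs hp).hasFDerivAt.prodMk
        (hc.differentiable (by simp) p).hasFDerivAt)
    rw [hd.fderiv]; rfl
  have hEi : ∀ v, fderiv ℝ E p₁ v = 0 → v = 0 := by
    intro v hv
    rw [hE' p₁ hp₁, hc'] at hv
    simp only [Prod.mk_eq_zero] at hv
    obtain ⟨v0, v1, v2⟩ := hv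
    have hlin : ∀ a b d : ℝ, fderiv ℝ φ p₁ (a, b, d) = a * fderiv ℝ φ p₁ (1, 0, 0)
        + b * fderiv ℝ φ p₁ (0, 1, 0) + d * fderiv ℝ φ p₁ (0, 0, 1) := by
      intro a b d
      have : ((a, b, d) : Pt) = a • (1, 0, 0) + b • (0, 1, 0) + d • (0, 0, 1) := by simp
      rw [this]; simp only [map_add, map_smul, smul_eq_mul]
    have q0 := hφ0 p₁ hp₁
    have hQe : Q 0 p₁ = (0, α, β) := Prod.ext (h₁.tau 0 _ hp₁) rfl
    have hve : v = (0, v.2.1, v.2.2) := Prod.ext v0 rfl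
    rw [hQe, hlin] at q0
    rw [hve, hlin] at v1
    rw [D_comp_base h₁.isOpen hφs hj₁] at hD₁
    generalize fderiv ℝ φ p₁ (0, 1, 0) = fx at *
    generalize fderiv ℝ φ p₁ (0, 0, 1) = fu at *
    have hf : fx * fx + fu * fu ≠ 0 := by
      intro h0
      obtain ⟨h1, h2⟩ := mul_self_add_mul_self_eq_zero.1 h0
      rw [h1, h2] at hD₁
      simp at hD₁
    -- The gradient of φ and the vector v are both orthogonal to (α, β), hence parallel; v is also
    -- orthogonal to this nonzero gradient, so v = 0.
    have hcross : fx * v.2.2 - fu * v.2.1 = 0 := by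
      refine (mul_eq_zero.1 ?_).resolve_right hαβ
      linear_combination (α * v.2.2 - β * v.2.1) * q0 + (-α * fu + β * fx) * v2
    have e1 : v.2.1 = 0 := by
      refine (mul_eq_zero.1 ?_).resolve_right hf
      linear_combination fx * v1 - fu * hcross
    have e2 : v.2.2 = 0 := by
      refine (mul_eq_zero.1 ?_).resolve_right hf
      linear_combination fu * v1 + fx * hcross
    rw [hve, e1, e2]; rfl
  obtain ⟨e, he, hes, hesub, hesymm⟩ := exists_localDiffeomorph hΩ₁ hE hp₁ hEi
  -- In the coordinates (t, φ, c) the field Q 0 is κ ∂_c; an antiderivative of 1/κ with respect to c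
  -- therefore yields U with Q 0 U = 1.
  let κ : Pt → ℝ := fun p => α * (Q 0 p).2.1 + β * (Q 0 p).2.2
  have hκ : ContDiffOn ℝ ∞ κ (base '' J₁) :=
    (contDiffOn_const.mul (h₁.smooth_Q 0).snd.fst).add
      (contDiffOn_const.mul (h₁.smooth_Q 0).snd.snd)
  have hmaps : ∀ k ∈ e.target, e.symm k ∈ base '' J₁ := fun k hk => hesub (e.map_target hk)
  have hκe : ContDiffOn ℝ ∞ (fun k => κ (e.symm k)) e.target := hκ.comp hesymm hmaps
  set k₁ := E p₁ with hk₁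
  have hk₁t : k₁ ∈ e.target := by have := e.map_source hes; rwa [he] at this
  have hinv₁ : e.symm k₁ = p₁ := by have := e.left_inv hes; rwa [he] at this
  have hSo : IsOpen (e.target ∩ (fun k => κ (e.symm k)) ⁻¹' {y | y ≠ 0}) :=
    hκe.continuousOn.isOpen_inter_preimage e.open_target isOpen_ne
  obtain ⟨V, r, hr, hV, hrS, hV'⟩ := exists_antiderivative_inv hSo
    (hκe.mono inter_subset_left) (fun k hk => hk.2) (k₀ := k₁)
    ⟨hk₁t, by rw [mem_preimage, hinv₁]; exact hαβ⟩
  set B := Metric.ball k₁ r with hB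
  have hBt : ∀ k ∈ B, k ∈ e.target := fun k hk => (hrS hk).1
  -- the smaller set of jets on which the new coordinates live
  set N := e.source ∩ e ⁻¹' B with hN
  have hNo : IsOpen N := e.isOpen_inter_preimage Metric.isOpen_ball
  set J₂ := (J₁ ∩ base ⁻¹' N) ∩ (J₁ ∩ D (fun j => φ (base j)) ⁻¹' {y | y ≠ 0}) with hJ₂
  have hJ₂o : IsOpen J₂ := (h₁.isOpen.inter (hNo.preimage contDiff_base.continuous)).inter
    ((contDiffOn_D h₁.isOpen (orderZero_comp_base h₁.isOpen
      hφs).smooth).continuousOn.isOpen_inter_preimage h₁.isOpen isOpen_ne)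
  have hJ₂sub : J₂ ⊆ J₁ := fun j hj => hj.1.1
  have hsub := image_mono (f := base) hJ₂sub
  have hj₁J₂ : j₁ ∈ J₂ := by
    refine ⟨⟨hj₁, hes, ?_⟩, hj₁, hD₁⟩
    rw [mem_preimage, he]
    exact Metric.mem_ball_self hr
  have h₂ := h₁.mono hJ₂o hJ₂sub
  have hΩ₂N : ∀ p ∈ base '' J₂, p ∈ e.source ∧ E p ∈ B ∧ e.symm (E p) = p := by
    rintro _ ⟨j, hj, rfl⟩
    have h1 : base j ∈ e.source := hj.1.2.1
    have h2 : e (base j) ∈ B := hj.1.2.2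
    have h3 := e.left_inv h1
    rw [he] at h2 h3
    exact ⟨h1, h2, h3⟩
  have hEQ : ∀ p ∈ base '' J₁, fderiv ℝ E p (Q 0 p) = κ p • (0, 0, 1) := by
    intro p hp
    rw [hE' p hp, hφ0 p hp, hc', h₁.tau 0 p hp]
    simp [κ]
  let U : Pt → ℝ := fun p => V (E p)
  have hU : ContDiffOn ℝ ∞ U (base '' J₁) := hV.comp_contDiffOn hE
  have hUQ : ∀ p ∈ base '' J₂, fderiv ℝ U p (Q 0 p) = 1 := by
    intro p hp
    obtain ⟨q1, q2, q3⟩ := hΩ₂N p hp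
    have hd1 := (hV.differentiable (by simp) (E p)).hasFDerivAt
    have hd2 := (differentiableAt_of_contDiffOn hΩ₁ hE (hsub hp)).hasFDerivAt
    have hd : HasFDerivAt U _ p := hd1.comp p hd2
    rw [hd.fderiv]
    change fderiv ℝ V (E p) (fderiv ℝ E p (Q 0 p)) = 1
    have hκ0 : κ (e.symm (E p)) ≠ 0 := (hrS q2).2
    rw [hEQ p (hsub hp), map_smul, hV' _ q2, smul_eq_mul]
    rw [q3] at hκ0 ⊢
    exact mul_inv_cancel₀ hκ0
  -- `ψ` as a function of `(t, φ)`
  have hψe : ContDiffOn ℝ ∞ (fun k => ψ (e.symm k)) B := hψs.comp (hesymm.mono hBt)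
    fun k hk => hmaps k (hBt k hk)
  have hψe' : ∀ k ∈ B, fderiv ℝ (fun k => ψ (e.symm k)) k (0, 0, 1) = 0 := by
    intro k hk
    have hp := hmaps k (hBt k hk)
    have hEk : E (e.symm k) = k := by have := e.right_inv (hBt k hk); rwa [he] at this
    have hd1 : HasFDerivAt (fun k => ψ (e.symm k)) (fderiv ℝ (fun k => ψ (e.symm k)) k)
        (E (e.symm k)) := by
      rw [hEk]
      exact (differentiableAt_of_contDiffOn Metric.isOpen_ball hψe hk).hasFDerivAt
    have hd2 := (differentiableAt_of_contDiffOn hΩ₁ hE hp).hasFDerivAt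
    have hd := hd1.comp (e.symm k) hd2
    have hev : (fun k => ψ (e.symm k)) ∘ E =ᶠ[𝓝 (e.symm k)] ψ := by
      filter_upwards [e.open_source.mem_nhds (e.map_target (hBt k hk))] with y hy
      have := e.left_inv hy
      rw [he] at this
      simp [this]
    have hd' := DFunLike.congr_fun (hev.fderiv_eq (𝕜 := ℝ)) (Q 0 (e.symm k))
    rw [hd.fderiv, hψ0 _ hp] at hd'
    change fderiv ℝ (fun k => ψ (e.symm k)) k (fderiv ℝ E (e.symm k) (Q 0 (e.symm k))) = 0 at hd'
    rw [hEQ _ hp, map_smul, smul_eq_mul] at hd'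
    exact (mul_eq_zero.1 hd').resolve_left (hrS hk).2
  -- As Q 0 ψ = 0, the function ψ is constant along c on the convex ball, so c may be frozen at its
  -- central value.
  let Ψ : ℝ × ℝ → ℝ := fun y => ψ (e.symm (y.1, y.2, k₁.2.2))
  have hmB : ∀ k ∈ B, ((k.1, k.2.1, k₁.2.2) : Pt) ∈ B := by
    intro k hk
    simp only [hB, Metric.mem_ball, Prod.dist_eq, max_lt_iff] at hk ⊢
    simp [hk.1, hk.2.1, hr]
  have hψΨ : ∀ p ∈ base '' J₂, ψ p = Ψ (p.1, φ p) := by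
    intro p hp
    obtain ⟨q1, q2, q3⟩ := hΩ₂N p hp
    have := eq_of_fderiv_apply_eq_zero Metric.isOpen_ball (convex_ball k₁ r) hψe
      (x := E p) (y := ((E p).1, (E p).2.1, k₁.2.2)) (fun y hy => by
        have hv : (((E p).1, (E p).2.1, k₁.2.2) : Pt) - E p
          = (k₁.2.2 - (E p).2.2) • (0, 0, 1) := by simp [Prod.ext_iff]
        rw [hv, map_smul, hψe' y hy, smul_zero]) q2 (hmB _ q2)
    rw [q3] at this
    exact this
  have hΨs : ∀ p ∈ base '' J₂, ContDiffAt ℝ ∞ Ψ (p.1, φ p) := by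
    intro p hp
    obtain ⟨q1, q2, q3⟩ := hΩ₂N p hp
    have h1 : ContDiffAt ℝ ∞ (fun k => ψ (e.symm k)) (p.1, φ p, k₁.2.2) :=
      hψe.contDiffAt (Metric.isOpen_ball.mem_nhds (hmB _ q2))
    have h2 : ContDiff ℝ ∞ fun y : ℝ × ℝ => ((y.1, y.2, k₁.2.2) : Pt) := by fun_prop
    exact ContDiffAt.comp (p.1, φ p) (f := fun y : ℝ × ℝ => ((y.1, y.2, k₁.2.2) : Pt)) h1
      h2.contDiffAt
  have had : Adapted J₂ F G φ U Ψ Q := by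
    refine ⟨hJ₂o, h₂.smooth_F, h₂.smooth_G, hφs.mono hsub, hU.mono hsub, hΨs, fun j hj => hj.2.2,
      h₂.smooth_Q, h₂.tau, h₂.symmetry, fun i p hp => ?_, hUQ, fun p hp => ?_, fun p hp => ?_⟩
    · obtain ⟨χ, -, hχ, -⟩ := hφ i
      rw [hχ p (hsub hp), map_smul, hφ0 p (hsub hp), smul_zero]
    · rw [hφQ p (hsub hp), map_smul, hUQ p hp, smul_eq_mul, mul_one]
    · rw [hψQ p (hsub hp), map_smul, hUQ p hp, smul_eq_mul, mul_one, hψΨ p hp]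
  -- Should Ψ_xx vanish throughout, then Ψ_t = 0 too; this makes Ψ_x and then ψ - Ψ_x φ constant on
  -- a connected set, a linear relation between the three fields.
  by_cases hxx : ∀ p ∈ base '' J₂, dx (dx Ψ) (p.1, φ p) = 0
  · exfalso
    have hdt := had.dt_eq_zero hxx
    obtain ⟨J', hJ'S, hJ'o, hJ'c, hjJ'⟩ := exists_connected hJ₂o
      (contDiffOn_const (c := (1 : ℝ))) rfl (j := j₁) ⟨hj₁J₂, one_ne_zero⟩
    have hJ'sub : J' ⊆ J₂ := fun j hj => (hJ'S hj).1
    have hs2 := image_mono (f := base) hJ'sub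
    have hs1 := hs2.trans hsub
    have h' := h₂.mono hJ'o hJ'sub
    have hΩ' := isOpen_base_image hJ'o
    have hcΩ : IsPreconnected (base '' J') :=
      hJ'c.image base contDiff_base.continuous.continuousOn
    have hφd : ∀ p ∈ base '' J', DifferentiableAt ℝ φ p := fun p hp =>
      differentiableAt_of_contDiffOn hΩ₁ hφs (hs1 hp)
    have hdxt : ∀ p ∈ base '' J', dx (dt Ψ) (p.1, φ p) = 0 := by
      rintro _ ⟨j, hj, rfl⟩
      have hp := mem_image_of_mem base hj
      have e0 : fderiv ℝ (fun p : Pt => dt Ψ (p.1, φ p)) (base j) = 0 := by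
        have : (fun p : Pt => dt Ψ (p.1, φ p)) =ᶠ[𝓝 (base j)] fun _ => 0 := by
          filter_upwards [(isOpen_base_image hJ₂o).mem_nhds (hs2 hp)] with y hy using hdt y hy
        rw [this.fderiv_eq]; simp
      have e1 := fderiv_comp_pair_pt (hφd _ hp)
        ((contDiffAt_dt (hΨs _ (hs2 hp))).differentiableAt (by simp)) (base (tot 0 j))
      rw [e0] at e1
      have e2 : fderiv ℝ φ (base j) (base (tot 0 j)) ≠ 0 := by
        rw [← fderiv_comp_base (hφd _ hp)]
        exact (hJ'sub hj).2.2
      have e3 : fderiv ℝ φ (base j) (base (tot 0 j)) * dx (dt Ψ) ((base j).1, φ (base j)) = 0 := by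
        simpa [base, tot] using e1.symm
      exact (mul_eq_zero.1 e3).resolve_left e2
    have hb : ContDiffOn ℝ ∞ (fun p : Pt => dx Ψ (p.1, φ p)) (base '' J') := fun p hp =>
      (ContDiffAt.comp p (f := fun p : Pt => (p.1, φ p)) (contDiffAt_dx (hΨs p (hs2 hp)))
        (contDiffAt_fst.prodMk (hφs.contDiffAt (hΩ₁.mem_nhds (hs1 hp))))).contDiffWithinAt
    have hb' : ∀ p ∈ base '' J', fderiv ℝ (fun p : Pt => dx Ψ (p.1, φ p)) p = 0 := by
      intro p hp
      refine ContinuousLinearMap.ext fun v => ?_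
      rw [fderiv_comp_pair_pt (hφd p hp)
        ((contDiffAt_dx (hΨs p (hs2 hp))).differentiableAt (by simp)), ← dx_dt_eq (hΨs p (hs2 hp)),
        hdxt p hp, hxx p (hs2 hp)]
      simp
    have hp₀ : p₁ ∈ base '' J' := mem_image_of_mem _ hjJ'
    set b₀ := dx Ψ (p₁.1, φ p₁) with hb₀
    have hbc : ∀ p ∈ base '' J', dx Ψ (p.1, φ p) = b₀ := fun p hp =>
      eq_of_fderiv_eq_zero hΩ' hcΩ hb hb' hp hp₀
    have ha : ContDiffOn ℝ ∞ (fun p => ψ p - b₀ * φ p) (base '' J') :=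
      (hψs.mono hs1).sub (contDiffOn_const.mul (hφs.mono hs1))
    have ha' : ∀ p ∈ base '' J', fderiv ℝ (fun p => ψ p - b₀ * φ p) p = 0 := by
      intro p hp
      refine ContinuousLinearMap.ext fun v => ?_
      have hev : ψ =ᶠ[𝓝 p] fun p => Ψ (p.1, φ p) := by
        filter_upwards [hΩ'.mem_nhds hp] with y hy using hψΨ y (hs2 hy)
      rw [fderiv_fun_sub (differentiableAt_of_contDiffOn hΩ₁ hψs (hs1 hp))
        ((hφd p hp).const_mul b₀), fderiv_const_mul (hφd p hp), hev.fderiv_eq]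
      simp only [sub_apply, smul_apply, smul_eq_mul]
      rw [fderiv_comp_pair_pt (hφd p hp) ((hΨs p (hs2 hp)).differentiableAt (by simp)),
        hdt p (hs2 hp), hbc p hp]
      simp only [mul_zero, zero_add, zero_apply]
      ring
    have := h'.independent _ hΩ' ⟨_, hp₀⟩ Subset.rfl ![ψ p₁ - b₀ * φ p₁, b₀, -1]
      (fun p hp => by
        rw [Fin.sum_univ_three]
        simp only [Matrix.cons_val]
        have hconst : ψ p₁ - b₀ * φ p₁ = ψ p - b₀ * φ p :=
          eq_of_fderiv_eq_zero hΩ' hcΩ ha ha' hp₀ hp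
        rw [hconst, hφQ p (hs1 hp), hψQ p (hs1 hp)]
        module)
    simpa using congrFun this 2
  · push Not at hxx
    obtain ⟨_, ⟨j, hj, rfl⟩, hjne⟩ := hxx
    exact ⟨j, hJ₁ (hJ₂sub hj), had.linearizableNear
      (fun j hj => hF0 j (hJ₁ (hJ₂sub hj))) hj hjne⟩

end Triple

/-! ### Linear combinations of symmetries and of commuting fields. -/

section LinearCombinations

theorem contDiffAt_characteristic {J : Set Jet} (hJ : IsOpen J) {Q : Pt → Pt}
    (hQ : ContDiffOn ℝ ∞ Q (base '' J)) {w : ℝ × ℝ → ℝ} {z : ℝ × ℝ} (hw : ContDiffAt ℝ ∞ w z)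
    (hz : jet w z ∈ J) : ContDiffAt ℝ ∞ (characteristic Q w) z :=
  ((contDiffAt_comp_jet hJ (orderZero_etaJ hJ hQ).smooth hw hz).sub ((contDiffAt_dt hw).mul
    (contDiffAt_comp_jet hJ (orderZero_tauJ hJ hQ).smooth hw hz))).sub ((contDiffAt_dx hw).mul
      (contDiffAt_comp_jet hJ (orderZero_xiJ hJ hQ).smooth hw hz))

theorem dx_sub_const_mul {f g h : ℝ × ℝ → ℝ} {z : ℝ × ℝ} {c : ℝ} (hf : ContDiffAt ℝ ∞ f z)
    (hg : ContDiffAt ℝ ∞ g z) (hh : h =ᶠ[𝓝 z] fun y => f y - c * g y) :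
    dx h =ᶠ[𝓝 z] fun y => dx f y - c * dx g y := by
  filter_upwards [dx_eventuallyEq hh, dx_sub_mul hf (contDiffAt_const (c := c)) hg] with y h1 h2
  rw [h1, h2, Adapted.dx_const]
  ring

/-- Point symmetries form a vector space. -/
theorem IsPointSymmetry.sub_smul {J : Set Jet} {F G : Jet → ℝ} (hJ : IsOpen J) {A C : Pt → Pt}
    (hA : ContDiffOn ℝ ∞ A (base '' J)) (hC : ContDiffOn ℝ ∞ C (base '' J))
    (sA : IsPointSymmetry J F G A) (sC : IsPointSymmetry J F G C) (c : ℝ) :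
    IsPointSymmetry J F G (fun p => A p - c • C p) := by
  intro w hw z hz hh
  have cA := contDiffAt_characteristic hJ hA hw.contDiffAt hz
  have cC := contDiffAt_characteristic hJ hC hw.contDiffAt hz
  have e0 : characteristic (fun p => A p - c • C p) w
      = fun y => characteristic A w y - c * characteristic C w y := by
    ext y
    simp only [characteristic, Prod.fst_sub, Prod.snd_sub, Prod.smul_fst, Prod.smul_snd,
      smul_eq_mul]
    ring
  have e1 := dx_sub_const_mul cA cC (EventuallyEq.of_eq e0)
  have e2 := dx_sub_const_mul (contDiffAt_dx cA) (contDiffAt_dx cC) e1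
  have e3 := dx_sub_const_mul (contDiffAt_dx (contDiffAt_dx cA)) (contDiffAt_dx (contDiffAt_dx cC))
    e2
  have et : dt (characteristic (fun p => A p - c • C p) w) z
      = dt (characteristic A w) z - c * dt (characteristic C w) z := by
    rw [e0, dt_sub_mul cA contDiffAt_const cC]
    simp [dt]
  have p0 : ∀ D : (ℝ × ℝ → ℝ) → (ℝ × ℝ → ℝ),
      D (characteristic (fun p => A p - c • C p) w) z
        = D (characteristic A w) z - c * D (characteristic C w) z →
      prolongationCoeff D (fun p => A p - c • C p) w z
        = prolongationCoeff D A w z - c * prolongationCoeff D C w z := by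
    intro D hD
    simp only [prolongationCoeff, hD, Prod.fst_sub, Prod.snd_sub, Prod.smul_fst, Prod.smul_snd,
      smul_eq_mul]
    ring
  have q1 := p0 dx e1.eq_of_nhds
  have q2 := p0 (fun f => dx (dx f)) e2.eq_of_nhds
  have q3 := p0 (fun f => dx (dx (dx f))) e3.eq_of_nhds
  have qt := p0 dt et
  have pv : prolongedVector (fun p => A p - c • C p) w z
      = prolongedVector A w z - c • prolongedVector C w z := by
    simp [prolongedVector, q1, q2]
  rw [qt, q3, pv]
  simp only [map_sub, map_smul, smul_eq_mul]
  linear_combination sA w hw z hz hh - c * sC w hw z hz hh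

theorem lieBracket_sub_smul {A B C : Pt → Pt} {a b : ℝ} {p : Pt} (hA : DifferentiableAt ℝ A p)
    (hB : DifferentiableAt ℝ B p) (hC : DifferentiableAt ℝ C p)
    (hAB : VectorField.lieBracket ℝ A B p = 0) (hAC : VectorField.lieBracket ℝ A C p = 0)
    (hCB : VectorField.lieBracket ℝ C B p = 0) :
    VectorField.lieBracket ℝ (fun p => A p - a • C p) (fun p => B p - b • C p) p = 0 := by
  simp only [VectorField.lieBracket] at *
  rw [fderiv_fun_sub hA (hC.fun_const_smul a), fderiv_fun_sub hB (hC.fun_const_smul b),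
    fderiv_fun_const_smul hC, fderiv_fun_const_smul hC]
  simp only [sub_apply, smul_apply, map_sub, map_smul]
  linear_combination (norm := module) hAB - b • hAC - a • hCB

end LinearCombinations

/-! ### The component ξ⁰ of commuting symmetries. -/

section TimeComponent

variable {J : Set Jet} {F G : Jet → ℝ}

theorem fderiv_fst_vertical (hJ : IsOpen J) {Q : Pt → Pt} (hQ : ContDiffOn ℝ ∞ Q (base '' J))
    (hF0 : ∀ j ∈ J, F j ≠ 0) (hs : IsPointSymmetry J F G Q) {p : Pt} (hp : p ∈ base '' J)
    (y z : ℝ) : fderiv ℝ (fun p => (Q p).1) p (0, y, z) = 0 :=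
  fderiv_vertical_eq_zero hJ (φ := fun p => (Q p).1) hQ.fst
    (fun _ hj => hs.D_tauJ hJ hQ hF0 hj) hp y z

/-- The `∂_t` components of two commuting point symmetries are proportional. -/
theorem exists_fst_eq_const_mul (hJ : IsOpen J) (hc : IsPreconnected J) {Q R : Pt → Pt}
    (hQ : ContDiffOn ℝ ∞ Q (base '' J)) (hR : ContDiffOn ℝ ∞ R (base '' J))
    (hF0 : ∀ j ∈ J, F j ≠ 0) (sQ : IsPointSymmetry J F G Q) (sR : IsPointSymmetry J F G R)
    (hQR : ∀ p ∈ base '' J, VectorField.lieBracket ℝ Q R p = 0)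
    (h0 : ∀ p ∈ base '' J, (Q p).1 ≠ 0) : ∃ c : ℝ, ∀ p ∈ base '' J, (R p).1 = c * (Q p).1 := by
  have hΩ := isOpen_base_image hJ
  rcases J.eq_empty_or_nonempty with rfl | ⟨j, hj⟩
  · exact ⟨0, by simp⟩
  let c : Pt → ℝ := fun p => (R p).1 / (Q p).1
  have hcs : ContDiffOn ℝ ∞ c (base '' J) := hR.fst.div hQ.fst h0
  have key : ∀ p ∈ base '' J, ∀ v, fderiv ℝ (fun p => (R p).1) p v
      = c p * fderiv ℝ (fun p => (Q p).1) p v + fderiv ℝ c p v * (Q p).1 := by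
    intro p hp v
    have e : (fun p => (R p).1) =ᶠ[𝓝 p] fun p => c p * (Q p).1 := by
      filter_upwards [hΩ.mem_nhds hp] with y hy
      exact (div_mul_cancel₀ _ (h0 y hy)).symm
    rw [e.fderiv_eq, fderiv_fun_mul (differentiableAt_of_contDiffOn hΩ hcs hp)
      (differentiableAt_of_contDiffOn hΩ hQ.fst hp)]
    simp
    ring
  have hv : ∀ p ∈ base '' J, ∀ y z : ℝ, fderiv ℝ c p (0, y, z) = 0 := by
    intro p hp y z
    have := key p hp (0, y, z)
    rw [fderiv_fst_vertical hJ hQ hF0 sQ hp, fderiv_fst_vertical hJ hR hF0 sR hp] at this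
    have h1 : fderiv ℝ c p (0, y, z) * (Q p).1 = 0 := by linarith
    exact (mul_eq_zero.1 h1).resolve_right (h0 p hp)
  have ht : ∀ p ∈ base '' J, fderiv ℝ c p (1, 0, 0) = 0 := by
    intro p hp
    -- For time components q(t) and r(t), the first component of the bracket is q r' - r q', so its
    -- vanishing says (r/q)' = 0.
    have dfst : ∀ {S : Pt → Pt}, ContDiffOn ℝ ∞ S (base '' J) → IsPointSymmetry J F G S → ∀ v,
        (fderiv ℝ S p v).1 = v.1 * fderiv ℝ (fun p => (S p).1) p (1, 0, 0) := by
      intro S hS sS v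
      have h1 : HasFDerivAt (fun p => (S p).1)
          ((ContinuousLinearMap.fst ℝ ℝ (ℝ × ℝ)).comp (fderiv ℝ S p)) p :=
        (differentiableAt_of_contDiffOn hΩ hS hp).hasFDerivAt.fst
      have h2 : (fderiv ℝ S p v).1 = fderiv ℝ (fun p => (S p).1) p v := by rw [h1.fderiv]; rfl
      have h3 : v = v.1 • (1, 0, 0) + (0, v.2.1, v.2.2) := by ext <;> simp
      rw [h2, h3, map_add, map_smul, fderiv_fst_vertical hJ hS hF0 sS hp]
      simp
    have hb := congrArg (fun v : Pt => v.1) (hQR p hp)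
    simp only [VectorField.lieBracket, Prod.fst_sub, dfst hQ sQ, dfst hR sR, Prod.fst_zero] at hb
    rw [key p hp] at hb
    have hcR : c p * (Q p).1 = (R p).1 := div_mul_cancel₀ _ (h0 p hp)
    have h1 : fderiv ℝ c p (1, 0, 0) * ((Q p).1 * (Q p).1) = 0 := by
      linear_combination hb - fderiv ℝ (fun p => (Q p).1) p (1, 0, 0) * hcR
    exact (mul_eq_zero.1 h1).resolve_right (mul_ne_zero (h0 p hp) (h0 p hp))
  refine ⟨c (base j), fun p hp => ?_⟩
  rw [eq_of_fderiv_eq_zero_base hJ hc hcs hv ht (mem_image_of_mem _ hj) hp]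
  exact (div_mul_cancel₀ _ (h0 p hp)).symm

end TimeComponent

/-! ### From the abelian algebra to three symmetries with ξ⁰ = 0. -/

section Algebra

variable {ι : Type*} {J : Set Jet} {F G : Jet → ℝ} {Q : ι → Pt → Pt}

/-- Independence of germs is what survives restriction; the density argument depends on this. -/
theorem IsAbelianSymmetryAlgebra.mono (h : IsAbelianSymmetryAlgebra J F G Q) {J' : Set Jet}
    (hs : J' ⊆ J) : IsAbelianSymmetryAlgebra J' F G Q where
  smooth i := (h.smooth i).mono (image_mono hs)
  symmetry i := (h.symmetry i).mono hs
  abelian i k p hp := h.abelian i k p (image_mono hs hp)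
  independent V h1 h2 h3 := h.independent V h1 h2 (h3.trans (image_mono hs))

theorem IsAbelianSymmetryAlgebra.eq_zero_of_sum (h : IsAbelianSymmetryAlgebra J F G Q) {n : ℕ}
    {σ : Fin n → ι} (hσ : Function.Injective σ) {V : Set Pt} (hV : IsOpen V) (hne : V.Nonempty)
    (hVJ : V ⊆ base '' J) {c : Fin n → ℝ} (hc : ∀ p ∈ V, ∑ i, c i • Q (σ i) p = 0) : c = 0 := by
  have h1 := (h.independent V hV hne hVJ).comp σ hσ
  rw [Fintype.linearIndependent_iff] at h1
  ext i
  refine h1 c ?_ i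
  ext1 p
  simpa using hc p p.2

theorem IsAbelianSymmetryAlgebra.triple (h : IsAbelianSymmetryAlgebra J F G Q) (hJ : IsOpen J)
    (hF : ContDiffOn ℝ ∞ F J) (hG : ContDiffOn ℝ ∞ G J) {σ : Fin 3 → ι}
    (hσ : Function.Injective σ) (hτ : ∀ i, ∀ p ∈ base '' J, (Q (σ i) p).1 = 0) :
    Triple J F G (fun i => Q (σ i)) where
  isOpen := hJ
  smooth_F := hF
  smooth_G := hG
  smooth_Q _ := h.smooth _
  tau := hτ
  symmetry _ := h.symmetry _
  commute _ _ := h.abelian _ _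
  independent _ h1 h2 h3 _ hc := h.eq_zero_of_sum hσ h1 h2 h3 hc

/-- A four-dimensional abelian algebra contains, locally, three symmetries without `∂_t`
component. -/
theorem IsAbelianSymmetryAlgebra.exists_triple (h : IsAbelianSymmetryAlgebra J F G Q)
    (hJ : IsOpen J) (hne : J.Nonempty) (hF : ContDiffOn ℝ ∞ F J) (hG : ContDiffOn ℝ ∞ G J)
    (hF0 : ∀ j ∈ J, F j ≠ 0) {σ : Fin 4 → ι} (hσ : Function.Injective σ) :
    ∃ J' ⊆ J, J'.Nonempty ∧ ∃ R : Fin 3 → Pt → Pt, Triple J' F G R := by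
  by_cases hτ : ∀ i, ∀ p ∈ base '' J, (Q (σ i) p).1 = 0
  · exact ⟨J, Subset.rfl, hne, _, h.triple hJ hF hG (σ := fun i => σ i.castSucc)
      (hσ.comp (Fin.castSucc_injective 3)) fun i => hτ _⟩
  push Not at hτ
  obtain ⟨i₀, _, ⟨j, hj, rfl⟩, hj0⟩ := hτ
  obtain ⟨J', hJ'S, hJ'o, hJ'c, hjJ'⟩ := exists_connected hJ
    (orderZero_tauJ hJ (h.smooth (σ i₀))).smooth rfl (j := j) ⟨hj, hj0⟩
  have hsub : J' ⊆ J := fun j hj => (hJ'S hj).1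
  replace h := h.mono hsub
  have h0 : ∀ p ∈ base '' J', (Q (σ i₀) p).1 ≠ 0 := by
    rintro _ ⟨j, hj, rfl⟩
    exact (hJ'S hj).2
  have hΩ := isOpen_base_image hJ'o
  choose c hc using fun k : Fin 3 => exists_fst_eq_const_mul hJ'o hJ'c (h.smooth (σ i₀))
    (h.smooth (σ (i₀.succAbove k))) (fun j hj => hF0 j (hsub hj)) (h.symmetry _) (h.symmetry _)
    (h.abelian _ _) h0
  -- Subtracting constant multiples of the field with ξ⁰ ≠ 0 removes ξ⁰ from the other three.
  refine ⟨J', hsub, ⟨j, hjJ'⟩, fun k p => Q (σ (i₀.succAbove k)) p - c k • Q (σ i₀) p, hJ'o,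
    hF.mono hsub, hG.mono hsub, fun k => (h.smooth _).sub ((h.smooth (σ i₀)).const_smul (c k)),
    fun k p hp => ?_, fun k => (h.symmetry _).sub_smul hJ'o (h.smooth _) (h.smooth _)
      (h.symmetry _) _, fun i k p hp => ?_, fun V hV hVne hVJ d hd => ?_⟩
  · simp [hc k p hp]
  · exact lieBracket_sub_smul (differentiableAt_of_contDiffOn hΩ (h.smooth _) hp)
      (differentiableAt_of_contDiffOn hΩ (h.smooth _) hp)
      (differentiableAt_of_contDiffOn hΩ (h.smooth _) hp) (h.abelian _ _ p hp)
      (h.abelian _ _ p hp) (h.abelian _ _ p hp)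
  · have := h.eq_zero_of_sum hσ hV hVne hVJ
      (c := i₀.insertNth (α := fun _ => ℝ) (-∑ k, d k * c k) d) (fun p hp => by
        rw [Fin.sum_univ_succAbove _ i₀, ← hd p hp]
        simp only [Fin.insertNth_apply_same, Fin.insertNth_apply_succAbove, smul_sub,
          Finset.sum_sub_distrib, neg_smul, Finset.sum_smul, smul_smul]
        abel)
    ext k
    simpa using congrFun this (i₀.succAbove k)

/-- In an algebra of rank one, all `2 × 2` minors vanish. -/
theorem minor_eq_zero_of_rank {Ω : Set Pt} (hr : rank Ω Q = 1) (i k : ι) {p : Pt} (hp : p ∈ Ω)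
    (l₁ l₂ : Pt →ₗ[ℝ] ℝ) : l₁ (Q i p) * l₂ (Q k p) - l₂ (Q i p) * l₁ (Q k p) = 0 := by
  -- The infimum of the empty set is 0, so the value 1 means that the set is non-empty and contains
  -- 1.
  have hmem := Nat.sInf_mem (Nat.nonempty_of_sInf_eq_succ hr)
  change rank Ω Q ∈ _ at hmem
  rw [hr] at hmem
  have h1 : ExteriorAlgebra.ιMulti ℝ 2 (fun m => Q (![i, k] m) p) = 0 := hmem.2 ![i, k] p hp
  -- A linear form on the exterior algebra is built from alternating maps in all degrees; here only
  -- degree 2 is nonzero and carries the minor.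
  let f : (m : ℕ) → Pt [⋀^Fin m]→ₗ[ℝ] ℝ := fun m => if h : m = 2 then by
    subst h
    exact (Matrix.detRowAlternating (n := Fin 2) (R := ℝ)).compLinearMap
      (LinearMap.pi ![l₁, l₂]) else 0
  have h2 := ExteriorAlgebra.liftAlternating_apply_ιMulti f (fun m => Q (![i, k] m) p)
  rw [h1, map_zero] at h2
  have h3 : f 2 = (Matrix.detRowAlternating (n := Fin 2) (R := ℝ)).compLinearMap
    (LinearMap.pi ![l₁, l₂]) := by simp [f]
  rw [h3] at h2
  have h4 : Matrix.det (Matrix.of fun m => LinearMap.pi ![l₁, l₂] (Q (![i, k] m) p)) = 0 := h2.symm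
  rw [Matrix.det_fin_two] at h4
  simpa using h4

/-- Where ξ⁰ of Q i is nonzero, that of Q k is a constant multiple of it; the minors with the
∂_t-component then extend the same factor to all components, against independence. A second index k
is needed for this. -/
theorem IsAbelianSymmetryAlgebra.fst_eq_zero_of_minor (h : IsAbelianSymmetryAlgebra J F G Q)
    (hJ : IsOpen J) (hF0 : ∀ j ∈ J, F j ≠ 0)
    (hm : ∀ i k, ∀ p ∈ base '' J, ∀ l₁ l₂ : Pt →ₗ[ℝ] ℝ,
      l₁ (Q i p) * l₂ (Q k p) - l₂ (Q i p) * l₁ (Q k p) = 0) {i k : ι} (hik : i ≠ k) :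
    ∀ p ∈ base '' J, (Q i p).1 = 0 := by
  rintro _ ⟨j, hj, rfl⟩
  by_contra hj0
  obtain ⟨J', hJ'S, hJ'o, hJ'c, hjJ'⟩ := exists_connected hJ
    (orderZero_tauJ hJ (h.smooth i)).smooth rfl (j := j) ⟨hj, hj0⟩
  have hsub : J' ⊆ J := fun j hj => (hJ'S hj).1
  replace h := h.mono hsub
  have h0 : ∀ p ∈ base '' J', (Q i p).1 ≠ 0 := by
    rintro _ ⟨j, hj, rfl⟩
    exact (hJ'S hj).2
  obtain ⟨c, hc⟩ := exists_fst_eq_const_mul hJ'o hJ'c (h.smooth i) (h.smooth k)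
    (fun j hj => hF0 j (hsub hj)) (h.symmetry _) (h.symmetry _) (h.abelian _ _) h0
  have hinj : Function.Injective ![i, k] := by
    intro a b hab
    fin_cases a <;> fin_cases b <;> simp_all
  have := h.eq_zero_of_sum hinj (isOpen_base_image hJ'o) ⟨_, mem_image_of_mem _ hjJ'⟩ Subset.rfl
    (c := ![c, -1]) (fun p hp => by
      have hp' := image_mono hsub hp
      have m1 := hm i k p hp' (LinearMap.fst ℝ ℝ (ℝ × ℝ))
        (LinearMap.fst ℝ ℝ ℝ ∘ₗ LinearMap.snd ℝ ℝ (ℝ × ℝ))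
      have m2 := hm i k p hp' (LinearMap.fst ℝ ℝ (ℝ × ℝ))
        (LinearMap.snd ℝ ℝ ℝ ∘ₗ LinearMap.snd ℝ ℝ (ℝ × ℝ))
      simp only [LinearMap.fst_apply, LinearMap.snd_apply, LinearMap.comp_apply, hc p hp] at m1 m2
      have e1 : (Q k p).2.1 = c * (Q i p).2.1 :=
        mul_left_cancel₀ (h0 p hp) (by linear_combination m1)
      have e2 : (Q k p).2.2 = c * (Q i p).2.2 :=
        mul_left_cancel₀ (h0 p hp) (by linear_combination m2)
      rw [Fin.sum_univ_two]
      refine Prod.ext ?_ (Prod.ext ?_ ?_) <;> simp [hc p hp, e1, e2])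
  simpa using congrFun this 1

theorem nonempty_embedding_of_le_card {n : ℕ} (h : (n : ℕ∞) ≤ ENat.card ι) :
    Nonempty (Fin n ↪ ι) := by
  rw [ENat.card, Cardinal.natCast_le_toENat] at h
  rw [← Cardinal.lift_mk_le']
  simpa using h

/-- The rank hypothesis takes the form of vanishing minors because these restrict trivially to
smaller open sets. -/
theorem IsAbelianSymmetryAlgebra.exists_linearizableNear (h : IsAbelianSymmetryAlgebra J F G Q)
    (hJ : IsOpen J) (hne : J.Nonempty) (hF : ContDiffOn ℝ ∞ F J) (hG : ContDiffOn ℝ ∞ G J)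
    (hF0 : ∀ j ∈ J, F j ≠ 0)
    (hdim : 4 ≤ ENat.card ι ∨ (ENat.card ι = 3 ∧ ∀ i k, ∀ p ∈ base '' J, ∀ l₁ l₂ : Pt →ₗ[ℝ] ℝ,
      l₁ (Q i p) * l₂ (Q k p) - l₂ (Q i p) * l₁ (Q k p) = 0)) :
    ∃ j ∈ J, LinearizableNear F G j := by
  rcases hdim with hdim | ⟨hdim, hm⟩
  · obtain ⟨σ⟩ := nonempty_embedding_of_le_card (n := 4) (by exact_mod_cast hdim)
    obtain ⟨J', hsub, hne', R, hR⟩ := h.exists_triple hJ hne hF hG hF0 σ.injective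
    obtain ⟨j, hj, hl⟩ := hR.exists_linearizableNear (fun j hj => hF0 j (hsub hj)) hne'
    exact ⟨j, hsub hj, hl⟩
  · obtain ⟨σ⟩ := nonempty_embedding_of_le_card (n := 3) (by exact_mod_cast hdim.ge)
    refine (h.triple hJ hF hG σ.injective fun i => ?_).exists_linearizableNear hF0 hne
    -- Addition in `Fin 3` is cyclic, so `i + 1` provides a second index for every i.
    have hne : i ≠ i + 1 := by decide +revert
    exact h.fst_eq_zero_of_minor hJ hF0 hm (σ.injective.ne hne)

end Algebra

/-! ### Openness and density of the linearizable points. -/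

theorem isOpen_setOf_linearizableNear (F G : Jet → ℝ) : IsOpen {j | LinearizableNear F G j} := by
  rw [isOpen_iff_mem_nhds]
  rintro j ⟨W, e, f, h₂, h₁, h₀, g, hW, hj, h⟩
  exact mem_of_superset (hW.mem_nhds hj) fun j' hj' => ⟨W, e, f, h₂, h₁, h₀, g, hW, hj', h⟩

end EvolutionEq

theorem corollary4p1 {ι : Type*} (J : Set EvolutionEq.Jet) (hJ : IsOpen J)
    (F G : EvolutionEq.Jet → ℝ) (hF : ContDiffOn ℝ ∞ F J) (hG : ContDiffOn ℝ ∞ G J)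
    (hF0 : ∀ j ∈ J, F j ≠ 0)
    (Q : ι → EvolutionEq.Pt → EvolutionEq.Pt)
    (hQ : EvolutionEq.IsAbelianSymmetryAlgebra J F G Q)
    (hdim : 4 ≤ ENat.card ι ∨
      (ENat.card ι = 3 ∧ EvolutionEq.rank (EvolutionEq.base '' J) Q = 1)) :
    ∃ O : Set EvolutionEq.Jet, IsOpen O ∧ O ⊆ J ∧ J ⊆ closure O ∧
      ∀ j ∈ O, EvolutionEq.LinearizableNear F G j := by
  refine ⟨J ∩ {j | EvolutionEq.LinearizableNear F G j},
    hJ.inter (EvolutionEq.isOpen_setOf_linearizableNear F G), inter_subset_left, fun j hj => ?_,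
    fun j hj => hj.2⟩
  rw [mem_closure_iff]
  intro S hS hjS
  have hsub : S ∩ J ⊆ J := inter_subset_right
  -- The existence result is applied over `S ∩ J`, to which all hypotheses restrict; linearizability
  -- near a point does not refer to `J`.
  obtain ⟨j', hj', hl⟩ := (hQ.mono hsub).exists_linearizableNear (hS.inter hJ) ⟨j, hjS, hj⟩
    (hF.mono hsub) (hG.mono hsub) (fun j hj => hF0 j (hsub hj))
    (hdim.imp id fun h => ⟨h.1, fun i k p hp l₁ l₂ =>
      EvolutionEq.minor_eq_zero_of_rank h.2 i k (image_mono hsub hp) l₁ l₂⟩)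
  exact ⟨j', hj'.1, hj'.2, hl⟩
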